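/- Conventions. A circle in $\mathbb{R}^2$ with centre $p=(p_1,p_2)$ and radius $r>0$ has the vertical poles $(p_1\pm r,p_2)$ and the horizontal poles $(p_1,p_2\pm r)$; it is the zero set of either polynomial $\pm(r^2-|x-p|^2)$. Let $D\subset\mathbb{R}^2$ be a non-empty connected open set with compact closure, let $S_1,\dots,S_{l_1}$ be circles with chosen polynomials $f_1,\dots,f_{l_1}$ of this form, and let $\mu:\{1,\dots,l_1\}\to\{1,\dots,l_2\}$ be a surjection. Call $(D,\{S_j\},\mu)$ admissible if (1) for every sufficiently small open neighbourhood $U$ of $\overline{D}$ one has $D=U\cap\bigcap_j\{f_j>0\}$; (2) for every non-empty index set $J$ and every $p\in\overline{D}\cap\bigcap_{j\in J}S_j$, $\dim\bigcap_{j\in J}T_pS_j=2-|J|$; (3) $\mu$ is injective on every non-empty $J$ with $\overline{D}\cap\bigcap_{j\in J}S_j\ne\emptyset$. For admissible data and $k:\{1,\dots,l_2\}\to\{0,1,2,\dots\}$ let $Z\subset\mathbb{R}^2\times\prod_i\mathbb{R}^{k(i)+1}$ be the set of all $(x,y_1,\dots,y_{l_2})$ with $\prod_{\mu(j)=i}f_j(x)=\|y_i\|^2$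 for all $i$. For every sufficiently small open neighbourhood $U$ of $\overline{D}$ the part of $Z$ over $U$ equals the part $M$ of $Z$ over $\overline{D}$; the projection $f:M\to\mathbb{R}^2$, $(x,y)\mapsto x$, is the moment-like map reconstructed from the data $(D,\{S_j\},\mu,k)$, and $f_0:=\pi_{2,1}\circ f$ is its first coordinate. The Reeb graph of $f_0$ is the space of connected components of level sets of $f_0$ with the quotient topology; its vertices are the classes that contain a singular point of $f_0$, and its edges are the connected components of the complement of the vertex set. Graphs are finite, may have multiple edges and have no loops; an isomorphism of graphs is a homeomorphism that maps vertices onto vertices and edges onto edges. A function on a manifold is Morse-Bott if it is smooth and, around each singular point, the composition of a submersion with a Morse function. Theorem. Let $l_{1,2}\ge 1$, let $(D_1,\{S_{1,j}\}_{j=1}^{l_{1,1}},\mu_1)$ be admissible with $\mu_1:\{1,\dots,l_{1,1}\}\to\{1,\dots,l_{1,2}\}$, and let $k_1:\{1,\dots,l_{1,2}\}\to\{1,2,\dots\}$ have positive values. Suppose that $\overline{D_1}-D_1\subset\bigcup_jS_{1,j}$, that $(\overline{D_1}-D_1)\cap S_{1,j}\ne\emptyset$ for each $j$, and that no circle $S_{1,j}$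 contains a vertical or horizontal pole of another circle of the family. Let $M_1$ be the manifold and $f_{0,1}:M_1\to\mathbb{R}$ the function obtained from these data and $k_1$. Then the Reeb graph $W_{f_{0,1}}$ is a graph, and for each edge $e_i$ of it and each function $k:\{1,\dots,l_{1,2}+1\}\to\{1,2,\dots\}$ with positive values that extends $k_1$ there are admissible data $(D,\{S_j\}_{j=1}^{l_1},\mu)$ with $l_1=l_{1,1}+1$ and $\mu:\{1,\dots,l_1\}\to\{1,\dots,l_2\}$, $l_2=l_{1,2}+1$, such that the following hold for the moment-like map $f:M\to\mathbb{R}^2$ reconstructed from $(D,\{S_j\},\mu,k)$. (1) $D$ is a non-empty connected open proper subset of $D_1$; $S_j=S_{1,j}$ for $1\le j\le l_{1,1}$; $(\overline{D}-D)\cap S_j\ne\emptyset$ for $1\le j\le l_{1,1}$; $\mu$ extends $\mu_1$ and $\mu(l_1)=l_2$; the set $S_{l_1}\cap S_{1,j}$ is non-empty for a unique $j\in\{1,\dots,l_{1,1}\}$, and it then consists of exactly two points. (2) $M$ is a closed connected non-singular real algebraic manifold of dimension $2+\sum_{i=1}^{l_{1,2}+1}k(i)$. If, moreover, the whole plane can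 be taken as the neighbourhood $U$ in the construction of $M_1$ (that is, if $M_1$ is the whole set $Z$ of its data), then $M$ is the zero set of a real polynomial map, namely the whole set $Z$ of the new data. (3) $f_0=\pi_{2,1}\circ f$ is a Morse-Bott function. (4) The Reeb graph $W_{f_0}$ is a graph, and it is isomorphic to the graph obtained from $W_{f_{0,1}}$ by adding exactly two vertices in the interior of the edge $e_i$. -/

import Mathlib

open scoped ContDiff

/-! ### Circles in the plane -/

/-- A circle in the plane `ℝ²` (coordinates `x 0`, `x 1`), together with one of the two polynomials
`r² - |x - p|²` (if `inside = true`) and `|x - p|² - r²` (if `inside = false`) defining it. -/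
structure OrientedCircle where
  /-- the centre -/
  center : Fin 2 → ℝ
  /-- the radius -/
  radius : ℝ
  radius_pos : 0 < radius
  /-- which of the two polynomials is used -/
  inside : Bool

namespace OrientedCircle

/-- The real polynomial in two variables attached to the circle. -/
noncomputable def poly (S : OrientedCircle) : MvPolynomial (Fin 2) ℝ :=
  if S.inside then
    MvPolynomial.C (S.radius ^ 2) - (MvPolynomial.X 0 - MvPolynomial.C (S.center 0)) ^ 2
      - (MvPolynomial.X 1 - MvPolynomial.C (S.center 1)) ^ 2
  else
    (MvPolynomial.X 0 - MvPolynomial.C (S.center 0)) ^ 2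
      + (MvPolynomial.X 1 - MvPolynomial.C (S.center 1)) ^ 2 - MvPolynomial.C (S.radius ^ 2)

/-- The polynomial function of `S.poly`. -/
noncomputable def val (S : OrientedCircle) (x : Fin 2 → ℝ) : ℝ := MvPolynomial.eval x S.poly

/-- The circle as a subset of the plane: the zero set of its polynomial. -/
def carrier (S : OrientedCircle) : Set (Fin 2 → ℝ) := {x | S.val x = 0}

/-- The two vertical poles `(p₁ ± r, p₂)`. -/
def verticalPoles (S : OrientedCircle) : Set (Fin 2 → ℝ) :=
  {![S.center 0 - S.radius, S.center 1], ![S.center 0 + S.radius, S.center 1]}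

/-- The two horizontal poles `(p₁, p₂ ± r)`. -/
def horizontalPoles (S : OrientedCircle) : Set (Fin 2 → ℝ) :=
  {![S.center 0, S.center 1 - S.radius], ![S.center 0, S.center 1 + S.radius]}

/-- The tangent space of the circle at one of its points `p`, as a subspace of `ℝ²`: the kernel
of the differential of the defining polynomial. -/
noncomputable def tangent (S : OrientedCircle) (p : Fin 2 → ℝ) : Submodule ℝ (Fin 2 → ℝ) :=
  LinearMap.ker (fderiv ℝ S.val p).toLinearMap

theorem contDiff_val (S : OrientedCircle) : ContDiff ℝ ∞ S.val := by
  unfold val poly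
  cases S.inside <;> simp <;> fun_prop

end OrientedCircle

/-! ### The data of a moment-like map over a plane region bounded by circles -/

/-- The conditions under which a plane region `D`, circles `C j` and a map `μ` of index sets
define a moment-like map. -/
structure IsMomentData {l₁ l₂ : ℕ} (D : Set (Fin 2 → ℝ)) (C : Fin l₁ → OrientedCircle)
    (μ : Fin l₁ → Fin l₂) : Prop where
  isOpen : IsOpen D
  isConnected : IsConnected D
  isCompact_closure : IsCompact (closure D)
  /-- For every sufficiently small open neighbourhood `U` of the closure of `D`, the region `D` is
  the set of the points of `U` at which all the polynomials are positive. -/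
  eq_pos : ∃ U₀ : Set (Fin 2 → ℝ), IsOpen U₀ ∧ closure D ⊆ U₀ ∧
    ∀ U : Set (Fin 2 → ℝ), IsOpen U → closure D ⊆ U → U ⊆ U₀ →
      D = U ∩ ⋂ j, {x | 0 < (C j).val x}
  /-- Transversality: at a point of the closure of `D` that lies on the circles indexed by `J`, the
  intersection of the tangent spaces has dimension `2 - |J|`. -/
  transverse : ∀ J : Finset (Fin l₁), J.Nonempty →
    ∀ p ∈ (⋂ j ∈ J, (C j).carrier) ∩ closure D,
      Module.finrank ℝ (⨅ j ∈ J, (C j).tangent p : Submodule ℝ (Fin 2 → ℝ)) + J.card = 2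
  surjective : Function.Surjective μ
  injOn : ∀ J : Finset (Fin l₁), J.Nonempty →
    ((⋂ j ∈ J, (C j).carrier) ∩ closure D).Nonempty → Set.InjOn μ (J : Set (Fin l₁))

/-- The index set of the coordinates `(x, y₁, …, y_{l₂})` of `ℝ² × ∏ i, ℝ^{k i + 1}`. -/
abbrev MomentIndex {l₂ : ℕ} (k : Fin l₂ → ℕ) : Type :=
  Fin 2 ⊕ (Σ i : Fin l₂, Fin (k i + 1))

/-- The affine space `ℝ² × ∏ i, ℝ^{k i + 1}`. -/
abbrev MomentSpace {l₂ : ℕ} (k : Fin l₂ → ℕ) : Type := MomentIndex k → ℝ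

section Moment

variable {l₁ l₂ : ℕ} (C : Fin l₁ → OrientedCircle) (μ : Fin l₁ → Fin l₂) (k : Fin l₂ → ℕ)

/-- The polynomial `∏_{μ j = i} f_j (x) - ‖y_i‖²`. -/
noncomputable def momentPoly (i : Fin l₂) : MvPolynomial (MomentIndex k) ℝ :=
  (∏ j with μ j = i, MvPolynomial.rename Sum.inl (C j).poly)
    - ∑ s : Fin (k i + 1), MvPolynomial.X (Sum.inr ⟨i, s⟩) ^ 2

/-- The projection `(x, y) ↦ x` onto the plane. -/
def momentProj (p : MomentSpace k) : Fin 2 → ℝ := fun a => p (Sum.inl a)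

/-- The zero set, in the whole affine space, of the polynomial map with components
`momentPoly C μ k i`. -/
def momentZeroSet : Set (MomentSpace k) :=
  {p | ∀ i, MvPolynomial.eval p (momentPoly C μ k i) = 0}

/-- The manifold of the moment-like map: the part of the zero set that lies over the closure of `D`
(equivalently over any sufficiently small open neighbourhood of the closure of `D`, see
`exists_momentManifold_eq`). The moment-like map is the restriction of `momentProj k` to it. -/
def momentManifold (D : Set (Fin 2 → ℝ)) : Set (MomentSpace k) :=
  {p | momentProj k p ∈ closure D ∧ p ∈ momentZeroSet C μ k}

/-- The composition of `momentProj k` with the projection of the plane to the first coordinate. -/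
def momentFun (p : MomentSpace k) : ℝ := momentProj k p 0

/-- If the data are admissible, the part of the zero set over a sufficiently small open
neighbourhood of the closure of `D` does not depend on the neighbourhood, and is the set
`momentManifold C μ k D`. -/
theorem exists_momentManifold_eq {D : Set (Fin 2 → ℝ)} (h : IsMomentData D C μ) :
    ∃ U₀ : Set (Fin 2 → ℝ), IsOpen U₀ ∧ closure D ⊆ U₀ ∧
      ∀ U : Set (Fin 2 → ℝ), IsOpen U → closure D ⊆ U → U ⊆ U₀ →
        {p | momentProj k p ∈ U ∧ p ∈ momentZeroSet C μ k} = momentManifold C μ k D := by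
  classical
  obtain ⟨U₁, hU₁o, hDU₁, hU₁⟩ := h.eq_pos
  have hD : D = U₁ ∩ ⋂ j, {x | 0 < (C j).val x} := hU₁ U₁ hU₁o hDU₁ subset_rfl
  have hcont : ∀ j, Continuous (C j).val := fun j => (C j).contDiff_val.continuous
  have hnn : ∀ j, ∀ p ∈ closure D, 0 ≤ (C j).val p := by
    intro j
    have : closure D ⊆ {x | 0 ≤ (C j).val x} := by
      refine closure_minimal ?_ (isClosed_le continuous_const (hcont j))
      intro x hx
      rw [hD] at hx
      have hxj : 0 < (C j).val x := Set.mem_iInter.1 hx.2 j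
      exact hxj.le
    exact this
  have key : ∀ p ∈ closure D, ∀ᶠ x in nhds p,
      (∀ i, 0 ≤ ∏ j with μ j = i, (C j).val x) → x ∈ closure D := by
    intro p hp
    set J : Finset (Fin l₁) := Finset.univ.filter fun j => (C j).val p = 0 with hJ
    have hpJ : p ∈ (⋂ j ∈ J, (C j).carrier) ∩ closure D := by
      refine ⟨?_, hp⟩
      simp only [Set.mem_iInter]
      intro j hj
      exact (Finset.mem_filter.1 hj).2
    have hv : ∃ v : Fin 2 → ℝ, ∀ j ∈ J, fderiv ℝ (C j).val p v = 1 := by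
      rcases J.eq_empty_or_nonempty with h0 | hne
      · exact ⟨0, by simp [h0]⟩
      have hdim := h.transverse J hne p hpJ
      let L : (Fin 2 → ℝ) →ₗ[ℝ] (J → ℝ) :=
        LinearMap.pi fun j => (fderiv ℝ (C j.1).val p).toLinearMap
      have hker : LinearMap.ker L = ⨅ j ∈ J, (C j).tangent p := by
        rw [LinearMap.ker_pi, iInf_subtype]
        rfl
      have hrank := L.finrank_range_add_finrank_ker
      rw [hker] at hrank
      have hr : Module.finrank ℝ (LinearMap.range L) = Module.finrank ℝ (J → ℝ) := by
        simp only [Module.finrank_fintype_fun_eq_card, Fintype.card_fin, Fintype.card_coe] at *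
        omega
      have hsurj : Function.Surjective L :=
        LinearMap.range_eq_top.1 (Submodule.eq_top_of_finrank_eq hr)
      obtain ⟨v, hv⟩ := hsurj fun _ => 1
      exact ⟨v, fun j hj => congrFun hv ⟨j, hj⟩⟩
    obtain ⟨v, hv⟩ := hv
    have e1 : ∀ᶠ x in nhds p, x ∈ U₁ := hU₁o.mem_nhds (hDU₁ hp)
    have e2 : ∀ᶠ x in nhds p, ∀ j, j ∉ J → 0 < (C j).val x := by
      rw [Filter.eventually_all]
      intro j
      by_cases hj : j ∈ J
      · simp [hj]
      have h0 : 0 < (C j).val p := by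
        refine lt_of_le_of_ne (hnn j p hp) fun h0 => hj ?_
        simp [hJ, h0.symm]
      filter_upwards [(hcont j).continuousAt.eventually (lt_mem_nhds h0)] with x hx _
      exact hx
    have e3 : ∀ᶠ x in nhds p, ∀ j, j ∈ J → 0 < fderiv ℝ (C j).val x v := by
      rw [Filter.eventually_all]
      intro j
      by_cases hj : j ∈ J
      · have hc : Continuous fun x => fderiv ℝ (C j).val x v :=
          ((C j).contDiff_val.continuous_fderiv (by simp)).clm_apply continuous_const
        have h0 : 0 < fderiv ℝ (C j).val p v := by rw [hv j hj]; exact one_pos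
        filter_upwards [hc.continuousAt.eventually (lt_mem_nhds h0)] with x hx _
        exact hx
      · simp [hj]
    filter_upwards [e1, e2, e3] with x h1 h2 h3 hP
    have hge : ∀ j ∈ J, 0 ≤ (C j).val x := by
      intro j hj
      have hprod := hP (μ j)
      have hmem : j ∈ Finset.univ.filter fun j' => μ j' = μ j :=
        Finset.mem_filter.2 ⟨Finset.mem_univ j, rfl⟩
      rw [← Finset.mul_prod_erase _ (fun j' => (C j').val x) hmem] at hprod
      refine nonneg_of_mul_nonneg_left hprod (Finset.prod_pos fun j' hj' => h2 j' fun hj'J => ?_)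
      obtain ⟨hne, hm⟩ := Finset.mem_erase.1 hj'
      exact hne (h.injOn J ⟨j, hj⟩ ⟨p, hpJ⟩ hj'J hj (Finset.mem_filter.1 hm).2)
    have hline : Continuous fun t : ℝ => x + t • v := by fun_prop
    have ht : ∀ᶠ t : ℝ in nhdsWithin 0 (Set.Ioi 0), x + t • v ∈ D := by
      rw [hD]
      have a1 : ∀ᶠ t : ℝ in nhdsWithin 0 (Set.Ioi 0), x + t • v ∈ U₁ := by
        refine (hline.continuousAt.eventually
          (hU₁o.mem_nhds ?_)).filter_mono nhdsWithin_le_nhds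
        simpa using h1
      have a2 : ∀ᶠ t : ℝ in nhdsWithin 0 (Set.Ioi 0), ∀ j, 0 < (C j).val (x + t • v) := by
        rw [Filter.eventually_all]
        intro j
        by_cases hj : j ∈ J
        · have hd : HasDerivAt (fun t : ℝ => (C j).val (x + t • v))
              (fderiv ℝ (C j).val x v) 0 := by
            have hf : HasFDerivAt (C j).val (fderiv ℝ (C j).val x) (x + (0 : ℝ) • v) := by
              simpa using (((C j).contDiff_val.differentiable (by simp)) x).hasFDerivAt
            have hg : HasDerivAt (fun t : ℝ => x + t • v) v 0 := by
              simpa using ((hasDerivAt_id (0 : ℝ)).smul_const v).const_add x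
            exact hf.comp_hasDerivAt 0 hg
          have hs := (hasDerivAt_iff_tendsto_slope.1 hd).eventually (lt_mem_nhds (h3 j hj))
          have hs' := hs.filter_mono (nhdsWithin_mono (0 : ℝ) fun t (ht : 0 < t) => ne_of_gt ht)
          filter_upwards [hs', self_mem_nhdsWithin] with t hst htp
          have htp : 0 < t := htp
          rw [slope_def_field] at hst
          simp only [zero_smul, add_zero, sub_zero] at hst
          have := (div_pos_iff_of_pos_right htp).1 hst
          linarith [hge j hj]
        · refine ((hcont j).comp hline).continuousAt.eventually
            (lt_mem_nhds ?_) |>.filter_mono nhdsWithin_le_nhds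
          simpa using h2 j hj
      filter_upwards [a1, a2] with t b1 b2
      exact ⟨b1, Set.mem_iInter.2 b2⟩
    refine mem_closure_of_tendsto (b := nhdsWithin (0 : ℝ) (Set.Ioi 0)) ?_ ht
    have := hline.tendsto 0
    simp only [zero_smul, add_zero] at this
    exact this.mono_left nhdsWithin_le_nhds
  let G : Set (Fin 2 → ℝ) :=
    {x | (∀ i, 0 ≤ ∏ j with μ j = i, (C j).val x) → x ∈ closure D}
  refine ⟨interior G, isOpen_interior, fun p hp => mem_interior_iff_mem_nhds.2 (key p hp), ?_⟩
  intro U _ hDU hU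
  ext p
  constructor
  · rintro ⟨hpU, hpZ⟩
    refine ⟨interior_subset (hU hpU) fun i => ?_, hpZ⟩
    have := hpZ i
    simp only [momentPoly, map_sub, map_prod, MvPolynomial.eval_rename, map_sum, map_pow,
      MvPolynomial.eval_X, sub_eq_zero] at this
    have h2 : ∏ j with μ j = i, (C j).val (momentProj k p) =
        ∑ s : Fin (k i + 1), p (Sum.inr ⟨i, s⟩) ^ 2 := this
    rw [h2]
    positivity
  · rintro ⟨hp, hpZ⟩
    exact ⟨hDU hp, hpZ⟩

end Moment

/-! ### Submanifolds of affine space and Morse-Bott functions on them -/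

section Manifold

variable {σ : Type} [Fintype σ]

/-- `M` is a smooth submanifold of `ℝ^σ` of dimension `d`, without boundary: near each of its
points a smooth change of coordinates maps `M` to the linear subspace `ℝ^d × 0`. -/
def IsSmoothSubmanifold (d : ℕ) (M : Set (σ → ℝ)) : Prop :=
  ∀ p ∈ M, ∃ (r : ℕ) (Φ : OpenPartialHomeomorph (σ → ℝ) ((Fin d → ℝ) × (Fin r → ℝ))),
    p ∈ Φ.source ∧ ContDiffOn ℝ ∞ Φ Φ.source ∧ ContDiffOn ℝ ∞ Φ.symm Φ.target ∧
      ∀ q ∈ Φ.source, q ∈ M ↔ (Φ q).2 = 0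

/-- `M` is a non-singular real algebraic manifold of dimension `d` in `ℝ^σ`: a union of connected
components of the common zero set of finitely many real polynomials whose gradients are linearly
independent at every point of `M`, their number being the codimension of `M`. -/
def IsNonsingularAlgebraic (d : ℕ) (M : Set (σ → ℝ)) : Prop :=
  ∃ (r : ℕ) (F : Fin r → MvPolynomial σ ℝ),
    d + r = Fintype.card σ ∧
    (∀ p ∈ M, p ∈ {q : σ → ℝ | ∀ i, MvPolynomial.eval q (F i) = 0} ∧
      connectedComponentIn {q : σ → ℝ | ∀ i, MvPolynomial.eval q (F i) = 0} p ⊆ M) ∧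
    ∀ p ∈ M, LinearIndependent ℝ fun (i : Fin r) (s : σ) =>
      MvPolynomial.eval p (MvPolynomial.pderiv s (F i))

/-- The tangent space of the submanifold `M` at `p`: the velocities of smooth curves in `M`. -/
def tangentVectors (M : Set (σ → ℝ)) (p : σ → ℝ) : Set (σ → ℝ) :=
  {v | ∃ γ : ℝ → (σ → ℝ), ContDiffAt ℝ ∞ γ 0 ∧ γ 0 = p ∧ (∀ᶠ t in nhds 0, γ t ∈ M) ∧
    deriv γ 0 = v}

/-- The singular points of the restriction to the submanifold `M` of the smooth function `c`. -/
def singularPoints (M : Set (σ → ℝ)) (c : (σ → ℝ) → ℝ) : Set (σ → ℝ) :=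
  {p | p ∈ M ∧ ∀ v ∈ tangentVectors M p, fderiv ℝ c p v = 0}

/-- `g` is a Morse function on the open subset `W` of `ℝⁿ`: it is smooth and its Hessian is
non-degenerate at each of its singular points. -/
def IsMorseOn {n : ℕ} (g : (Fin n → ℝ) → ℝ) (W : Set (Fin n → ℝ)) : Prop :=
  ContDiffOn ℝ ∞ g W ∧
    ∀ w ∈ W, fderiv ℝ g w = 0 →
      ∀ u : Fin n → ℝ, (∀ v : Fin n → ℝ, fderiv ℝ (fderiv ℝ g) w u v = 0) → u = 0

/-- The restriction of `c` to the submanifold `M` is a Morse-Bott function: it is smooth, and around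
each of its singular points it is the composition of a submersion `s` (from an open subset of `M`
to an open subset `W` of some `ℝⁿ`) with a Morse function `g`. -/
def IsMorseBott (M : Set (σ → ℝ)) (c : (σ → ℝ) → ℝ) : Prop :=
  ContDiff ℝ ∞ c ∧
    ∀ p ∈ singularPoints M c, ∃ (n : ℕ) (W : Set (Fin n → ℝ)) (g : (Fin n → ℝ) → ℝ)
      (V : Set (σ → ℝ)) (s : (σ → ℝ) → (Fin n → ℝ)),
      IsOpen W ∧ IsMorseOn g W ∧ IsOpen V ∧ p ∈ V ∧ ContDiffOn ℝ ∞ s V ∧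
        ∀ q ∈ V ∩ M, s q ∈ W ∧ c q = g (s q) ∧
          ∀ w : Fin n → ℝ, ∃ v ∈ tangentVectors M q, fderiv ℝ s q v = w

end Manifold

/-! ### Graphs and Reeb graphs -/

/-- The edges of a graph with underlying space `W` and vertex set `V`: the connected components of
the complement of the vertex set. -/
def graphEdges {W : Type*} [TopologicalSpace W] (V : Set W) : Set (Set W) :=
  {e | ∃ w ∈ Vᶜ, e = connectedComponentIn Vᶜ w}

/-- `W` is a finite graph (a `1`-dimensional finite CW complex, possibly with multiple edges, but
without loops) with vertex set `V`: there are finitely many vertices and edges, and each edge is an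
open arc whose closure joins two distinct vertices. -/
structure IsGraphWith {W : Type*} [TopologicalSpace W] (V : Set W) : Prop where
  t2 : T2Space W
  finite_vertices : V.Finite
  finite_edges : (graphEdges V).Finite
  edge_arc : ∀ e ∈ graphEdges V, ∃ γ : unitInterval → W, Continuous γ ∧ Function.Injective γ ∧
    γ 0 ∈ V ∧ γ 1 ∈ V ∧ γ '' Set.Ioo 0 1 = e

section Reeb

variable {σ : Type} [Fintype σ] (M : Set (σ → ℝ)) (c : (σ → ℝ) → ℝ)

/-- Two points of `M` are equivalent if they lie in the same connected component of the same level
set of `c` on `M`. -/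
def reebSetoid : Setoid M where
  r x y := (y : σ → ℝ) ∈ connectedComponentIn {z | z ∈ M ∧ c z = c x} x
  iseqv :=
    { refl := fun x => mem_connectedComponentIn ⟨x.2, rfl⟩
      symm := by
        intro x y h
        have hy : c y = c x := (connectedComponentIn_subset _ _ h).2
        have hx := mem_connectedComponentIn
          (show (x : σ → ℝ) ∈ {z | z ∈ M ∧ c z = c x} from ⟨x.2, rfl⟩)
        rw [hy, ← connectedComponentIn_eq h]
        exact hx
      trans := by
        intro x y z hxy hyz
        have hy : c y = c x := (connectedComponentIn_subset _ _ hxy).2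
        rw [hy, ← connectedComponentIn_eq hxy] at hyz
        exact hyz }

/-- The Reeb space of the restriction of `c` to `M`, with the quotient topology. -/
abbrev ReebSpace : Type := Quotient (reebSetoid M c)

/-- The vertices of the Reeb graph: the classes that contain a singular point. -/
def reebVertices : Set (ReebSpace M c) :=
  {w | ∃ p : M, (p : σ → ℝ) ∈ singularPoints M c ∧ Quotient.mk (reebSetoid M c) p = w}

end Reeb

/-! Everything descends to the plane. At a point of the closure the differentials of the vanishing
circle polynomials are independent, by transversality, and each product has at most one vanishing
factor, by injectivity of the index map. Hence the defining equations are regular along the manifold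
(`surjective_fderiv_momentMap`), and the implicit function theorem gives smoothness and the tangent
spaces (`tangentVectors_eq_of_regular`). The singular points of the first coordinate are those over
corners and vertical poles (`mem_singularPoints_iff`). As the `k i` are positive, the fibres are
products of connected spheres and points, so the Reeb space is that of the first coordinate on
`closure D`, where the classes are maximal vertical segments (`IsMomentData.reebHomeomorph`,
`reebSetoid_plane_iff`).

A segment without critical points crosses the region between two circle arcs and deforms with its
abscissa, so the Reeb space has local arcs off finitely many vertices (`exists_slice`,
`hasLocalArcs`). In a compact Hausdorff space such arcs can be followed until they reach vertices,
which yields the graph (`HasLocalArcs.isGraphWith`).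

For the new data, take a class inside the given edge and the upper end `q` of its segment, which
lies on a single circle. A small disc, centred just outside the region on the normal at `q` and
slightly larger than its distance to `q`, bites a cap off the region; its size is chosen so that its
horizontal diameter avoids `closure D` (`exists_cutting_disc`). The cap then lies below the
diameter, so the cut shortens vertical segments only from above. Therefore the region stays
connected and the Reeb space does not change (`isConnected_cutRegion`, `IsCut.reebHomeomorph`), the
vertical poles of the new circle lie outside the region, and the only new critical points are the
two corners (`IsCut.mem_criticalPoints_iff`). These have different abscissae, and as the disc is
small their classes lie in the chosen edge.

For the Morse-Bott property, near each singular point the function is a constant plus a sum of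
squares of independent functions with nonvanishing coefficients (`exists_morse_of_sum_sq`). At a
pole the squares are those of the vertical coordinate and of the fibre coordinates of the circle; at
a corner they are those of the fibre coordinates of both circles. The hypothesis on poles excludes
corners that are vertical poles. -/

/-! ### Circles and their polynomials -/

namespace OrientedCircle

/-- The sign of the polynomial of an oriented circle, relative to `r² - |x - p|²`. -/
noncomputable def sgn (S : OrientedCircle) : ℝ := if S.inside then 1 else -1

theorem sgn_mul_sgn (S : OrientedCircle) : S.sgn * S.sgn = 1 := by
  unfold sgn; split_ifs <;> norm_num

theorem sgn_ne_zero (S : OrientedCircle) : S.sgn ≠ 0 := by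
  unfold sgn; split_ifs <;> norm_num

theorem val_eq (S : OrientedCircle) (x : Fin 2 → ℝ) :
    S.val x = S.sgn * (S.radius ^ 2 - (x 0 - S.center 0) ^ 2 - (x 1 - S.center 1) ^ 2) := by
  unfold val poly sgn
  cases S.inside <;> simp
  ring

theorem continuous_val (S : OrientedCircle) : Continuous S.val := S.contDiff_val.continuous

theorem differentiable_val (S : OrientedCircle) : Differentiable ℝ S.val :=
  S.contDiff_val.differentiable (by simp)

theorem fderiv_val (S : OrientedCircle) (x v : Fin 2 → ℝ) :
    fderiv ℝ S.val x v =
      -2 * S.sgn * ((x 0 - S.center 0) * v 0 + (x 1 - S.center 1) * v 1) := by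
  have h0 : HasFDerivAt (fun y : Fin 2 → ℝ => y 0 - S.center 0)
      (ContinuousLinearMap.proj (R := ℝ) (φ := fun _ : Fin 2 => ℝ) 0) x :=
    (hasFDerivAt_apply (0 : Fin 2) x).sub_const _
  have h1 : HasFDerivAt (fun y : Fin 2 → ℝ => y 1 - S.center 1)
      (ContinuousLinearMap.proj (R := ℝ) (φ := fun _ : Fin 2 => ℝ) 1) x :=
    (hasFDerivAt_apply (1 : Fin 2) x).sub_const _
  have h := (((h0.pow 2).const_sub (S.radius ^ 2)).sub (h1.pow 2)).const_mul S.sgn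
  have h' := h.congr_of_eventuallyEq (f₁ := S.val) (Filter.Eventually.of_forall S.val_eq)
  rw [h'.fderiv]
  simp
  ring

/-- The value at `q + ξ` in terms of the value and the differential at `q`. -/
theorem val_add (S : OrientedCircle) (q ξ : Fin 2 → ℝ) :
    S.val (q + ξ) = S.val q + fderiv ℝ S.val q ξ - S.sgn * (ξ 0 ^ 2 + ξ 1 ^ 2) := by
  rw [val_eq, val_eq, fderiv_val]
  simp only [Pi.add_apply]
  ring

end OrientedCircle

/-! ### Joint kernels of linear forms -/

/-- The common kernel of finitely many linear forms has codimension their number iff the forms take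
all systems of values. -/
theorem finrank_iInf_ker_add_card_iff {E ι : Type*} [AddCommGroup E] [Module ℝ E]
    [FiniteDimensional ℝ E] (J : Finset ι) (φ : ι → E →ₗ[ℝ] ℝ) :
    Module.finrank ℝ (⨅ j ∈ J, LinearMap.ker (φ j) : Submodule ℝ E) + J.card =
        Module.finrank ℝ E ↔
      ∀ c : ι → ℝ, ∃ v, ∀ j ∈ J, φ j v = c j := by
  classical
  let L : E →ₗ[ℝ] (J → ℝ) := LinearMap.pi fun j => φ j.1
  have hker : LinearMap.ker L = ⨅ j ∈ J, LinearMap.ker (φ j) := by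
    rw [LinearMap.ker_pi, iInf_subtype]
  have hrank := L.finrank_range_add_finrank_ker
  rw [hker] at hrank
  have hcard : Module.finrank ℝ (J → ℝ) = J.card := by simp
  constructor
  · intro h c
    have hr : Module.finrank ℝ (LinearMap.range L) = Module.finrank ℝ (J → ℝ) := by omega
    have hsurj : Function.Surjective L :=
      LinearMap.range_eq_top.1 (Submodule.eq_top_of_finrank_eq hr)
    obtain ⟨v, hv⟩ := hsurj fun j => c j.1
    exact ⟨v, fun j hj => congrFun hv ⟨j, hj⟩⟩
  · intro h
    have hsurj : Function.Surjective L := by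
      intro c
      obtain ⟨v, hv⟩ := h fun j => if hj : j ∈ J then c ⟨j, hj⟩ else 0
      refine ⟨v, funext fun j => ?_⟩
      have := hv j.1 j.2
      simpa [L, j.2] using this
    have hr : Module.finrank ℝ (LinearMap.range L) = J.card := by
      rw [LinearMap.range_eq_top.2 hsurj, finrank_top, hcard]
    omega

/-! ### The zero set over a point of the plane -/

section Fibre

variable {l₁ l₂ : ℕ} (C : Fin l₁ → OrientedCircle) (μ : Fin l₁ → Fin l₂) (k : Fin l₂ → ℕ)

/-- The product of the polynomials `f_j` with `μ j = i`. -/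
noncomputable def planeProd (i : Fin l₂) (x : Fin 2 → ℝ) : ℝ := ∏ j with μ j = i, (C j).val x

theorem contDiff_planeProd (i : Fin l₂) : ContDiff ℝ ∞ (planeProd C μ i) := by
  unfold planeProd
  exact contDiff_prod fun j _ => (C j).contDiff_val

theorem continuous_planeProd (i : Fin l₂) : Continuous (planeProd C μ i) :=
  (contDiff_planeProd C μ i).continuous

theorem eval_momentPoly (i : Fin l₂) (p : MomentSpace k) :
    MvPolynomial.eval p (momentPoly C μ k i) =
      planeProd C μ i (momentProj k p) - ∑ s : Fin (k i + 1), p (Sum.inr ⟨i, s⟩) ^ 2 := by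
  simp only [momentPoly, map_sub, map_prod, MvPolynomial.eval_rename, map_sum, map_pow,
    MvPolynomial.eval_X]
  rfl

theorem mem_momentZeroSet_iff (p : MomentSpace k) :
    p ∈ momentZeroSet C μ k ↔
      ∀ i, planeProd C μ i (momentProj k p) = ∑ s : Fin (k i + 1), p (Sum.inr ⟨i, s⟩) ^ 2 := by
  simp only [momentZeroSet, Set.mem_ofPred_eq, eval_momentPoly, sub_eq_zero]

theorem continuous_momentProj : Continuous (momentProj k) :=
  continuous_pi fun _ => continuous_apply _

theorem contDiff_momentProj : ContDiff ℝ ∞ (momentProj k) :=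
  contDiff_pi.2 fun _ => contDiff_apply _ _ _

/-- The section `x ↦ (x, (√F₁(x), 0, …), (√F₂(x), 0, …), …)` of the projection to the plane. -/
noncomputable def momentSection (x : Fin 2 → ℝ) : MomentSpace k
  | Sum.inl a => x a
  | Sum.inr ⟨i, s⟩ => if s = 0 then √(planeProd C μ i x) else 0

theorem momentProj_momentSection (x : Fin 2 → ℝ) :
    momentProj k (momentSection C μ k x) = x := rfl

theorem continuous_momentSection : Continuous (momentSection C μ k) := by
  refine continuous_pi fun a => ?_
  rcases a with a | ⟨i, s⟩
  · exact continuous_apply a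
  · by_cases hs : s = 0
    · simpa [momentSection, hs] using (continuous_planeProd C μ i).sqrt
    · simpa [momentSection, hs] using continuous_const

theorem momentSection_mem {x : Fin 2 → ℝ} (hx : ∀ i, 0 ≤ planeProd C μ i x) :
    momentSection C μ k x ∈ momentZeroSet C μ k := by
  rw [mem_momentZeroSet_iff]
  intro i
  rw [momentProj_momentSection, Finset.sum_eq_single 0]
  · simp [momentSection, Real.sq_sqrt (hx i)]
  · intro s _ hs
    simp [momentSection, hs]
  · simp

theorem planeProd_nonneg_of_mem {p : MomentSpace k} (hp : p ∈ momentZeroSet C μ k) (i : Fin l₂) :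
    0 ≤ planeProd C μ i (momentProj k p) := by
  rw [(mem_momentZeroSet_iff C μ k p).1 hp i]
  positivity

end Fibre

/-! ### The plane region of admissible data -/

namespace IsMomentData

variable {l₁ l₂ : ℕ} {C : Fin l₁ → OrientedCircle} {μ : Fin l₁ → Fin l₂} {D : Set (Fin 2 → ℝ)}

theorem val_nonneg (h : IsMomentData D C μ) {x : Fin 2 → ℝ} (hx : x ∈ closure D) (j : Fin l₁) :
    0 ≤ (C j).val x := by
  obtain ⟨U₁, hU₁o, hDU₁, hU₁⟩ := h.eq_pos
  have hD : D = U₁ ∩ ⋂ j, {x | 0 < (C j).val x} := hU₁ U₁ hU₁o hDU₁ subset_rfl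
  have : closure D ⊆ {x | 0 ≤ (C j).val x} := by
    refine closure_minimal ?_ (isClosed_le continuous_const (C j).continuous_val)
    intro x hx
    rw [hD] at hx
    have hxj : 0 < (C j).val x := Set.mem_iInter.1 hx.2 j
    exact hxj.le
  exact this hx

theorem planeProd_nonneg (h : IsMomentData D C μ) {x : Fin 2 → ℝ} (hx : x ∈ closure D)
    (i : Fin l₂) : 0 ≤ planeProd C μ i x :=
  Finset.prod_nonneg fun j _ => h.val_nonneg hx j

/-- Near its closure, the region is given by the strict inequalities and its closure by the weak
ones. -/
theorem exists_nhds (h : IsMomentData D C μ) :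
    ∃ U : Set (Fin 2 → ℝ), IsOpen U ∧ closure D ⊆ U ∧
      (∀ x ∈ U, (∀ j, 0 < (C j).val x) → x ∈ D) ∧
      (∀ x ∈ U, (∀ i, 0 ≤ planeProd C μ i x) → x ∈ closure D) := by
  obtain ⟨U₁, hU₁o, hDU₁, hU₁⟩ := h.eq_pos
  -- Any `k` serves here: a point with nonnegative products lifts by the section to the zero set,
  -- and over a small neighbourhood the zero set lies over the closure.
  obtain ⟨U₂, hU₂o, hDU₂, hU₂⟩ := exists_momentManifold_eq C μ (fun _ => 0) h
  refine ⟨U₁ ∩ U₂, hU₁o.inter hU₂o, Set.subset_inter hDU₁ hDU₂, ?_, ?_⟩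
  · intro x hx hpos
    rw [hU₁ U₁ hU₁o hDU₁ subset_rfl]
    exact ⟨hx.1, Set.mem_iInter.2 hpos⟩
  · intro x hx hnn
    have : momentSection C μ (fun _ => 0) x ∈ momentManifold C μ (fun _ => 0) D := by
      rw [← hU₂ U₂ hU₂o hDU₂ subset_rfl]
      exact ⟨hx.2, momentSection_mem C μ _ hnn⟩
    exact this.1

theorem mem_iff (h : IsMomentData D C μ) {x : Fin 2 → ℝ} (hx : x ∈ closure D) :
    x ∈ D ↔ ∀ j, 0 < (C j).val x := by
  constructor
  · intro hxD
    obtain ⟨U₁, hU₁o, hDU₁, hU₁⟩ := h.eq_pos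
    rw [hU₁ U₁ hU₁o hDU₁ subset_rfl] at hxD
    exact Set.mem_iInter.1 hxD.2
  · obtain ⟨U, -, hDU, hU, -⟩ := h.exists_nhds
    exact hU x (hDU hx)

/-- At a point of the closure of the region, the differentials of the polynomials that vanish there
take all systems of values. -/
theorem exists_fderiv_eq (h : IsMomentData D C μ) {x : Fin 2 → ℝ} (hx : x ∈ closure D)
    (c : Fin l₁ → ℝ) : ∃ v, ∀ j, (C j).val x = 0 → fderiv ℝ (C j).val x v = c j := by
  classical
  set J : Finset (Fin l₁) := Finset.univ.filter fun j => (C j).val x = 0 with hJ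
  rcases J.eq_empty_or_nonempty with h0 | hne
  · refine ⟨0, fun j hj => ?_⟩
    have : j ∈ J := by simp [hJ, hj]
    simp [h0] at this
  have hxJ : x ∈ (⋂ j ∈ J, (C j).carrier) ∩ closure D := by
    refine ⟨Set.mem_iInter₂.2 fun j hj => ?_, hx⟩
    exact (Finset.mem_filter.1 hj).2
  have hdim := h.transverse J hne x hxJ
  obtain ⟨v, hv⟩ := (finrank_iInf_ker_add_card_iff J
    fun j => (fderiv ℝ (C j).val x).toLinearMap).1 (by
      rw [Module.finrank_fin_fun]; exact hdim) c
  exact ⟨v, fun j hj => hv j (by simp [hJ, hj])⟩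

theorem index_injective (h : IsMomentData D C μ) {x : Fin 2 → ℝ} (hx : x ∈ closure D)
    {j j' : Fin l₁} (hj : (C j).val x = 0) (hj' : (C j').val x = 0) (hμ : μ j = μ j') :
    j = j' := by
  classical
  refine h.injOn {j, j'} (by simp) ⟨x, ?_, hx⟩ (by simp) (by simp) hμ
  simp only [Finset.mem_insert, Finset.mem_singleton, Set.mem_iInter]
  rintro i (rfl | rfl) <;> assumption

end IsMomentData

/-- The points of the closure of the region over which the first coordinate of the moment-like map
has singular points: the corners, and the vertical poles of the circles. -/
def criticalPoints {l₁ : ℕ} (D : Set (Fin 2 → ℝ)) (C : Fin l₁ → OrientedCircle) :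
    Set (Fin 2 → ℝ) :=
  {x | x ∈ closure D ∧
    ∀ v : Fin 2 → ℝ, (∀ j, (C j).val x = 0 → fderiv ℝ (C j).val x v = 0) → v 0 = 0}

/-! ### Connectedness of the fibres and the Reeb space -/

/-- The set is empty, a point or a sphere of dimension `n`, and spheres of positive dimension are
connected; this is where positivity of the multiplicities enters. -/
theorem isPreconnected_setOf_sum_sq_eq {n : ℕ} (hn : 0 < n) (c : ℝ) :
    IsPreconnected {y : Fin (n + 1) → ℝ | ∑ s, y s ^ 2 = c} := by
  rcases lt_or_ge c 0 with hc | hc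
  · have : {y : Fin (n + 1) → ℝ | ∑ s, y s ^ 2 = c} = ∅ := by
      refine Set.eq_empty_of_forall_notMem fun y hy => ?_
      have : 0 ≤ ∑ s, y s ^ 2 := by positivity
      have hy' : ∑ s, y s ^ 2 = c := hy
      linarith
    rw [this]
    exact isPreconnected_empty
  have hrank : 1 < Module.rank ℝ (EuclideanSpace ℝ (Fin (n + 1))) := by
    rw [← Module.finrank_eq_rank, finrank_euclideanSpace_fin]
    exact_mod_cast Nat.succ_lt_succ hn
  have h := (isPreconnected_sphere hrank 0 (√c)).image
    (fun y : EuclideanSpace ℝ (Fin (n + 1)) => (y : Fin (n + 1) → ℝ))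
    (PiLp.continuous_ofLp 2 _).continuousOn
  convert h using 1
  ext y
  simp only [Set.mem_ofPred_eq, Set.mem_image, mem_sphere_iff_norm, sub_zero]
  constructor
  · intro hy
    refine ⟨WithLp.toLp 2 y, ?_, rfl⟩
    rw [EuclideanSpace.norm_eq]
    simp [hy]
  · rintro ⟨z, hz, rfl⟩
    have h2 := EuclideanSpace.norm_sq_eq z
    rw [hz, Real.sq_sqrt hc] at h2
    simpa using h2.symm

section Fibre

variable {l₁ l₂ : ℕ} (C : Fin l₁ → OrientedCircle) (μ : Fin l₁ → Fin l₂) (k : Fin l₂ → ℕ)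

theorem isPreconnected_fibre (hk : ∀ i, 0 < k i) (x : Fin 2 → ℝ) :
    IsPreconnected {p | momentProj k p = x ∧ p ∈ momentZeroSet C μ k} := by
  have hpi : IsPreconnected (Set.univ.pi fun i =>
      {y : Fin (k i + 1) → ℝ | ∑ s, y s ^ 2 = planeProd C μ i x}) :=
    isPreconnected_univ_pi fun i => isPreconnected_setOf_sum_sq_eq (hk i) _
  let g : (∀ i, Fin (k i + 1) → ℝ) → MomentSpace k :=
    fun y => Sum.elim x fun a => y a.1 a.2
  have hg : Continuous g := by
    refine continuous_pi fun a => ?_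
    rcases a with a | a
    · exact continuous_const
    · exact (continuous_apply a.2).comp (continuous_apply a.1)
  convert hpi.image g hg.continuousOn using 1
  ext p
  simp only [mem_momentZeroSet_iff, Set.mem_ofPred_eq, Set.mem_image, Set.mem_univ_pi]
  constructor
  · rintro ⟨hx, hp⟩
    refine ⟨fun i s => p (Sum.inr ⟨i, s⟩), fun i => ?_, ?_⟩
    · rw [← hx]; exact (hp i).symm
    · funext a
      rcases a with a | a
      · exact (congrFun hx a).symm
      · rfl
  · rintro ⟨y, hy, rfl⟩
    exact ⟨rfl, fun i => (hy i).symm⟩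

/-- The section sends `A` to a connected set that meets every fibre, and the fibres are connected.
-/
theorem isPreconnected_preimage_momentProj (hk : ∀ i, 0 < k i) {A : Set (Fin 2 → ℝ)}
    (hA : IsPreconnected A) (hA0 : ∀ x ∈ A, ∀ i, 0 ≤ planeProd C μ i x) :
    IsPreconnected {p | momentProj k p ∈ A ∧ p ∈ momentZeroSet C μ k} := by
  rcases A.eq_empty_or_nonempty with rfl | ⟨x₀, hx₀⟩
  · simpa using isPreconnected_empty
  refine isPreconnected_of_forall (momentSection C μ k x₀) fun p hp => ?_
  refine ⟨momentSection C μ k '' A ∪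
    {q | momentProj k q = momentProj k p ∧ q ∈ momentZeroSet C μ k}, ?_, ?_, ?_, ?_⟩
  · rintro q (⟨x, hx, rfl⟩ | ⟨hq, hqZ⟩)
    · exact ⟨hx, momentSection_mem C μ k (hA0 x hx)⟩
    · exact ⟨hq ▸ hp.1, hqZ⟩
  · exact Or.inl ⟨x₀, hx₀, rfl⟩
  · exact Or.inr ⟨rfl, hp.2⟩
  · exact IsPreconnected.union (momentSection C μ k (momentProj k p)) ⟨_, hp.1, rfl⟩
      ⟨rfl, momentSection_mem C μ k (hA0 _ hp.1)⟩
      (hA.image _ (continuous_momentSection C μ k).continuousOn) (isPreconnected_fibre C μ k hk _)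

end Fibre

namespace IsMomentData

variable {l₁ l₂ : ℕ} {C : Fin l₁ → OrientedCircle} {μ : Fin l₁ → Fin l₂} {D : Set (Fin 2 → ℝ)}

theorem momentSection_mem_manifold (h : IsMomentData D C μ) (k : Fin l₂ → ℕ) {x : Fin 2 → ℝ}
    (hx : x ∈ closure D) : momentSection C μ k x ∈ momentManifold C μ k D :=
  ⟨hx, momentSection_mem C μ k (h.planeProd_nonneg hx)⟩

theorem isConnected_momentManifold (h : IsMomentData D C μ) {k : Fin l₂ → ℕ}
    (hk : ∀ i, 0 < k i) : IsConnected (momentManifold C μ k D) := by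
  refine ⟨?_, isPreconnected_preimage_momentProj C μ k hk h.isConnected.closure.isPreconnected
    fun x hx => h.planeProd_nonneg hx⟩
  obtain ⟨x, hx⟩ := h.isConnected.closure.nonempty
  exact ⟨_, h.momentSection_mem_manifold k hx⟩

theorem isClosed_momentZeroSet (C : Fin l₁ → OrientedCircle) (μ : Fin l₁ → Fin l₂)
    (k : Fin l₂ → ℕ) : IsClosed (momentZeroSet C μ k) := by
  have : momentZeroSet C μ k = ⋂ i, {p | MvPolynomial.eval p (momentPoly C μ k i) = 0} := by
    ext p
    simp [momentZeroSet]
  rw [this]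
  exact isClosed_iInter fun i => isClosed_eq (MvPolynomial.continuous_eval _) continuous_const

/-- Over the compact closure each product is bounded, and it equals the sum of the squares of its
fibre coordinates, so these are bounded as well. -/
theorem isCompact_momentManifold (h : IsMomentData D C μ) (k : Fin l₂ → ℕ) :
    IsCompact (momentManifold C μ k D) := by
  have hclosed : IsClosed (momentManifold C μ k D) :=
    (isClosed_closure.preimage (continuous_momentProj k)).inter (isClosed_momentZeroSet C μ k)
  have hK := h.isCompact_closure
  have hb : ∀ i, ∃ b, ∀ x ∈ closure D, planeProd C μ i x ≤ b := by
    intro i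
    obtain ⟨b, hb⟩ := (hK.image (continuous_planeProd C μ i)).bddAbove
    exact ⟨b, fun x hx => hb ⟨x, hx, rfl⟩⟩
  choose b hb using hb
  have hcomp : IsCompact (Set.univ.pi fun a : MomentIndex k =>
      (Sum.elim (fun a => (fun x : Fin 2 → ℝ => x a) '' closure D)
        (fun s => Set.Icc (-(b s.1 + 1)) (b s.1 + 1)) a : Set ℝ)) := by
    refine isCompact_univ_pi fun a => ?_
    rcases a with a | ⟨i, s⟩
    · exact hK.image (continuous_apply a)
    · exact isCompact_Icc
  refine hcomp.of_isClosed_subset hclosed fun p hp a _ => ?_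
  rcases a with a | ⟨i, s⟩
  · exact ⟨momentProj k p, hp.1, rfl⟩
  · have h1 := (mem_momentZeroSet_iff C μ k p).1 hp.2 i
    have h2 := hb i _ hp.1
    have h3 : p (Sum.inr ⟨i, s⟩) ^ 2 ≤ ∑ s : Fin (k i + 1), p (Sum.inr ⟨i, s⟩) ^ 2 :=
      Finset.single_le_sum (f := fun s : Fin (k i + 1) => p (Sum.inr ⟨i, s⟩) ^ 2)
        (fun s _ => sq_nonneg _) (Finset.mem_univ s)
    -- From `t ^ 2 ≤ b` the bounds `±t ≤ b + 1` follow through `(t ± 1) ^ 2 ≥ 0`.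
    exact ⟨by nlinarith [sq_nonneg (p (Sum.inr ⟨i, s⟩) + 1)],
      by nlinarith [sq_nonneg (p (Sum.inr ⟨i, s⟩) - 1)]⟩

/-- Two points of the manifold are equivalent iff their projections to the plane are. -/
theorem reeb_rel_iff (h : IsMomentData D C μ) {k : Fin l₂ → ℕ} (hk : ∀ i, 0 < k i)
    (p q : momentManifold C μ k D) :
    (reebSetoid (momentManifold C μ k D) (momentFun k)).r p q ↔
      (reebSetoid (closure D) (fun x => x 0)).r ⟨momentProj k p, p.2.1⟩
        ⟨momentProj k q, q.2.1⟩ := by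
  constructor
  · intro hpq
    have hsub : momentProj k '' connectedComponentIn
        {z | z ∈ momentManifold C μ k D ∧ momentFun k z = momentFun k p} p ⊆
        connectedComponentIn {z | z ∈ closure D ∧ z 0 = momentProj k p 0} (momentProj k p) := by
      refine IsPreconnected.subset_connectedComponentIn
        (isPreconnected_connectedComponentIn.image _ (continuous_momentProj k).continuousOn)
        ⟨p, mem_connectedComponentIn ⟨p.2, rfl⟩, rfl⟩ ?_
      rintro _ ⟨z, hz, rfl⟩
      have := connectedComponentIn_subset _ _ hz
      exact ⟨this.1.1, this.2⟩
    exact hsub ⟨q, hpq, rfl⟩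
  · intro hpq
    -- The part of the zero set over a component in the plane is connected, hence stays in one
    -- component of the level set upstairs.
    set A := connectedComponentIn {z | z ∈ closure D ∧ z 0 = momentProj k p 0}
      (momentProj k p) with hA
    have hAsub : A ⊆ {z | z ∈ closure D ∧ z 0 = momentProj k p 0} := connectedComponentIn_subset _ _
    have hpre := isPreconnected_preimage_momentProj C μ k hk
      (isPreconnected_connectedComponentIn : IsPreconnected A)
      fun x hx => h.planeProd_nonneg (hAsub hx).1
    have hpA : momentProj k p ∈ A := mem_connectedComponentIn ⟨p.2.1, rfl⟩
    exact hpre.subset_connectedComponentIn (F := {z | z ∈ momentManifold C μ k D ∧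
      momentFun k z = momentFun k p}) ⟨hpA, p.2.2⟩
      (fun z hz => ⟨⟨(hAsub hz.1).1, hz.2⟩, (hAsub hz.1).2⟩) ⟨hpq, q.2.2⟩

/-- The Reeb space of the first coordinate of the moment-like map is the one of the first
coordinate on the closure of the region. -/
noncomputable def reebHomeomorph (h : IsMomentData D C μ) {k : Fin l₂ → ℕ} (hk : ∀ i, 0 < k i) :
    ReebSpace (momentManifold C μ k D) (momentFun k) ≃ₜ ReebSpace (closure D) (fun x => x 0) where
  toFun := Quotient.map (fun p => ⟨momentProj k p, p.2.1⟩) fun p q hpq =>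
    (h.reeb_rel_iff hk p q).1 hpq
  invFun := Quotient.map (fun x => ⟨momentSection C μ k x, h.momentSection_mem_manifold k x.2⟩)
    fun _ _ hxy => (h.reeb_rel_iff hk _ _).2 hxy
  left_inv := by
    refine Quotient.ind fun p => Quotient.sound ?_
    refine (h.reeb_rel_iff hk _ _).2 ?_
    exact (reebSetoid (closure D) (fun x => x 0)).refl _
  right_inv := by
    refine Quotient.ind fun x => rfl
  continuous_toFun := by
    refine Continuous.quotient_map' ?_ _
    exact ((continuous_momentProj k).comp continuous_subtype_val).subtype_mk _
  continuous_invFun := by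
    refine Continuous.quotient_map' ?_ _
    exact ((continuous_momentSection C μ k).comp continuous_subtype_val).subtype_mk _

theorem reebHomeomorph_mk (h : IsMomentData D C μ) {k : Fin l₂ → ℕ} (hk : ∀ i, 0 < k i)
    (p : momentManifold C μ k D) :
    h.reebHomeomorph hk (Quotient.mk _ p) = Quotient.mk _ ⟨momentProj k p, p.2.1⟩ := rfl

end IsMomentData

/-! ### Regular zero sets -/

section Regular

variable {σ : Type} [Fintype σ]

/-- A smooth map with surjective differential at `p` is the second component of a chart. -/
theorem exists_chart {d r : ℕ} (hdr : d + r = Fintype.card σ) {F : (σ → ℝ) → (Fin r → ℝ)}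
    (hF : ContDiff ℝ ∞ F) {p : σ → ℝ} (hp : Function.Surjective (fderiv ℝ F p)) {O : Set (σ → ℝ)}
    (hO : IsOpen O) (hpO : p ∈ O) :
    ∃ Φ : OpenPartialHomeomorph (σ → ℝ) ((Fin d → ℝ) × (Fin r → ℝ)),
      p ∈ Φ.source ∧ Φ.source ⊆ O ∧ ContDiffOn ℝ ∞ Φ Φ.source ∧
        ContDiffOn ℝ ∞ Φ.symm Φ.target ∧ ∀ q, (Φ q).2 = F q := by
  set L := fderiv ℝ F p with hL
  have hker : Module.finrank ℝ (LinearMap.ker L.toLinearMap) =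
      Module.finrank ℝ (Fin d → ℝ) := by
    have h1 := L.toLinearMap.finrank_range_add_finrank_ker
    rw [LinearMap.range_eq_top.2 hp, finrank_top] at h1
    simp only [Module.finrank_fintype_fun_eq_card, Fintype.card_fin] at h1 ⊢
    omega
  -- A projection `g` onto the kernel of `L` complements `L`: together they form an isomorphism, so
  -- `F` can be completed to local coordinates.
  obtain ⟨g, hg⟩ := LinearMap.exists_leftInverse_of_injective
    (LinearMap.ker L.toLinearMap).subtype (Submodule.ker_subtype _)
  let e := LinearEquiv.ofFinrankEq _ _ hker
  let π : (σ → ℝ) →L[ℝ] (Fin d → ℝ) := (e.toLinearMap ∘ₗ g).toContinuousLinearMap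
  have hinj : Function.Injective (π.prod L).toLinearMap := by
    rw [← LinearMap.ker_eq_bot, LinearMap.ker_eq_bot']
    intro v hv
    have hv1 : e (g v) = 0 := congrArg Prod.fst hv
    have hv2 : L v = 0 := congrArg Prod.snd hv
    have hgv : g v = ⟨v, hv2⟩ := LinearMap.congr_fun hg (⟨v, hv2⟩ : LinearMap.ker L.toLinearMap)
    rw [LinearEquiv.map_eq_zero_iff, hgv] at hv1
    exact congrArg Subtype.val hv1
  have hdim : Module.finrank ℝ (σ → ℝ) = Module.finrank ℝ ((Fin d → ℝ) × (Fin r → ℝ)) := by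
    simp [hdr]
  let E := (LinearEquiv.ofInjectiveOfFinrankEq (π.prod L).toLinearMap hinj hdim).toContinuousLinearEquiv
  have hE : (E : (σ → ℝ) →L[ℝ] (Fin d → ℝ) × (Fin r → ℝ)) = π.prod L := by
    ext v <;> rfl
  let Φ₀ : (σ → ℝ) → (Fin d → ℝ) × (Fin r → ℝ) := fun q => (π q, F q)
  have hΦ₀ : ContDiff ℝ ∞ Φ₀ := π.contDiff.prodMk hF
  have hder : ∀ q, HasFDerivAt Φ₀ (π.prod (fderiv ℝ F q)) q := fun q =>
    π.hasFDerivAt.prodMk ((hF.differentiable (by simp)) q).hasFDerivAt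
  have hderp : HasFDerivAt Φ₀ (E : (σ → ℝ) →L[ℝ] (Fin d → ℝ) × (Fin r → ℝ)) p := by
    rw [hE]; exact hder p
  let Φ₁ := hΦ₀.contDiffAt.toOpenPartialHomeomorph Φ₀ hderp (by simp)
  -- The inverse is smooth wherever the differential is invertible; restricting to the open set `G`
  -- ensures this on the whole target.
  let G : Set (σ → ℝ) := {q | π.prod (fderiv ℝ F q) ∈
    Set.range (fun e : (σ → ℝ) ≃L[ℝ] (Fin d → ℝ) × (Fin r → ℝ) =>
      (e : (σ → ℝ) →L[ℝ] (Fin d → ℝ) × (Fin r → ℝ)))}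
  have hG : IsOpen G := by
    refine ContinuousLinearEquiv.isOpen.preimage ?_
    have h1 : Continuous (fderiv ℝ F) := hF.continuous_fderiv (by simp)
    exact (ContinuousLinearMap.prodₗᵢ ℝ : _ ≃ₗᵢ[ℝ] _).continuous.comp (continuous_const.prodMk h1)
  have hpΦ₁ : p ∈ Φ₁.source := hΦ₀.contDiffAt.mem_toOpenPartialHomeomorph_source hderp (by simp)
  have hpG : p ∈ G := ⟨E, hE⟩
  refine ⟨Φ₁.restrOpen (G ∩ O) (hG.inter hO), ?_, ?_, ?_, ?_, ?_⟩
  · rw [OpenPartialHomeomorph.restrOpen_source]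
    exact ⟨hpΦ₁, hpG, hpO⟩
  · rw [OpenPartialHomeomorph.restrOpen_source]
    exact fun q hq => hq.2.2
  · exact hΦ₀.contDiffOn
  · intro y hy
    set Φ := Φ₁.restrOpen (G ∩ O) (hG.inter hO) with hΦ
    have hs : Φ.symm y ∈ Φ.source := Φ.map_target hy
    rw [hΦ, OpenPartialHomeomorph.restrOpen_source] at hs
    obtain ⟨e', he'⟩ := hs.2.1
    refine (Φ.contDiffAt_symm (f₀' := e') hy ?_ ?_).contDiffWithinAt
    · have := hder (Φ.symm y)
      rw [← hΦ] at he'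
      rw [← he'] at this
      exact this
    · exact hΦ₀.contDiffAt
  · intro q
    rfl

variable {r : ℕ} {F : (σ → ℝ) → (Fin r → ℝ)} {M O : Set (σ → ℝ)}

theorem isSmoothSubmanifold_of_regular {d : ℕ} (hdr : d + r = Fintype.card σ)
    (hF : ContDiff ℝ ∞ F) (hO : IsOpen O) (hMO : M ⊆ O) (hM : ∀ q ∈ O, q ∈ M ↔ F q = 0)
    (hreg : ∀ q ∈ M, Function.Surjective (fderiv ℝ F q)) : IsSmoothSubmanifold d M := by
  intro p hp
  obtain ⟨Φ, h1, h2, h3, h4, h5⟩ := exists_chart hdr hF (hreg p hp) hO (hMO hp)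
  exact ⟨r, Φ, h1, h3, h4, fun q hq => by rw [h5, hM q (h2 hq)]⟩

/-- One inclusion is the chain rule. For the other, straighten `F` by a chart and pull back the line
in the direction of the image of `v`; this direction has no component along `F`, so the curve stays
in the zero set. -/
theorem tangentVectors_eq_of_regular (hF : ContDiff ℝ ∞ F) (hO : IsOpen O) (hMO : M ⊆ O)
    (hM : ∀ q ∈ O, q ∈ M ↔ F q = 0) {p : σ → ℝ} (hp : p ∈ M)
    (hreg : Function.Surjective (fderiv ℝ F p)) :
    tangentVectors M p = {v | fderiv ℝ F p v = 0} := by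
  have hdF : ∀ q, HasFDerivAt F (fderiv ℝ F q) q := fun q =>
    ((hF.differentiable (by simp)) q).hasFDerivAt
  ext v
  constructor
  · rintro ⟨γ, hγ, hγ0, hγM, rfl⟩
    have hd : HasDerivAt γ (deriv γ 0) 0 := (hγ.differentiableAt (by simp)).hasDerivAt
    have hc : HasDerivAt (F ∘ γ) (fderiv ℝ F p (deriv γ 0)) 0 :=
      HasFDerivAt.comp_hasDerivAt 0 (by rw [hγ0]; exact hdF p) hd
    have h0 : F ∘ γ =ᶠ[nhds 0] fun _ => 0 := by
      filter_upwards [hγM] with t ht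
      exact (hM _ (hMO ht)).1 ht
    exact hc.unique ((hasDerivAt_const (0 : ℝ) (0 : Fin r → ℝ)).congr_of_eventuallyEq h0)
  · intro hv
    have hv : fderiv ℝ F p v = 0 := hv
    have hle : r ≤ Fintype.card σ := by
      have := LinearMap.finrank_le_finrank_of_surjective (f := (fderiv ℝ F p).toLinearMap) hreg
      simpa using this
    obtain ⟨Φ, h1, h2, h3, h4, h5⟩ :=
      exists_chart (d := Fintype.card σ - r) (by omega) hF hreg hO (hMO hp)
    have hΦp : Φ p ∈ Φ.target := Φ.map_source h1
    have hsd : ContDiffAt ℝ ∞ Φ.symm (Φ p) := h4.contDiffAt (Φ.open_target.mem_nhds hΦp)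
    have hΦd : HasFDerivAt Φ (fderiv ℝ Φ p) p :=
      ((h3.contDiffAt (Φ.open_source.mem_nhds h1)).differentiableAt (by simp)).hasFDerivAt
    have hsd' : HasFDerivAt Φ.symm (fderiv ℝ Φ.symm (Φ p)) (Φ p) :=
      (hsd.differentiableAt (by simp)).hasFDerivAt
    have hcomp : (fderiv ℝ Φ.symm (Φ p)).comp (fderiv ℝ Φ p) = ContinuousLinearMap.id ℝ _ := by
      refine (hsd'.comp p hΦd).unique ((hasFDerivAt_id p).congr_of_eventuallyEq ?_)
      filter_upwards [Φ.open_source.mem_nhds h1] with q hq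
      exact Φ.left_inv hq
    set w := fderiv ℝ Φ p v with hw
    have hw2 : w.2 = 0 := by
      have hs : HasFDerivAt (fun q => (Φ q).2) ((ContinuousLinearMap.snd ℝ _ _).comp
          (fderiv ℝ Φ p)) p := hasFDerivAt_snd.comp p hΦd
      have : (fun q => (Φ q).2) = F := funext h5
      rw [this] at hs
      rw [hw, ← hv, hs.fderiv]
      rfl
    have hline : HasDerivAt (fun t : ℝ => Φ p + t • w) w 0 := by
      simpa using ((hasDerivAt_id (0 : ℝ)).smul_const w).const_add (Φ p)
    have hlc : ContDiff ℝ ∞ fun t : ℝ => Φ p + t • w := by fun_prop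
    refine ⟨fun t => Φ.symm (Φ p + t • w), ?_, ?_, ?_, ?_⟩
    · refine ContDiffAt.comp (0 : ℝ) (g := Φ.symm) (by simpa using hsd) hlc.contDiffAt
    · simp [Φ.left_inv h1]
    · have : ∀ᶠ t : ℝ in nhds 0, Φ p + t • w ∈ Φ.target :=
        hlc.continuous.continuousAt.eventually (Φ.open_target.mem_nhds (by simpa using hΦp))
      filter_upwards [this] with t ht
      have hs := Φ.map_target ht
      rw [hM _ (h2 hs), ← h5, Φ.right_inv ht]
      simp only [Prod.snd_add, Prod.smul_snd, hw2, smul_zero, add_zero]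
      rw [h5, (hM p (hMO hp)).1 hp]
    · have := HasFDerivAt.comp_hasDerivAt (0 : ℝ) (l := Φ.symm) (f := fun t : ℝ => Φ p + t • w)
        (by simpa using hsd') hline
      refine this.deriv.trans ?_
      exact ContinuousLinearMap.ext_iff.1 hcomp v

theorem hasFDerivAt_eval (P : MvPolynomial σ ℝ) (p : σ → ℝ) :
    HasFDerivAt (fun q => MvPolynomial.eval q P)
      (∑ s, MvPolynomial.eval p (MvPolynomial.pderiv s P) •
        (ContinuousLinearMap.proj (R := ℝ) (φ := fun _ : σ => ℝ) s)) p := by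
  classical
  induction P using MvPolynomial.induction_on with
  | C a => simpa using hasFDerivAt_const a p
  | add P Q hP hQ =>
    simp only [map_add, add_smul, Finset.sum_add_distrib]
    exact hP.add hQ
  | mul_X P n hP =>
    simp only [map_mul, MvPolynomial.eval_X, Derivation.leibniz, MvPolynomial.pderiv_X,
      map_add, smul_eq_mul]
    refine (hP.mul (hasFDerivAt_apply n p)).congr_fderiv ?_
    ext v
    simp [add_mul, Finset.sum_add_distrib, Finset.mul_sum, Pi.single_apply, mul_assoc,
      Finset.sum_ite_eq]

end Regular

/-! ### The differential of the defining equations -/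

section MomentMap

variable {l₁ l₂ : ℕ} (C : Fin l₁ → OrientedCircle) (μ : Fin l₁ → Fin l₂) (k : Fin l₂ → ℕ)

/-- The map whose zero set contains the manifold. -/
noncomputable def momentMap (p : MomentSpace k) : Fin l₂ → ℝ :=
  fun i => MvPolynomial.eval p (momentPoly C μ k i)

theorem momentMap_eq_zero_iff (p : MomentSpace k) :
    momentMap C μ k p = 0 ↔ p ∈ momentZeroSet C μ k :=
  funext_iff

theorem contDiff_momentMap : ContDiff ℝ ∞ (momentMap C μ k) := by
  refine contDiff_pi.2 fun i => ?_
  simp only [momentMap, eval_momentPoly]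
  have h1 := (contDiff_planeProd C μ i).comp (contDiff_momentProj k)
  refine h1.sub (ContDiff.sum fun s _ => ?_)
  exact (contDiff_apply ℝ ℝ _).pow 2

theorem fderiv_momentMap (p v : MomentSpace k) (i : Fin l₂) :
    fderiv ℝ (momentMap C μ k) p v i =
      fderiv ℝ (planeProd C μ i) (momentProj k p) (momentProj k v) -
        ∑ s : Fin (k i + 1), 2 * p (Sum.inr ⟨i, s⟩) * v (Sum.inr ⟨i, s⟩) := by
  let P : MomentSpace k →L[ℝ] (Fin 2 → ℝ) :=
    ContinuousLinearMap.pi fun a => ContinuousLinearMap.proj (Sum.inl a)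
  have h1 : HasFDerivAt (fun q => planeProd C μ i (momentProj k q))
      ((fderiv ℝ (planeProd C μ i) (momentProj k p)).comp P) p :=
    HasFDerivAt.comp p (((contDiff_planeProd C μ i).differentiable (by simp)) _).hasFDerivAt
      P.hasFDerivAt
  have h2 : HasFDerivAt (fun q : MomentSpace k => ∑ s : Fin (k i + 1), q (Sum.inr ⟨i, s⟩) ^ 2)
      (∑ s : Fin (k i + 1), (2 * p (Sum.inr ⟨i, s⟩)) •
        ContinuousLinearMap.proj (R := ℝ) (φ := fun _ : MomentIndex k => ℝ) (Sum.inr ⟨i, s⟩)) p := by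
    refine HasFDerivAt.fun_sum fun s _ => ?_
    simpa using (hasFDerivAt_apply (𝕜 := ℝ) (F' := fun _ : MomentIndex k => ℝ)
      (Sum.inr ⟨i, s⟩) p).pow 2
  have h3 := h1.sub h2
  have h4 : HasFDerivAt (fun q => momentMap C μ k q i) _ p :=
    h3.congr_of_eventuallyEq (Filter.Eventually.of_forall fun q => eval_momentPoly C μ k i q)
  have h5 : HasFDerivAt (fun q => momentMap C μ k q i)
      ((ContinuousLinearMap.proj i).comp (fderiv ℝ (momentMap C μ k) p)) p :=
    hasFDerivAt_pi'.1 (((contDiff_momentMap C μ k).differentiable (by simp)) p).hasFDerivAt i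
  have := congrArg (fun L : MomentSpace k →L[ℝ] ℝ => L v) (h5.unique h4)
  simp only [ContinuousLinearMap.comp_apply, ContinuousLinearMap.proj_apply] at this
  rw [this]
  simp
  rfl

/-- The product of the other polynomials with the same index as `f_j`. -/
noncomputable def planeCofactor (j : Fin l₁) (x : Fin 2 → ℝ) : ℝ :=
  ∏ j' ∈ (Finset.univ.filter fun j' => μ j' = μ j).erase j, (C j').val x

theorem contDiff_planeCofactor (j : Fin l₁) : ContDiff ℝ ∞ (planeCofactor C μ j) := by
  unfold planeCofactor
  exact contDiff_prod fun j _ => (C j).contDiff_val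

theorem planeProd_eq_mul (j : Fin l₁) (x : Fin 2 → ℝ) :
    planeProd C μ (μ j) x = (C j).val x * planeCofactor C μ j x :=
  (Finset.mul_prod_erase (Finset.univ.filter fun j' => μ j' = μ j) (fun j' => (C j').val x)
    (Finset.mem_filter.2 ⟨Finset.mem_univ j, rfl⟩)).symm

theorem fderiv_planeProd {j : Fin l₁} {x : Fin 2 → ℝ} (hx : (C j).val x = 0) (v : Fin 2 → ℝ) :
    fderiv ℝ (planeProd C μ (μ j)) x v = planeCofactor C μ j x * fderiv ℝ (C j).val x v := by
  have h1 : planeProd C μ (μ j) = fun x => (C j).val x * planeCofactor C μ j x :=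
    funext (planeProd_eq_mul C μ j)
  rw [h1, fderiv_fun_mul ((C j).differentiable_val x)
    (((contDiff_planeCofactor C μ j).differentiable (by simp)) x)]
  simp [hx]

theorem contDiff_momentFun : ContDiff ℝ ∞ (momentFun k) := contDiff_apply ℝ ℝ _

theorem fderiv_momentFun (p v : MomentSpace k) : fderiv ℝ (momentFun k) p v = momentProj k v 0 := by
  have : HasFDerivAt (momentFun k) (ContinuousLinearMap.proj (R := ℝ)
    (φ := fun _ : MomentIndex k => ℝ) (Sum.inl 0)) p := hasFDerivAt_apply _ _
  rw [this.fderiv]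
  rfl

end MomentMap

namespace IsMomentData

variable {l₁ l₂ : ℕ} {C : Fin l₁ → OrientedCircle} {μ : Fin l₁ → Fin l₂} {D : Set (Fin 2 → ℝ)}

theorem planeProd_eq_zero_iff (i : Fin l₂) (x : Fin 2 → ℝ) :
    planeProd C μ i x = 0 ↔ ∃ j, μ j = i ∧ (C j).val x = 0 := by
  simp [planeProd, Finset.prod_eq_zero_iff]

/-- Circles through one point of the closure have distinct indices, so no second factor of the same
product vanishes there. -/
theorem planeCofactor_pos (h : IsMomentData D C μ) {x : Fin 2 → ℝ} (hx : x ∈ closure D)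
    {j : Fin l₁} (hj : (C j).val x = 0) : 0 < planeCofactor C μ j x := by
  refine Finset.prod_pos fun j' hj' => lt_of_le_of_ne (h.val_nonneg hx j') fun h0 => ?_
  obtain ⟨hne, hm⟩ := Finset.mem_erase.1 hj'
  exact hne (h.index_injective hx h0.symm hj (Finset.mem_filter.1 hm).2)

theorem coord_eq_zero {k : Fin l₂ → ℕ} {p : MomentSpace k} (hp : p ∈ momentZeroSet C μ k)
    {i : Fin l₂} (hi : planeProd C μ i (momentProj k p) = 0) (s : Fin (k i + 1)) :
    p (Sum.inr ⟨i, s⟩) = 0 := by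
  have h1 := (mem_momentZeroSet_iff C μ k p).1 hp i
  rw [hi] at h1
  have := (Finset.sum_eq_zero_iff_of_nonneg fun s _ => sq_nonneg (p (Sum.inr ⟨i, s⟩))).1 h1.symm s
    (Finset.mem_univ s)
  exact pow_eq_zero_iff (two_ne_zero) |>.1 this

/-- Vectors with prescribed values of the differential of the defining equations: the plane
component and the `y_i` with `F_i = 0` can be prescribed, under the obvious condition. -/
theorem exists_fderiv_momentMap_eq {k : Fin l₂ → ℕ} {p : MomentSpace k}
    (hp : p ∈ momentZeroSet C μ k) (u : Fin 2 → ℝ) (z : MomentSpace k) (τ : Fin l₂ → ℝ)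
    (hτ : ∀ i, planeProd C μ i (momentProj k p) = 0 →
      fderiv ℝ (planeProd C μ i) (momentProj k p) u = τ i) :
    ∃ v : MomentSpace k, momentProj k v = u ∧
      (∀ i s, planeProd C μ i (momentProj k p) = 0 → v (Sum.inr ⟨i, s⟩) = z (Sum.inr ⟨i, s⟩)) ∧
      fderiv ℝ (momentMap C μ k) p v = τ := by
  classical
  set x := momentProj k p with hx
  -- Where `F_i ≠ 0` the fibre component is a multiple of `y_i` itself: since `‖y_i‖ ^ 2 = F_i`, the
  -- factor can be solved for. Where `F_i = 0` also `y_i = 0`, and the fibre component does not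
  -- contribute to the differential.
  refine ⟨Sum.elim u fun a => if planeProd C μ a.1 x = 0 then z (Sum.inr a) else
    (fderiv ℝ (planeProd C μ a.1) x u - τ a.1) / (2 * planeProd C μ a.1 x) * p (Sum.inr a),
    rfl, ?_, ?_⟩
  · intro i s hi
    simp [hi]
  · funext i
    rw [fderiv_momentMap, ← hx]
    have hu : momentProj k (Sum.elim u fun a => if planeProd C μ a.1 x = 0 then z (Sum.inr a) else
      (fderiv ℝ (planeProd C μ a.1) x u - τ a.1) / (2 * planeProd C μ a.1 x) * p (Sum.inr a))
        = u := rfl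
    rw [hu]
    by_cases hi : planeProd C μ i x = 0
    · simp [coord_eq_zero hp hi, hτ i hi]
    · simp only [Sum.elim_inr, hi, if_false]
      have h1 := (mem_momentZeroSet_iff C μ k p).1 hp i
      have h2 : ∑ s : Fin (k i + 1), 2 * p (Sum.inr ⟨i, s⟩) *
          ((fderiv ℝ (planeProd C μ i) x u - τ i) / (2 * planeProd C μ i x) * p (Sum.inr ⟨i, s⟩)) =
          (fderiv ℝ (planeProd C μ i) x u - τ i) / (planeProd C μ i x) *
            ∑ s : Fin (k i + 1), p (Sum.inr ⟨i, s⟩) ^ 2 := by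
        rw [Finset.mul_sum]
        refine Finset.sum_congr rfl fun s _ => ?_
        field_simp
      rw [h2, ← h1, ← hx, div_mul_cancel₀ _ hi]
      ring

theorem exists_fderiv_planeProd_eq (h : IsMomentData D C μ) {x : Fin 2 → ℝ} (hx : x ∈ closure D)
    (τ : Fin l₂ → ℝ) :
    ∃ u, ∀ i, planeProd C μ i x = 0 → fderiv ℝ (planeProd C μ i) x u = τ i := by
  obtain ⟨u, hu⟩ := h.exists_fderiv_eq hx fun j => τ (μ j) / planeCofactor C μ j x
  refine ⟨u, fun i hi => ?_⟩
  obtain ⟨j, rfl, hj⟩ := (planeProd_eq_zero_iff i x).1 hi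
  rw [fderiv_planeProd C μ hj, hu j hj, mul_div_cancel₀ _ (h.planeCofactor_pos hx hj).ne']

/-- Only the equations with vanishing product constrain the plane component, and transversality
makes those solvable; the remaining ones are solved in the fibre directions. -/
theorem surjective_fderiv_momentMap (h : IsMomentData D C μ) {k : Fin l₂ → ℕ} {p : MomentSpace k}
    (hp : p ∈ momentManifold C μ k D) :
    Function.Surjective (fderiv ℝ (momentMap C μ k) p) := by
  intro τ
  obtain ⟨u, hu⟩ := h.exists_fderiv_planeProd_eq hp.1 τ
  obtain ⟨v, -, -, hv⟩ := exists_fderiv_momentMap_eq hp.2 u 0 τ hu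
  exact ⟨v, hv⟩

theorem exists_isOpen_mem_iff (h : IsMomentData D C μ) (k : Fin l₂ → ℕ) :
    ∃ O : Set (MomentSpace k), IsOpen O ∧ momentManifold C μ k D ⊆ O ∧
      ∀ q ∈ O, q ∈ momentManifold C μ k D ↔ momentMap C μ k q = 0 := by
  obtain ⟨U, hUo, hDU, -, hU⟩ := h.exists_nhds
  refine ⟨momentProj k ⁻¹' U, hUo.preimage (continuous_momentProj k), fun p hp => hDU hp.1, ?_⟩
  intro q hq
  rw [momentMap_eq_zero_iff]
  exact ⟨fun hqM => hqM.2, fun hqZ => ⟨hU _ hq fun i => planeProd_nonneg_of_mem C μ k hqZ i, hqZ⟩⟩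

theorem card_momentIndex (k : Fin l₂ → ℕ) :
    (∑ i, k i) + 2 + l₂ = Fintype.card (MomentIndex k) := by
  simp [Fintype.card_sum, Fintype.card_sigma, Finset.sum_add_distrib]
  ring

theorem isSmoothSubmanifold_momentManifold (h : IsMomentData D C μ) (k : Fin l₂ → ℕ) :
    IsSmoothSubmanifold ((∑ i, k i) + 2) (momentManifold C μ k D) := by
  obtain ⟨O, hO, hMO, hM⟩ := h.exists_isOpen_mem_iff k
  exact isSmoothSubmanifold_of_regular (card_momentIndex k) (contDiff_momentMap C μ k) hO hMO hM
    fun q hq => h.surjective_fderiv_momentMap hq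

theorem tangentVectors_momentManifold (h : IsMomentData D C μ) {k : Fin l₂ → ℕ} {p : MomentSpace k}
    (hp : p ∈ momentManifold C μ k D) :
    tangentVectors (momentManifold C μ k D) p = {v | fderiv ℝ (momentMap C μ k) p v = 0} := by
  obtain ⟨O, hO, hMO, hM⟩ := h.exists_isOpen_mem_iff k
  exact tangentVectors_eq_of_regular (contDiff_momentMap C μ k) hO hMO hM hp
    (h.surjective_fderiv_momentMap hp)

theorem isNonsingularAlgebraic_momentManifold (h : IsMomentData D C μ) (k : Fin l₂ → ℕ) :
    IsNonsingularAlgebraic ((∑ i, k i) + 2) (momentManifold C μ k D) := by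
  obtain ⟨O, hO, hMO, hM⟩ := h.exists_isOpen_mem_iff k
  refine ⟨l₂, momentPoly C μ k, card_momentIndex k, ?_, ?_⟩
  · intro p hp
    refine ⟨hp.2, ?_⟩
    change connectedComponentIn (momentZeroSet C μ k) p ⊆ _
    set A := connectedComponentIn (momentZeroSet C μ k) p with hA
    have hAZ : A ⊆ momentZeroSet C μ k := connectedComponentIn_subset _ _
    have hpre : IsPreconnected A := isPreconnected_connectedComponentIn
    have hpA : p ∈ A := mem_connectedComponentIn hp.2
    have hMc : IsClosed (momentManifold C μ k D) := (h.isCompact_momentManifold k).isClosed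
    -- Inside the zero set the manifold is closed, by compactness, and open, by the choice of `O`; a
    -- component that meets it is contained in it.
    rcases isPreconnected_iff_subset_of_disjoint.1 hpre O (momentManifold C μ k D)ᶜ hO
      hMc.isOpen_compl (fun q _ => (Classical.em (q ∈ momentManifold C μ k D)).imp
        (fun hq => hMO hq) fun hq => hq) (by
        refine Set.eq_empty_of_forall_notMem fun q hq => hq.2.2 ?_
        exact (hM q hq.2.1).2 ((momentMap_eq_zero_iff C μ k q).2 (hAZ hq.1))) with h1 | h1
    · exact fun q hq => (hM q (h1 hq)).2 ((momentMap_eq_zero_iff C μ k q).2 (hAZ hq))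
    · exact absurd hp (h1 hpA)
  · intro p hp
    rw [Fintype.linearIndependent_iff]
    intro a ha i
    -- Pairing a linear relation among the gradients with a preimage of the `i`-th basis vector
    -- isolates the coefficient `a i`.
    obtain ⟨v, hv⟩ := h.surjective_fderiv_momentMap hp (Pi.single i 1)
    have hd : ∀ i', fderiv ℝ (momentMap C μ k) p v i' =
        ∑ s, MvPolynomial.eval p (MvPolynomial.pderiv s (momentPoly C μ k i')) * v s := by
      intro i'
      have h5 : HasFDerivAt (fun q => momentMap C μ k q i')
          ((ContinuousLinearMap.proj i').comp (fderiv ℝ (momentMap C μ k) p)) p :=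
        hasFDerivAt_pi'.1 (((contDiff_momentMap C μ k).differentiable (by simp)) p).hasFDerivAt i'
      have := congrArg (fun L : MomentSpace k →L[ℝ] ℝ => L v)
        (h5.unique (hasFDerivAt_eval (momentPoly C μ k i') p))
      simpa using this
    have h1 : ∑ i', a i' * fderiv ℝ (momentMap C μ k) p v i' = 0 := by
      simp only [hd, Finset.mul_sum]
      rw [Finset.sum_comm]
      refine Finset.sum_eq_zero fun s _ => ?_
      have := congrFun ha s
      simp only [Finset.sum_apply, Pi.smul_apply, smul_eq_mul, Pi.zero_apply] at this
      simp only [← mul_assoc]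
      rw [← Finset.sum_mul, this, zero_mul]
    rw [hv] at h1
    simpa [Pi.single_apply] using h1

/-- The singular points of the first coordinate of the moment-like map are the points over corners
and vertical poles. -/
theorem mem_singularPoints_iff (h : IsMomentData D C μ) {k : Fin l₂ → ℕ} {p : MomentSpace k}
    (hp : p ∈ momentManifold C μ k D) :
    p ∈ singularPoints (momentManifold C μ k D) (momentFun k) ↔
      momentProj k p ∈ criticalPoints D C := by
  simp only [singularPoints, criticalPoints, Set.mem_ofPred_eq, h.tangentVectors_momentManifold hp,
    fderiv_momentFun]
  constructor
  · rintro ⟨-, hv⟩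
    refine ⟨hp.1, fun u hu => ?_⟩
    -- A plane vector annihilated by the differentials of the vanishing circle polynomials lifts to
    -- a tangent vector of the manifold.
    obtain ⟨v, rfl, -, hv0⟩ := exists_fderiv_momentMap_eq hp.2 u 0 0 (by
      intro i hi
      obtain ⟨j, rfl, hj⟩ := (planeProd_eq_zero_iff i _).1 hi
      rw [fderiv_planeProd C μ hj, hu j hj, mul_zero]
      rfl)
    exact hv v hv0
  · rintro ⟨-, hu⟩
    refine ⟨hp, fun v hv => hu _ fun j hj => ?_⟩
    have h1 := congrFun hv (μ j)
    have h2 : planeProd C μ (μ j) (momentProj k p) = 0 := (planeProd_eq_zero_iff _ _).2 ⟨j, rfl, hj⟩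
    rw [fderiv_momentMap, fderiv_planeProd C μ hj] at h1
    simp only [coord_eq_zero hp.2 h2, mul_zero, zero_mul, Finset.sum_const_zero, sub_zero,
      Pi.zero_apply, mul_eq_zero] at h1
    exact h1.resolve_left (h.planeCofactor_pos hp.1 hj).ne'

end IsMomentData

/-! ### Morse-Bott functions -/

theorem isMorseOn_quadratic {n : ℕ} (c : ℝ) {ε : Fin n → ℝ} (hε : ∀ a, ε a ≠ 0) :
    IsMorseOn (fun w : Fin n → ℝ => c + ∑ a, ε a * w a ^ 2) Set.univ := by
  constructor
  · refine ContDiff.contDiffOn ?_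
    refine contDiff_const.add (ContDiff.sum fun a _ => ?_)
    exact contDiff_const.mul ((contDiff_apply ℝ ℝ a).pow 2)
  · intro w _ _ u hu
    let P : Fin n → (Fin n → ℝ) →L[ℝ] ℝ := fun a =>
      ContinuousLinearMap.proj (R := ℝ) (φ := fun _ : Fin n => ℝ) a
    let B : (Fin n → ℝ) →L[ℝ] ((Fin n → ℝ) →L[ℝ] ℝ) := ∑ a, (2 * ε a) • (P a).smulRight (P a)
    have h1 : fderiv ℝ (fun w : Fin n → ℝ => c + ∑ a, ε a * w a ^ 2) = B := by
      funext w
      have : HasFDerivAt (fun w : Fin n → ℝ => c + ∑ a, ε a * w a ^ 2)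
          (∑ a, ε a • ((2 * w a) • P a)) w := by
        refine HasFDerivAt.const_add c (HasFDerivAt.fun_sum fun a _ => ?_)
        refine HasFDerivAt.const_mul ?_ _
        simpa using (hasFDerivAt_apply (𝕜 := ℝ) (F' := fun _ : Fin n => ℝ) a w).pow 2
      rw [this.fderiv]
      ext v
      simp only [B, P, sum_apply, smul_apply, smul_eq_mul,
        ContinuousLinearMap.smulRight_apply]
      refine Finset.sum_congr rfl fun a _ => ?_
      simp
      ring
    rw [h1] at hu
    funext b
    have h2 := hu (Pi.single b 1)
    rw [B.fderiv] at h2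
    simp only [B, P, sum_apply, smul_apply, smul_eq_mul,
      ContinuousLinearMap.smulRight_apply, ContinuousLinearMap.proj_apply, Pi.single_apply] at h2
    simp only [mul_ite, mul_one, mul_zero, Finset.sum_ite_eq', Finset.mem_univ, if_true] at h2
    simpa [hε b] using h2

/-- Composed with a fixed right inverse of `L p`, the maps `L q` are close to the identity of `G`,
and invertible maps form an open set. -/
theorem eventually_surjective {X E G : Type*} [TopologicalSpace X] [NormedAddCommGroup E]
    [NormedSpace ℝ E] [NormedAddCommGroup G] [NormedSpace ℝ G] [FiniteDimensional ℝ G]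
    {L : X → E →L[ℝ] G} {p : X} (hL : ContinuousAt L p) (hp : Function.Surjective (L p)) :
    ∀ᶠ q in nhds p, Function.Surjective (L q) := by
  obtain ⟨R, hR⟩ := (L p).toLinearMap.exists_rightInverse_of_surjective
    (LinearMap.range_eq_top.2 hp)
  have : CompleteSpace G := FiniteDimensional.complete ℝ G
  let R' : G →L[ℝ] E := LinearMap.toContinuousLinearMap R
  have hRp : (L p).comp R' = (ContinuousLinearEquiv.refl ℝ G : G →L[ℝ] G) := by
    ext g
    exact LinearMap.congr_fun hR g
  have hc : ContinuousAt (fun q => (L q).comp R') p := hL.clm_comp continuousAt_const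
  have hopen := ContinuousLinearEquiv.isOpen (𝕜 := ℝ) (E := G) (F := G)
  filter_upwards [hc.eventually (hopen.mem_nhds ⟨ContinuousLinearEquiv.refl ℝ G, hRp.symm⟩)]
    with q hq g
  obtain ⟨e, he⟩ := hq
  refine ⟨R' (e.symm g), ?_⟩
  have : (L q).comp R' (e.symm g) = e (e.symm g) := by rw [← he]; rfl
  simpa using this

namespace IsMomentData

variable {l₁ l₂ : ℕ} {C : Fin l₁ → OrientedCircle} {μ : Fin l₁ → Fin l₂} {D : Set (Fin 2 → ℝ)}

/-- A Morse-Bott normal form follows from a presentation of the function as a weighted sum of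
squares of independent functions on the manifold. -/
theorem exists_morse_of_sum_sq (h : IsMomentData D C μ) {k : Fin l₂ → ℕ} {p : MomentSpace k}
    (hp : p ∈ momentManifold C μ k D) {n : ℕ} {O : Set (Fin 2 → ℝ)} (hO : IsOpen O)
    (hpO : momentProj k p ∈ O) (ε : Fin n → ℝ) (hε : ∀ a, ε a * ε a = 1)
    (ρ : Fin n → (Fin 2 → ℝ) → ℝ) (hρ : ∀ a, ContDiffOn ℝ ∞ (ρ a) O)
    (hερ : ∀ a, ∀ x ∈ O, 0 < ε a * ρ a x)
    (z : Fin n → MomentSpace k → ℝ) (hz : ∀ a, ContDiff ℝ ∞ (z a)) (hzp : ∀ a, z a p = 0)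
    (hsum : ∀ q ∈ momentManifold C μ k D, momentProj k q ∈ O →
      momentFun k q = momentFun k p + ∑ a, ρ a (momentProj k q) * z a q ^ 2)
    (hsurj : ∀ w : Fin n → ℝ, ∃ v, fderiv ℝ (momentMap C μ k) p v = 0 ∧
      ∀ a, fderiv ℝ (z a) p v = w a) :
    ∃ (W : Set (Fin n → ℝ)) (g : (Fin n → ℝ) → ℝ)
      (V : Set (MomentSpace k)) (s : MomentSpace k → (Fin n → ℝ)),
      IsOpen W ∧ IsMorseOn g W ∧ IsOpen V ∧ p ∈ V ∧ ContDiffOn ℝ ∞ s V ∧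
        ∀ q ∈ V ∩ momentManifold C μ k D, s q ∈ W ∧ momentFun k q = g (s q) ∧
          ∀ w : Fin n → ℝ, ∃ v ∈ tangentVectors (momentManifold C μ k D) q,
            fderiv ℝ s q v = w := by
  set O' : Set (MomentSpace k) := momentProj k ⁻¹' O with hO'
  have hO'o : IsOpen O' := hO.preimage (continuous_momentProj k)
  have hpO' : p ∈ O' := hpO
  -- Absorbing `√|ρ a|` into the coordinate leaves a sum of squares with constant signs; since `z a`
  -- vanishes at `p`, its differential there is merely rescaled.
  let t : Fin n → MomentSpace k → ℝ := fun a q => √(ε a * ρ a (momentProj k q))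
  have ht : ∀ a, ContDiffOn ℝ ∞ (t a) O' := by
    intro a
    have h1 : ContDiffOn ℝ ∞ (fun q => ε a * ρ a (momentProj k q)) O' :=
      contDiffOn_const.mul ((hρ a).comp (contDiff_momentProj k).contDiffOn fun q hq => hq)
    exact h1.sqrt fun q hq => (hερ a _ hq).ne'
  let s : MomentSpace k → (Fin n → ℝ) := fun q a => t a q * z a q
  have hs : ContDiffOn ℝ ∞ s O' :=
    contDiffOn_pi.2 fun a => (ht a).mul (hz a).contDiffOn
  have hsp : ∀ v a, fderiv ℝ s p v a = t a p * fderiv ℝ (z a) p v := by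
    intro v a
    have hd : DifferentiableAt ℝ s p := (hs.contDiffAt (hO'o.mem_nhds hpO')).differentiableAt (by simp)
    have h1 := hasFDerivAt_pi'.1 hd.hasFDerivAt a
    have h2 : HasFDerivAt (t a) (fderiv ℝ (t a) p) p :=
      (((ht a).contDiffAt (hO'o.mem_nhds hpO')).differentiableAt (by simp)).hasFDerivAt
    have h3 : HasFDerivAt (z a) (fderiv ℝ (z a) p) p :=
      (((hz a).differentiable (by simp)) p).hasFDerivAt
    have := congrArg (fun L : MomentSpace k →L[ℝ] ℝ => L v) (h1.unique (h2.mul h3))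
    simpa [hzp a] using this
  have htp : ∀ a, t a p ≠ 0 := fun a => (Real.sqrt_pos.2 (hερ a _ hpO)).ne'
  -- That `s` restricts to a submersion on the manifold is surjectivity of the joint differential
  -- with the defining equations; in this form it is an open condition on the point.
  let L : MomentSpace k → (MomentSpace k →L[ℝ] (Fin l₂ → ℝ) × (Fin n → ℝ)) :=
    fun q => (fderiv ℝ (momentMap C μ k) q).prod (fderiv ℝ s q)
  have hLc : ContinuousAt L p := by
    have h1 : ContinuousAt (fderiv ℝ (momentMap C μ k)) p :=
      ((contDiff_momentMap C μ k).continuous_fderiv (by simp)).continuousAt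
    have h2 : ContinuousAt (fderiv ℝ s) p :=
      (hs.continuousOn_fderiv_of_isOpen hO'o (by simp)).continuousAt (hO'o.mem_nhds hpO')
    exact (ContinuousLinearMap.prodₗᵢ ℝ : _ ≃ₗᵢ[ℝ] _).continuous.continuousAt.comp (h1.prodMk h2)
  have hLp : Function.Surjective (L p) := by
    rintro ⟨τ, w⟩
    obtain ⟨v₀, hv₀⟩ := h.surjective_fderiv_momentMap hp τ
    obtain ⟨v, hv, hvw⟩ := hsurj fun a => w a / t a p - fderiv ℝ (z a) p v₀
    refine ⟨v + v₀, Prod.ext ?_ (funext fun a => ?_)⟩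
    · change fderiv ℝ (momentMap C μ k) p (v + v₀) = τ
      rw [map_add, hv, hv₀, zero_add]
    · change fderiv ℝ s p (v + v₀) a = w a
      rw [hsp, map_add, hvw, sub_add_cancel, mul_div_cancel₀ _ (htp a)]
  obtain ⟨V, hV, hVo, hpV⟩ := eventually_nhds_iff.1 (eventually_surjective hLc hLp)
  refine ⟨Set.univ, fun w => momentFun k p + ∑ a, ε a * w a ^ 2, V ∩ O', s, isOpen_univ,
    isMorseOn_quadratic _ fun a h0 => by simpa [h0] using hε a, hVo.inter hO'o, ⟨hpV, hpO'⟩,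
    hs.mono Set.inter_subset_right, ?_⟩
  rintro q ⟨⟨hqV, hqO⟩, hqM⟩
  refine ⟨trivial, ?_, fun w => ?_⟩
  · rw [hsum q hqM hqO]
    congr 1
    refine Finset.sum_congr rfl fun a _ => ?_
    have h1 : t a q ^ 2 = ε a * ρ a (momentProj k q) := Real.sq_sqrt (hερ a _ hqO).le
    simp only [s, mul_pow, h1]
    linear_combination (-(ρ a (momentProj k q) * z a q ^ 2)) * hε a
  · obtain ⟨v, hv⟩ := hV q hqV (0, w)
    refine ⟨v, ?_, congrArg Prod.snd hv⟩
    rw [h.tangentVectors_momentManifold hqM]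
    exact congrArg Prod.fst hv

theorem exists_morse_of_sum_sq' (h : IsMomentData D C μ) {k : Fin l₂ → ℕ} {p : MomentSpace k}
    (hp : p ∈ momentManifold C μ k D) {ι : Type*} [Fintype ι] {O : Set (Fin 2 → ℝ)} (hO : IsOpen O)
    (hpO : momentProj k p ∈ O) (ε : ι → ℝ) (hε : ∀ a, ε a * ε a = 1)
    (ρ : ι → (Fin 2 → ℝ) → ℝ) (hρ : ∀ a, ContDiffOn ℝ ∞ (ρ a) O)
    (hερ : ∀ a, ∀ x ∈ O, 0 < ε a * ρ a x)
    (z : ι → MomentSpace k → ℝ) (hz : ∀ a, ContDiff ℝ ∞ (z a)) (hzp : ∀ a, z a p = 0)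
    (hsum : ∀ q ∈ momentManifold C μ k D, momentProj k q ∈ O →
      momentFun k q = momentFun k p + ∑ a, ρ a (momentProj k q) * z a q ^ 2)
    (hsurj : ∀ w : ι → ℝ, ∃ v, fderiv ℝ (momentMap C μ k) p v = 0 ∧
      ∀ a, fderiv ℝ (z a) p v = w a) :
    ∃ (n : ℕ) (W : Set (Fin n → ℝ)) (g : (Fin n → ℝ) → ℝ)
      (V : Set (MomentSpace k)) (s : MomentSpace k → (Fin n → ℝ)),
      IsOpen W ∧ IsMorseOn g W ∧ IsOpen V ∧ p ∈ V ∧ ContDiffOn ℝ ∞ s V ∧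
        ∀ q ∈ V ∩ momentManifold C μ k D, s q ∈ W ∧ momentFun k q = g (s q) ∧
          ∀ w : Fin n → ℝ, ∃ v ∈ tangentVectors (momentManifold C μ k D) q,
            fderiv ℝ s q v = w := by
  let e := Fintype.equivFin ι
  refine ⟨Fintype.card ι, h.exists_morse_of_sum_sq hp hO hpO (fun a => ε (e.symm a))
    (fun a => hε _) (fun a => ρ (e.symm a)) (fun a => hρ _) (fun a => hερ _)
    (fun a => z (e.symm a)) (fun a => hz _) (fun a => hzp _) ?_ ?_⟩
  · intro q hq hqO
    rw [hsum q hq hqO]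
    congr 1
    exact (Equiv.sum_comp e.symm fun a => ρ a (momentProj k q) * z a q ^ 2).symm
  · intro w
    obtain ⟨v, hv, hw⟩ := hsurj fun a => w (e a)
    exact ⟨v, hv, fun a => by simpa using hw (e.symm a)⟩

end IsMomentData

theorem fderiv_coord {σ : Type*} [Fintype σ] (a : σ) (c : ℝ) (p v : σ → ℝ) :
    fderiv ℝ (fun q : σ → ℝ => q a - c) p v = v a := by
  have : HasFDerivAt (fun q : σ → ℝ => q a - c)
      (ContinuousLinearMap.proj (R := ℝ) (φ := fun _ : σ => ℝ) a) p :=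
    (hasFDerivAt_apply a p).sub_const c
  rw [this.fderiv]
  rfl

/-! ### Normal forms at vertical poles and at corners -/

namespace IsMomentData

variable {l₁ l₂ : ℕ} {C : Fin l₁ → OrientedCircle} {μ : Fin l₁ → Fin l₂} {D : Set (Fin 2 → ℝ)}

theorem sum_sq_eq {k : Fin l₂ → ℕ} {q : MomentSpace k} (hq : q ∈ momentZeroSet C μ k) (j : Fin l₁) :
    ∑ s : Fin (k (μ j) + 1), q (Sum.inr ⟨μ j, s⟩) ^ 2 =
      (C j).val (momentProj k q) * planeCofactor C μ j (momentProj k q) := by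
  rw [← planeProd_eq_mul, (mem_momentZeroSet_iff C μ k q).1 hq (μ j)]

theorem exists_val_eq_zero {x : Fin 2 → ℝ} (hx : x ∈ criticalPoints D C) :
    ∃ j, (C j).val x = 0 := by
  by_contra! hne
  have := hx.2 ![1, 0] fun j hj => absurd hj (hne j)
  simp at this

/-- A critical point on a single circle is a vertical pole. -/
theorem eq_center_of_mem_criticalPoints {x : Fin 2 → ℝ} (hx : x ∈ criticalPoints D C) {j : Fin l₁}
    (hj : ∀ i, (C i).val x = 0 → i = j) : x 1 = (C j).center 1 := by
  -- The test vector is the radius vector turned by a right angle, hence tangent to the circle.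
  have := hx.2 ![-(x 1 - (C j).center 1), x 0 - (C j).center 0] fun i hi => by
    rw [hj i hi, (C j).fderiv_val]
    simp
    right
    ring
  simp at this
  linarith

/-- Let `d` be the offset of the pole from the centre, so `d ^ 2 = r ^ 2`, and let `X` be the offset
of `x 0` plus `d`. The circle polynomial `f_j` satisfies `X * (x 0 - p 0) = -(x 1 - c 1) ^ 2 - σ *
f_j`, with `c` the centre, and on the manifold `f_j` is the squared norm of its fibre coordinates
divided by a positive cofactor. Near the pole `X` keeps the sign of `d`, so dividing by it gives a
weighted sum of squares. -/
theorem exists_morse_of_pole (h : IsMomentData D C μ) {k : Fin l₂ → ℕ} {p : MomentSpace k}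
    (hp : p ∈ momentManifold C μ k D) {j : Fin l₁} (hj : (C j).val (momentProj k p) = 0)
    (huniq : ∀ i, (C i).val (momentProj k p) = 0 → i = j)
    (h1 : momentProj k p 1 = (C j).center 1) :
    ∃ (n : ℕ) (W : Set (Fin n → ℝ)) (g : (Fin n → ℝ) → ℝ)
      (V : Set (MomentSpace k)) (s : MomentSpace k → (Fin n → ℝ)),
      IsOpen W ∧ IsMorseOn g W ∧ IsOpen V ∧ p ∈ V ∧ ContDiffOn ℝ ∞ s V ∧
        ∀ q ∈ V ∩ momentManifold C μ k D, s q ∈ W ∧ momentFun k q = g (s q) ∧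
          ∀ w : Fin n → ℝ, ∃ v ∈ tangentVectors (momentManifold C μ k D) q,
            fderiv ℝ s q v = w := by
  set x₀ := momentProj k p with hx₀
  set r := (C j).radius with hr
  have hr0 : 0 < r := (C j).radius_pos
  set d := x₀ 0 - (C j).center 0 with hd
  set σ := (C j).sgn with hσ
  have hσσ : σ * σ = 1 := (C j).sgn_mul_sgn
  have hσ0 : σ ≠ 0 := (C j).sgn_ne_zero
  have hdr : d ^ 2 = r ^ 2 := by
    have h2 := hj
    rw [(C j).val_eq, h1, mul_eq_zero] at h2
    have := h2.resolve_left hσ0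
    simp only [sub_self] at this
    linarith
  set δ := d / r with hδ
  have hδδ : δ * δ = 1 := by
    rw [hδ]; field_simp; exact hdr
  have hdδ : d = δ * r := by rw [hδ]; field_simp
  let X : (Fin 2 → ℝ) → ℝ := fun x => x 0 - (C j).center 0 + d
  have hX : ContDiff ℝ ∞ X := by
    exact ((contDiff_apply ℝ ℝ (0 : Fin 2)).sub contDiff_const).add contDiff_const
  let R : (Fin 2 → ℝ) → ℝ := planeCofactor C μ j
  have hR : ContDiff ℝ ∞ R := contDiff_planeCofactor C μ j
  let O : Set (Fin 2 → ℝ) := {x | 0 < δ * X x} ∩ {x | 0 < R x}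
  have hO : IsOpen O := (isOpen_lt continuous_const (continuous_const.mul hX.continuous)).inter
    (isOpen_lt continuous_const hR.continuous)
  have hX0 : ∀ x ∈ O, X x ≠ 0 := fun x hx h0 => by
    have : 0 < δ * X x := hx.1
    simp [h0] at this
  have hR0 : ∀ x ∈ O, 0 < R x := fun x hx => hx.2
  have hpO : x₀ ∈ O := by
    refine ⟨?_, h.planeCofactor_pos hp.1 hj⟩
    change 0 < δ * (d + d)
    rw [hdδ]
    nlinarith
  have hδX : ∀ x ∈ O, 0 < δ / X x := fun x hx => by
    have h2 : 0 < δ * X x := hx.1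
    have h3 : δ / X x = δ * X x / X x ^ 2 := by field_simp [hX0 x hx]
    rw [h3]
    exact div_pos h2 (by have := hX0 x hx; positivity)
  let emb : Fin (k (μ j) + 1) → MomentIndex k := fun s => Sum.inr ⟨μ j, s⟩
  have hemb : Function.Injective emb := fun s t hst => by simpa [emb] using hst
  -- The index `none` stands for the vertical coordinate of the plane, `some s` for the fibre
  -- coordinates belonging to the circle.
  refine h.exists_morse_of_sum_sq' hp (ι := Option (Fin (k (μ j) + 1))) hO hpO
    (fun a => a.elim (-δ) fun _ => -(σ * δ)) ?_
    (fun a x => a.elim (-1 / X x) fun _ => -σ / (X x * R x)) ?_ ?_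
    (fun a q => a.elim (q (Sum.inl 1) - (C j).center 1) fun s => q (Sum.inr ⟨μ j, s⟩) - 0) ?_ ?_ ?_ ?_
  · rintro (_ | s)
    · simpa using hδδ
    · simp only [Option.elim_some]
      linear_combination hδδ * σ * σ + hσσ
  · rintro (_ | s)
    · exact contDiffOn_const.div hX.contDiffOn hX0
    · exact contDiffOn_const.div (hX.mul hR).contDiffOn fun x hx =>
        mul_ne_zero (hX0 x hx) (hR0 x hx).ne'
  · rintro (_ | s) x hx
    · have : -δ * (-1 / X x) = δ / X x := by ring
      simpa [this] using hδX x hx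
    · have h2 : -(σ * δ) * (-σ / (X x * R x)) = (σ * σ) * (δ / X x) / R x := by
        have := hX0 x hx
        have := (hR0 x hx).ne'
        field_simp
      simp only [Option.elim_some]
      rw [h2, hσσ, one_mul]
      exact div_pos (hδX x hx) (hR0 x hx)
  · rintro (_ | s) <;> exact (contDiff_apply ℝ ℝ _).sub contDiff_const
  · rintro (_ | s)
    · exact sub_eq_zero.2 h1
    · simpa using coord_eq_zero hp.2 ((planeProd_eq_zero_iff _ _).2 ⟨j, rfl, hj⟩) s
  · intro q hq hqO
    rw [Fintype.sum_option]
    simp only [Option.elim_none, Option.elim_some, sub_zero]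
    rw [← Finset.mul_sum, sum_sq_eq hq.2 j]
    have e1 : momentFun k q = momentProj k q 0 := rfl
    have e2 : momentFun k p = d + (C j).center 0 := by
      change x₀ 0 = _
      rw [hd]; ring
    have e3 : q (Sum.inl 1) = momentProj k q 1 := rfl
    set x := momentProj k q with hx
    have hXx := hX0 x hqO
    have hRx : planeCofactor C μ j x ≠ 0 := (hR0 x hqO).ne'
    rw [e1, e2, e3, (C j).val_eq, ← hσ, ← hr]
    have e4 : X x * (x 0 - (C j).center 0 - d) = (x 0 - (C j).center 0) ^ 2 - r ^ 2 := by
      rw [← hdr]; simp only [X]; ring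
    have e5 : -σ / (X x * R x) * (σ * (r ^ 2 - (x 0 - (C j).center 0) ^ 2 -
        (x 1 - (C j).center 1) ^ 2) * planeCofactor C μ j x) =
        -(σ * σ) / X x * (r ^ 2 - (x 0 - (C j).center 0) ^ 2 - (x 1 - (C j).center 1) ^ 2) := by
      simp only [R]
      field_simp
    rw [e5, hσσ]
    field_simp
    linear_combination e4
  · intro w
    obtain ⟨v, hv, hvz, hv0⟩ := exists_fderiv_momentMap_eq hp.2 ![0, w none]
      (Function.extend emb (fun s => w (some s)) 0) 0 (by
        intro i hi
        obtain ⟨j', rfl, hj'⟩ := (planeProd_eq_zero_iff i _).1 hi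
        have := huniq j' hj'
        subst this
        rw [fderiv_planeProd C μ hj', (C j').fderiv_val, ← hx₀, h1]
        simp)
    refine ⟨v, hv0, ?_⟩
    rintro (_ | s)
    · simp only [Option.elim_none]
      rw [fderiv_coord]
      exact congrFun hv 1
    · simp only [Option.elim_some]
      rw [fderiv_coord, hvz _ _ ((planeProd_eq_zero_iff _ _).2 ⟨j, rfl, hj⟩)]
      exact hemb.extend_apply _ _ s

/-- The quadratic parts of the two circle polynomials are proportional, so the first coordinate can
be solved for exactly: a factor close to `1` times its increment equals `α * f_j + β * f_j'`.
Neither tangent is vertical at the corner, whence `α` and `β` do not vanish there; and on the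
manifold near the corner each polynomial is a positive multiple of the squared norm of its fibre
coordinates. -/
theorem exists_morse_of_corner (h : IsMomentData D C μ) {k : Fin l₂ → ℕ} {p : MomentSpace k}
    (hp : p ∈ momentManifold C μ k D) {j j' : Fin l₁} (hjj' : j ≠ j')
    (hj : (C j).val (momentProj k p) = 0) (hj' : (C j').val (momentProj k p) = 0)
    (h1 : momentProj k p 1 ≠ (C j).center 1) (h1' : momentProj k p 1 ≠ (C j').center 1) :
    ∃ (n : ℕ) (W : Set (Fin n → ℝ)) (g : (Fin n → ℝ) → ℝ)
      (V : Set (MomentSpace k)) (s : MomentSpace k → (Fin n → ℝ)),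
      IsOpen W ∧ IsMorseOn g W ∧ IsOpen V ∧ p ∈ V ∧ ContDiffOn ℝ ∞ s V ∧
        ∀ q ∈ V ∩ momentManifold C μ k D, s q ∈ W ∧ momentFun k q = g (s q) ∧
          ∀ w : Fin n → ℝ, ∃ v ∈ tangentVectors (momentManifold C μ k D) q,
            fderiv ℝ s q v = w := by
  classical
  set x₀ := momentProj k p with hx₀
  have hμ : μ j ≠ μ j' := fun he => hjj' (h.index_injective hp.1 hj hj' he)
  obtain ⟨u, hu⟩ := h.exists_fderiv_eq hp.1 fun i => if i = j then 1 else 0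
  obtain ⟨w, hw⟩ := h.exists_fderiv_eq hp.1 fun i => if i = j' then 1 else 0
  have hju := hu j hj
  have hj'u := hu j' hj'
  have hjw := hw j hj
  have hj'w := hw j' hj'
  simp only [if_true, hjj', hjj'.symm, if_false, (C j).fderiv_val, (C j').fderiv_val,
    ← hx₀] at hju hj'u hjw hj'w
  set σ := (C j).sgn with hσ
  set σ' := (C j').sgn with hσ'
  set a0 := -2 * σ * (x₀ 0 - (C j).center 0) with ha0
  set a1 := -2 * σ * (x₀ 1 - (C j).center 1) with ha1
  set b0 := -2 * σ' * (x₀ 0 - (C j').center 0) with hb0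
  set b1 := -2 * σ' * (x₀ 1 - (C j').center 1) with hb1
  have ha1' : a1 ≠ 0 := mul_ne_zero (mul_ne_zero (by norm_num) (C j).sgn_ne_zero) (sub_ne_zero.2 h1)
  have hb1' : b1 ≠ 0 := mul_ne_zero (mul_ne_zero (by norm_num) (C j').sgn_ne_zero)
    (sub_ne_zero.2 h1')
  have hmat : !![a0, a1; b0, b1] * !![u 0, w 0; u 1, w 1] = (1 : Matrix (Fin 2) (Fin 2) ℝ) := by
    rw [Matrix.mul_fin_two, Matrix.one_fin_two]
    have n00 : a0 * u 0 + a1 * u 1 = 1 := by rw [← hju, ha0, ha1]; ring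
    have n01 : a0 * w 0 + a1 * w 1 = 0 := by rw [← hjw, ha0, ha1]; ring
    have n10 : b0 * u 0 + b1 * u 1 = 0 := by rw [← hj'u, hb0, hb1]; ring
    have n11 : b0 * w 0 + b1 * w 1 = 1 := by rw [← hj'w, hb0, hb1]; ring
    rw [n00, n01, n10, n11]
  -- A one-sided inverse of a square matrix is two-sided; the reversed product expresses the plane
  -- coordinates through the two differentials.
  have hmat' := mul_eq_one_comm.1 hmat
  rw [Matrix.mul_fin_two, Matrix.one_fin_two] at hmat'
  have m00 := congrFun (congrFun hmat' 0) 0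
  have m01 := congrFun (congrFun hmat' 0) 1
  have m10 := congrFun (congrFun hmat' 1) 0
  have m11 := congrFun (congrFun hmat' 1) 1
  simp at m00 m01 m10 m11
  have hu0 : u 0 ≠ 0 := fun h0 => by
    simp only [h0, zero_mul, zero_add, mul_eq_zero, hb1', or_false] at m00 m01
    simp [m01] at m00
  have hw0 : w 0 ≠ 0 := fun h0 => by
    simp only [h0, zero_mul, add_zero, mul_eq_zero, ha1', or_false] at m00 m01
    simp [m01] at m00
  set κ := -(u 0 * σ + w 0 * σ') with hκ
  set κ' := -(u 1 * σ + w 1 * σ') with hκ'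
  let det : (Fin 2 → ℝ) → ℝ := fun x => 1 + κ * (x 0 - x₀ 0) + κ' * (x 1 - x₀ 1)
  let α : (Fin 2 → ℝ) → ℝ := fun x => u 0 + (u 0 * κ' - κ * u 1) * (x 1 - x₀ 1)
  let β : (Fin 2 → ℝ) → ℝ := fun x => w 0 + (w 0 * κ' - κ * w 1) * (x 1 - x₀ 1)
  have hdet : ContDiff ℝ ∞ det := by fun_prop
  have hα : ContDiff ℝ ∞ α := by fun_prop
  have hβ : ContDiff ℝ ∞ β := by fun_prop
  have key : ∀ x, det x * (x 0 - x₀ 0) = α x * (C j).val x + β x * (C j').val x := by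
    intro x
    have e1 := (C j).val_add x₀ (x - x₀)
    have e2 := (C j').val_add x₀ (x - x₀)
    rw [add_sub_cancel, (C j).fderiv_val, hj, ← hσ] at e1
    rw [add_sub_cancel, (C j').fderiv_val, hj', ← hσ'] at e2
    simp only [Pi.sub_apply] at e1 e2
    set ξ0 := x 0 - x₀ 0
    set ξ1 := x 1 - x₀ 1
    have e1' : (C j).val x = a0 * ξ0 + a1 * ξ1 - σ * (ξ0 ^ 2 + ξ1 ^ 2) := by
      rw [e1, ha0, ha1]; ring
    have e2' : (C j').val x = b0 * ξ0 + b1 * ξ1 - σ' * (ξ0 ^ 2 + ξ1 ^ 2) := by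
      rw [e2, hb0, hb1]; ring
    have hL0 : u 0 * (C j).val x + w 0 * (C j').val x = ξ0 + κ * (ξ0 ^ 2 + ξ1 ^ 2) := by
      rw [e1', e2', hκ]
      linear_combination ξ0 * m00 + ξ1 * m01
    have hL1 : u 1 * (C j).val x + w 1 * (C j').val x = ξ1 + κ' * (ξ0 ^ 2 + ξ1 ^ 2) := by
      rw [e1', e2', hκ']
      linear_combination ξ0 * m10 + ξ1 * m11
    have hdx : det x = 1 + κ * ξ0 + κ' * ξ1 := rfl
    have hax : α x = u 0 + (u 0 * κ' - κ * u 1) * ξ1 := rfl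
    have hbx : β x = w 0 + (w 0 * κ' - κ * w 1) * ξ1 := rfl
    rw [hdx, hax, hbx]
    -- These multipliers cancel the cubic terms, and what remains has `ξ0` as a factor.
    linear_combination -(1 + κ' * ξ1) * hL0 + κ * ξ1 * hL1
  let εA := u 0 / |u 0|
  let εB := w 0 / |w 0|
  have hsign : ∀ t : ℝ, t ≠ 0 → t / |t| * (t / |t|) = 1 := fun t ht => by
    rw [div_mul_div_comm, abs_mul_abs_self, div_self (mul_ne_zero ht ht)]
  have hsign' : ∀ t : ℝ, t ≠ 0 → 0 < t / |t| * t := fun t ht => by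
    have h2 : 0 < t * t := mul_self_pos.2 ht
    have h3 : 0 < |t| := abs_pos.2 ht
    rw [div_mul_eq_mul_div]; positivity
  let O : Set (Fin 2 → ℝ) := ({x | 0 < det x} ∩ {x | 0 < εA * α x} ∩ {x | 0 < εB * β x}) ∩
    ({x | 0 < planeCofactor C μ j x} ∩ {x | 0 < planeCofactor C μ j' x})
  have hRj := contDiff_planeCofactor C μ j
  have hRj' := contDiff_planeCofactor C μ j'
  have hO : IsOpen O :=
    (((isOpen_lt continuous_const hdet.continuous).inter
      (isOpen_lt continuous_const (continuous_const.mul hα.continuous))).inter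
      (isOpen_lt continuous_const (continuous_const.mul hβ.continuous))).inter
      ((isOpen_lt continuous_const hRj.continuous).inter
        (isOpen_lt continuous_const hRj'.continuous))
  have hpO : x₀ ∈ O := by
    refine ⟨⟨⟨?_, ?_⟩, ?_⟩, h.planeCofactor_pos hp.1 hj, h.planeCofactor_pos hp.1 hj'⟩
    · simp [det]
    · simpa [α] using hsign' _ hu0
    · simpa [β] using hsign' _ hw0
  let emb : Fin (k (μ j) + 1) ⊕ Fin (k (μ j') + 1) → MomentIndex k :=
    Sum.elim (fun s => Sum.inr ⟨μ j, s⟩) fun s => Sum.inr ⟨μ j', s⟩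
  have hemb : Function.Injective emb := by
    rintro (s | s) (t | t) hst
    · simpa [emb] using hst
    · exact absurd (congrArg Sigma.fst (Sum.inr.inj hst)) hμ
    · exact absurd (congrArg Sigma.fst (Sum.inr.inj hst)) hμ.symm
    · simpa [emb] using hst
  have hz1 := (planeProd_eq_zero_iff (C := C) (μ := μ) _ x₀).2 ⟨j, rfl, hj⟩
  have hz2 := (planeProd_eq_zero_iff (C := C) (μ := μ) _ x₀).2 ⟨j', rfl, hj'⟩
  refine h.exists_morse_of_sum_sq' hp (ι := Fin (k (μ j) + 1) ⊕ Fin (k (μ j') + 1)) hO hpO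
    (Sum.elim (fun _ => εA) fun _ => εB) ?_
    (Sum.elim (fun _ x => α x / (det x * planeCofactor C μ j x))
      fun _ x => β x / (det x * planeCofactor C μ j' x)) ?_ ?_
    (fun a q => q (emb a) - 0) ?_ ?_ ?_ ?_
  · rintro (s | s)
    · exact hsign _ hu0
    · exact hsign _ hw0
  · rintro (s | s)
    · exact hα.contDiffOn.div (hdet.mul hRj).contDiffOn fun x hx =>
        mul_ne_zero (ne_of_gt hx.1.1.1) (ne_of_gt hx.2.1)
    · exact hβ.contDiffOn.div (hdet.mul hRj').contDiffOn fun x hx =>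
        mul_ne_zero (ne_of_gt hx.1.1.1) (ne_of_gt hx.2.2)
  · rintro (s | s) x hx
    · simp only [Sum.elim_inl, ← mul_div_assoc]
      exact div_pos hx.1.1.2 (mul_pos hx.1.1.1 hx.2.1)
    · simp only [Sum.elim_inr, ← mul_div_assoc]
      exact div_pos hx.1.2 (mul_pos hx.1.1.1 hx.2.2)
  · exact fun a => (contDiff_apply ℝ ℝ _).sub contDiff_const
  · rintro (s | s)
    · exact (sub_zero _).trans (coord_eq_zero hp.2 hz1 s)
    · exact (sub_zero _).trans (coord_eq_zero hp.2 hz2 s)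
  · intro q hq hqO
    simp only [Fintype.sum_sum_type, Sum.elim_inl, Sum.elim_inr, emb, sub_zero]
    rw [← Finset.mul_sum, ← Finset.mul_sum, sum_sq_eq hq.2 j, sum_sq_eq hq.2 j']
    have e1 : momentFun k q = momentProj k q 0 := rfl
    have e2 : momentFun k p = x₀ 0 := rfl
    have hk1 := key (momentProj k q)
    have n1 : det (momentProj k q) ≠ 0 := ne_of_gt hqO.1.1.1
    have n2 : planeCofactor C μ j (momentProj k q) ≠ 0 := ne_of_gt hqO.2.1
    have n3 : planeCofactor C μ j' (momentProj k q) ≠ 0 := ne_of_gt hqO.2.2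
    rw [e1, e2]
    field_simp
    linear_combination hk1
  · intro y
    obtain ⟨v, hv, hvz, hv0⟩ := exists_fderiv_momentMap_eq hp.2 0 (Function.extend emb y 0) 0 (by
        intro i hi
        simp)
    refine ⟨v, hv0, ?_⟩
    intro a
    rw [fderiv_coord]
    rcases a with s | s
    · exact (hvz _ s hz1).trans (hemb.extend_apply _ _ (Sum.inl s))
    · exact (hvz _ s hz2).trans (hemb.extend_apply _ _ (Sum.inr s))

/-- The first coordinate of a moment-like map is a Morse-Bott function if no corner of the region is
a vertical pole of one of the circles. -/
theorem isMorseBott_momentFun (h : IsMomentData D C μ) (k : Fin l₂ → ℕ)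
    (hcorner : ∀ x ∈ closure D, ∀ j j', j ≠ j' → (C j).val x = 0 → (C j').val x = 0 →
      x 1 ≠ (C j).center 1) :
    IsMorseBott (momentManifold C μ k D) (momentFun k) := by
  refine ⟨contDiff_momentFun k, fun p hps => ?_⟩
  have hp := hps.1
  have hcrit := (h.mem_singularPoints_iff hp).1 hps
  obtain ⟨j, hj⟩ := exists_val_eq_zero hcrit
  by_cases hu : ∀ i, (C i).val (momentProj k p) = 0 → i = j
  · exact h.exists_morse_of_pole hp hj hu (eq_center_of_mem_criticalPoints hcrit hu)
  · push Not at hu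
    obtain ⟨j', hj', hne⟩ := hu
    exact h.exists_morse_of_corner hp hne.symm hj hj' (hcorner _ hp.1 j j' hne.symm hj hj')
      (hcorner _ hp.1 j' j hne hj' hj)

end IsMomentData

/-! ### Graphs from local arcs -/

section Arcs

variable {W : Type*} [TopologicalSpace W]

/-- Outside `V`, the map `f` has local sections with open image through every point. -/
def HasLocalArcs (f : W → ℝ) (V : Set W) : Prop :=
  ∀ w ∉ V, ∃ δ > 0, ∃ σ : ℝ → W, ContinuousOn σ (Set.Ioo (f w - δ) (f w + δ)) ∧
    (∀ s ∈ Set.Ioo (f w - δ) (f w + δ), f (σ s) = s) ∧ σ (f w) = w ∧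
    IsOpen (σ '' Set.Ioo (f w - δ) (f w + δ))

variable {f : W → ℝ} {V : Set W}

/-- The image of the shortened interval is still open, being the old image intersected with the
preimage of that interval under `f`. -/
theorem HasLocalArcs.shrink (hf : Continuous f) (h : HasLocalArcs f V) {w : W} (hw : w ∉ V)
    {G : Set W} (hG : IsOpen G) (hwG : w ∈ G) :
    ∃ δ > 0, ∃ σ : ℝ → W, ContinuousOn σ (Set.Ioo (f w - δ) (f w + δ)) ∧
      (∀ s ∈ Set.Ioo (f w - δ) (f w + δ), f (σ s) = s) ∧ σ (f w) = w ∧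
      IsOpen (σ '' Set.Ioo (f w - δ) (f w + δ)) ∧
      ∀ s ∈ Set.Ioo (f w - δ) (f w + δ), σ s ∈ G := by
  obtain ⟨δ, hδ, σ, hσ, hfσ, hσw, hop⟩ := h w hw
  have hmem : Set.Ioo (f w - δ) (f w + δ) ∈ nhds (f w) := Ioo_mem_nhds (by linarith) (by linarith)
  have hev : ∀ᶠ s in nhds (f w), σ s ∈ G :=
    (hσ.continuousAt hmem).eventually (by rw [hσw]; exact hG.mem_nhds hwG)
  obtain ⟨δ', hδ', hδ'G⟩ := Metric.eventually_nhds_iff_ball.1 hev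
  have hsub : Set.Ioo (f w - min δ δ') (f w + min δ δ') ⊆ Set.Ioo (f w - δ) (f w + δ) :=
    Set.Ioo_subset_Ioo (by linarith [min_le_left δ δ']) (by linarith [min_le_left δ δ'])
  refine ⟨min δ δ', lt_min hδ hδ', σ, hσ.mono hsub, fun s hs => hfσ s (hsub hs), hσw, ?_, ?_⟩
  · have : σ '' Set.Ioo (f w - min δ δ') (f w + min δ δ') =
        σ '' Set.Ioo (f w - δ) (f w + δ) ∩ f ⁻¹' Set.Ioo (f w - min δ δ') (f w + min δ δ') := by
      ext z
      constructor
      · rintro ⟨s, hs, rfl⟩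
        refine ⟨⟨s, hsub hs, rfl⟩, ?_⟩
        rw [Set.mem_preimage, hfσ s (hsub hs)]
        exact hs
      · rintro ⟨⟨s, hs, rfl⟩, hz⟩
        rw [Set.mem_preimage, hfσ s hs] at hz
        exact ⟨s, hz, rfl⟩
    rw [this]
    exact hop.inter (isOpen_Ioo.preimage hf)
  · intro s hs
    refine hδ'G s ?_
    rw [Real.ball_eq_Ioo]
    exact Set.Ioo_subset_Ioo (by linarith [min_le_right δ δ']) (by linarith [min_le_right δ δ']) hs

theorem HasLocalArcs.neg (h : HasLocalArcs f V) : HasLocalArcs (fun w => -f w) V := by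
  intro w hw
  obtain ⟨δ, hδ, σ, hσ, hfσ, hσw, hop⟩ := h w hw
  have hmaps : ∀ s ∈ Set.Ioo (-f w - δ) (-f w + δ), -s ∈ Set.Ioo (f w - δ) (f w + δ) :=
    fun s hs => ⟨by linarith [hs.2], by linarith [hs.1]⟩
  refine ⟨δ, hδ, fun s => σ (-s), hσ.comp continuous_neg.continuousOn hmaps, ?_, ?_, ?_⟩
  · intro s hs
    change -f (σ (-s)) = s
    rw [hfσ _ (hmaps s hs), neg_neg]
  · change σ (- -f w) = w
    rw [neg_neg, hσw]
  · convert hop using 1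
    ext z
    constructor
    · rintro ⟨s, hs, rfl⟩
      exact ⟨-s, hmaps s hs, rfl⟩
    · rintro ⟨s, hs, rfl⟩
      exact ⟨-s, ⟨by linarith [hs.2], by linarith [hs.1]⟩, by simp⟩

/-- Sections over an interval that agree at the left end agree. -/
theorem HasLocalArcs.eqOn [T2Space W] (h : HasLocalArcs f V) {t β : ℝ} {σ₁ σ₂ : ℝ → W}
    (h₁ : ContinuousOn σ₁ (Set.Ico t β)) (h₂ : ContinuousOn σ₂ (Set.Ico t β))
    (hf₁ : ∀ s ∈ Set.Ico t β, f (σ₁ s) = s ∧ σ₁ s ∉ V)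
    (hf₂ : ∀ s ∈ Set.Ico t β, f (σ₂ s) = s ∧ σ₂ s ∉ V) (h0 : σ₁ t = σ₂ t) :
    Set.EqOn σ₁ σ₂ (Set.Ico t β) := by
  intro s hs
  let p : {w // w ∉ V} → ℝ := fun w => f w
  -- On a local arc `f` is injective. Off `V` the two sections are therefore lifts of one path along
  -- a locally injective map from a Hausdorff space, and such lifts agree once they agree at one
  -- point.
  have hinj : IsLocallyInjective p := by
    rintro ⟨w, hw⟩
    obtain ⟨δ, hδ, σ, hσ, hfσ, hσw, hop⟩ := h w hw
    refine ⟨Subtype.val ⁻¹' (σ '' Set.Ioo (f w - δ) (f w + δ)),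
      hop.preimage continuous_subtype_val, ⟨f w, ⟨by linarith, by linarith⟩, hσw⟩, ?_⟩
    rintro ⟨_, h1⟩ ⟨s, hs, rfl⟩ ⟨_, h2⟩ ⟨s', hs', rfl⟩ heq
    have heq' : f (σ s) = f (σ s') := heq
    rw [hfσ s hs, hfσ s' hs'] at heq'
    subst heq'
    rfl
  let g₁ : Set.Ico t β → {w // w ∉ V} := fun s => ⟨σ₁ s, (hf₁ s s.2).2⟩
  let g₂ : Set.Ico t β → {w // w ∉ V} := fun s => ⟨σ₂ s, (hf₂ s s.2).2⟩
  have : PreconnectedSpace (Set.Ico t β) := Subtype.preconnectedSpace isPreconnected_Ico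
  have := (T2Space.isSeparatedMap p).eq_of_comp_eq hinj (g₁ := g₁) (g₂ := g₂)
    (h₁.domRestrict.subtype_mk _) (h₂.domRestrict.subtype_mk _)
    (funext fun s => (hf₁ s s.2).1.trans (hf₂ s s.2).1.symm)
    ⟨t, ⟨le_rfl, hs.1.trans_lt hs.2⟩⟩ (Subtype.ext h0)
  exact congrArg Subtype.val (congrFun this ⟨s, hs⟩)

/-- There is a longest section over a half-open interval through a given point. -/
theorem HasLocalArcs.exists_maximal [CompactSpace W] [T2Space W] (hf : Continuous f)
    (hV : V.Finite) (h : HasLocalArcs f V) {w : W} (hw : w ∉ V) :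
    ∃ β > f w, ∃ σ : ℝ → W, ContinuousOn σ (Set.Ico (f w) β) ∧ σ (f w) = w ∧
      (∀ s ∈ Set.Ico (f w) β, f (σ s) = s ∧ σ s ∉ V) ∧
      ∀ β' > β, ¬ ∃ σ : ℝ → W, ContinuousOn σ (Set.Ico (f w) β') ∧ σ (f w) = w ∧
        ∀ s ∈ Set.Ico (f w) β', f (σ s) = s ∧ σ s ∉ V := by
  classical
  set t := f w with ht
  set S : Set ℝ := {β | t < β ∧ ∃ σ : ℝ → W, ContinuousOn σ (Set.Ico t β) ∧ σ t = w ∧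
    ∀ s ∈ Set.Ico t β, f (σ s) = s ∧ σ s ∉ V} with hS
  have hne : S.Nonempty := by
    obtain ⟨δ, hδ, σ, hσ, hfσ, hσw, -, hσV⟩ := h.shrink hf hw hV.isClosed.isOpen_compl hw
    have hsub : Set.Ico t (t + δ) ⊆ Set.Ioo (f w - δ) (f w + δ) := fun s hs =>
      ⟨by linarith [hs.1], hs.2⟩
    exact ⟨t + δ, by linarith, σ, hσ.mono hsub, hσw, fun s hs => ⟨hfσ s (hsub hs), hσV s (hsub hs)⟩⟩
  have hbdd : BddAbove S := by
    obtain ⟨B, hB⟩ := (isCompact_range hf).bddAbove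
    refine ⟨B, fun β hβ => ?_⟩
    obtain ⟨htβ, σ, -, -, hσ⟩ := hβ
    by_contra! hlt
    have hm : max t ((B + β) / 2) ∈ Set.Ico t β :=
      ⟨le_max_left _ _, max_lt htβ (by linarith)⟩
    have h1 := hB ⟨σ (max t ((B + β) / 2)), rfl⟩
    rw [(hσ _ hm).1] at h1
    linarith [le_max_right t ((B + β) / 2)]
  have hle : ∀ β ∈ S, β ≤ sSup S := fun β hβ => le_csSup hbdd hβ
  obtain ⟨β₀, hβ₀⟩ := hne
  have htS : t < sSup S := hβ₀.1.trans_le (hle β₀ hβ₀)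
  have hex : ∀ s : ℝ, ∃ β, s < sSup S → β ∈ S ∧ s < β := by
    intro s
    by_cases hs : s < sSup S
    · obtain ⟨β, hβ, hsβ⟩ := exists_lt_of_lt_csSup ⟨β₀, hβ₀⟩ hs
      exact ⟨β, fun _ => ⟨hβ, hsβ⟩⟩
    · exact ⟨0, fun h => absurd h hs⟩
  -- For each `s` below the supremum an endpoint `b s > s` in `S` is fixed; by uniqueness the value
  -- at `s` is the same for every section reaching past `s`, so the sections glue.
  choose b hb using hex
  have hsec : ∀ β, ∃ σ : ℝ → W, β ∈ S → ContinuousOn σ (Set.Ico t β) ∧ σ t = w ∧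
      ∀ s ∈ Set.Ico t β, f (σ s) = s ∧ σ s ∉ V := by
    intro β
    by_cases hβ : β ∈ S
    · obtain ⟨-, σ, hσ⟩ := hβ
      exact ⟨σ, fun _ => hσ⟩
    · exact ⟨fun _ => w, fun h => absurd h hβ⟩
  choose τ hτ using hsec
  let σ : ℝ → W := fun s => τ (b s) s
  have hagree : ∀ β ∈ S, ∀ s ∈ Set.Ico t β, σ s = τ β s := by
    intro β hβ s hs
    have hs' : s < sSup S := hs.2.trans_le (hle β hβ)
    obtain ⟨hb1, hb2⟩ := hb s hs'
    have hτ1 := hτ _ hb1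
    have hτ2 := hτ _ hβ
    have hsub1 : Set.Ico t (min (b s) β) ⊆ Set.Ico t (b s) := Set.Ico_subset_Ico_right (min_le_left _ _)
    have hsub2 : Set.Ico t (min (b s) β) ⊆ Set.Ico t β := Set.Ico_subset_Ico_right (min_le_right _ _)
    exact h.eqOn (hτ1.1.mono hsub1) (hτ2.1.mono hsub2) (fun u hu => hτ1.2.2 u (hsub1 hu))
      (fun u hu => hτ2.2.2 u (hsub2 hu)) (hτ1.2.1.trans hτ2.2.1.symm) ⟨hs.1, lt_min hb2 hs.2⟩
  refine ⟨sSup S, htS, σ, ?_, ?_, ?_, ?_⟩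
  · intro s hs
    obtain ⟨hb1, hb2⟩ := hb s hs.2
    have h1 : ContinuousWithinAt σ (Set.Ico t (b s)) s :=
      ((hτ _ hb1).1 s ⟨hs.1, hb2⟩).congr (fun u hu => hagree _ hb1 u hu)
        (hagree _ hb1 s ⟨hs.1, hb2⟩)
    refine h1.mono_of_mem_nhdsWithin ?_
    have h2 : Set.Ico t (sSup S) ∩ Set.Iio (b s) ∈ nhdsWithin s (Set.Ico t (sSup S)) :=
      Filter.inter_mem self_mem_nhdsWithin (mem_nhdsWithin_of_mem_nhds (Iio_mem_nhds hb2))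
    exact Filter.mem_of_superset h2 fun u hu => ⟨hu.1.1, hu.2⟩
  · exact (hagree β₀ hβ₀ t ⟨le_rfl, hβ₀.1⟩).trans (hτ β₀ hβ₀).2.1
  · intro s hs
    obtain ⟨hb1, hb2⟩ := hb s hs.2
    exact (hτ _ hb1).2.2 s ⟨hs.1, hb2⟩
  · rintro β' hβ' hσ'
    exact absurd (hle β' ⟨htS.trans hβ', hσ'⟩) (not_le.2 hβ')

/-- From a point outside `V`, a section can be followed to the right until it reaches `V`. -/
theorem HasLocalArcs.exists_right [CompactSpace W] [T2Space W] (hf : Continuous f)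
    (hV : V.Finite) (h : HasLocalArcs f V) {w : W} (hw : w ∉ V) :
    ∃ β > f w, ∃ γ : ℝ → W, ContinuousOn γ (Set.Icc (f w) β) ∧ γ (f w) = w ∧ γ β ∈ V ∧
      (∀ s ∈ Set.Icc (f w) β, f (γ s) = s) ∧ ∀ s ∈ Set.Ico (f w) β, γ s ∉ V := by
  classical
  obtain ⟨β, hβ, σ, hσ, hσw, hσf, hmax⟩ := h.exists_maximal hf hV hw
  set t := f w with ht
  have hev : ∀ a < β, ∀ᶠ s in nhdsWithin β (Set.Iio β), s ∈ Set.Ioo a β := fun a ha =>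
    Ioo_mem_nhdsLT ha
  have htend : Filter.Tendsto (fun s => f (σ s)) (nhdsWithin β (Set.Iio β)) (nhds β) := by
    have h1 : Filter.Tendsto (fun s : ℝ => s) (nhdsWithin β (Set.Iio β)) (nhds β) :=
      Filter.tendsto_id.mono_left nhdsWithin_le_nhds
    refine h1.congr' ?_
    filter_upwards [hev t hβ] with s hs
    exact (hσf s ⟨hs.1.le, hs.2⟩).1.symm
  -- A cluster point outside `V` has a local arc; the section enters this arc and could be continued
  -- along it beyond `β`, against maximality.
  have hcl : ∀ z, MapClusterPt z (nhdsWithin β (Set.Iio β)) σ → z ∈ V ∧ f z = β := by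
    intro z hz
    have hfz : f z = β := by
      have h1 : MapClusterPt (f z) (nhdsWithin β (Set.Iio β)) (f ∘ σ) :=
        hz.continuousAt_comp hf.continuousAt
      exact eq_of_nhds_neBot (ClusterPt.mono h1 htend)
    refine ⟨?_, hfz⟩
    by_contra hzV
    obtain ⟨δ, hδ, τ, hτ, hfτ, hτz, hop, hτV⟩ := h.shrink hf hzV hV.isClosed.isOpen_compl hzV
    rw [hfz] at hτ hfτ hop hτV
    have hzN : z ∈ τ '' Set.Ioo (β - δ) (β + δ) := ⟨β, ⟨by linarith, by linarith⟩, hfz ▸ hτz⟩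
    have hfr := hz.frequently (hop.mem_nhds hzN)
    obtain ⟨s₀, hs₀, hs₀1, hs₀2⟩ := (hfr.and_eventually
      (hev (max t (β - δ)) (max_lt hβ (by linarith)))).exists
    have hts₀ : t < s₀ := (le_max_left _ _).trans_lt hs₀1
    have hδs₀ : β - δ < s₀ := (le_max_right _ _).trans_lt hs₀1
    have heq : σ s₀ = τ s₀ := by
      obtain ⟨s', hs', he⟩ := hs₀
      have h1 := hfτ s' hs'
      rw [he, (hσf s₀ ⟨hts₀.le, hs₀2⟩).1] at h1
      rw [← he, h1]
    refine hmax (β + δ) (by linarith) ⟨fun s => if s ≤ s₀ then σ s else τ s, ?_, ?_, ?_⟩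
    · refine ContinuousOn.if ?_ ?_ ?_
      · rintro s ⟨-, hs⟩
        have : s = s₀ := by
          have hfrn : s ∈ frontier (Set.Iic s₀) := hs
          rwa [frontier_Iic, Set.mem_singleton_iff] at hfrn
        rw [this, heq]
      · refine hσ.mono ?_
        rintro s ⟨hs, hs'⟩
        have : s ∈ closure (Set.Iic s₀) := hs'
        rw [closure_Iic, Set.mem_Iic] at this
        exact ⟨hs.1, this.trans_lt hs₀2⟩
      · refine hτ.mono ?_
        rintro s ⟨hs, hs'⟩
        have : s ∈ closure (Set.Ioi s₀) := by
          convert hs' using 2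
          ext; simp
        rw [closure_Ioi, Set.mem_Ici] at this
        exact ⟨hδs₀.trans_le this, hs.2⟩
    · simp only [hts₀.le, if_true, hσw]
    · intro s hs
      by_cases hss : s ≤ s₀
      · simp only [hss, if_true]
        exact hσf s ⟨hs.1, hss.trans_lt hs₀2⟩
      · simp only [hss, if_false]
        have hsm : s ∈ Set.Ioo (β - δ) (β + δ) := ⟨hδs₀.trans (not_le.1 hss), hs.2⟩
        exact ⟨hfτ s hsm, hτV s hsm⟩
  obtain ⟨v, -, hv⟩ := isCompact_univ.exists_mapClusterPt (f := nhdsWithin β (Set.Iio β)) (u := σ)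
    (by simp)
  have hvV := hcl v hv
  -- If there were two cluster points, disjoint open sets around the one and around the rest of the
  -- finite set `V` would contain the connected image of `σ` near `β`; it would lie in one of them
  -- and could not cluster in the other.
  have hlim : Filter.Tendsto σ (nhdsWithin β (Set.Iio β)) (nhds v) := by
    refine isCompact_univ.tendsto_nhds_of_unique_mapClusterPt (by simp) fun z _ hz => ?_
    by_contra hne
    have hzV := hcl z hz
    obtain ⟨U₀, U₁, hU₀, hU₁, hvU, hVU, hdisj⟩ := SeparatedNhds.of_isCompact_isCompact
      (isCompact_singleton (x := v)) (hV.subset (Set.sdiff_subset (t := {v}))).isCompact (by simp)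
    have hvU : v ∈ U₀ := hvU rfl
    have hzU : z ∈ U₁ := hVU ⟨hzV.1, hne⟩
    have hevU : ∀ᶠ s in nhdsWithin β (Set.Iio β), σ s ∈ U₀ ∪ U₁ := by
      by_contra hcon
      obtain ⟨a, ha, hacl⟩ := IsCompact.exists_mapClusterPt_of_frequently
        (hU₀.union hU₁).isClosed_compl.isCompact (Filter.not_eventually.1 hcon)
      refine ha ?_
      by_cases hav : a = v
      · exact Or.inl (hav ▸ hvU)
      · exact Or.inr (hVU ⟨(hcl a hacl).1, hav⟩)
    obtain ⟨a, haβ, ha⟩ := (mem_nhdsLT_iff_exists_Ioo_subset' hβ).1 (hevU.and (hev t hβ))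
    have hpre : IsPreconnected (σ '' Set.Ioo a β) :=
      isPreconnected_Ioo.image _ (hσ.mono fun s hs => ⟨(ha hs).2.1.le, (ha hs).2.2⟩)
    have hsub : σ '' Set.Ioo a β ⊆ U₀ ∪ U₁ := by
      rintro _ ⟨s, hs, rfl⟩
      exact (ha hs).1
    have hfin : ∀ (y : W) (A B : Set W), MapClusterPt y (nhdsWithin β (Set.Iio β)) σ → IsOpen A →
        y ∈ A → Disjoint A B → σ '' Set.Ioo a β ⊆ B → False := by
      intro y A B hy hA hyA hAB hB
      obtain ⟨s, hs, hs'⟩ := ((hy.frequently (hA.mem_nhds hyA)).and_eventually (hev a haβ)).exists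
      exact Set.disjoint_left.1 hAB hs (hB ⟨s, hs', rfl⟩)
    rcases isPreconnected_iff_subset_of_disjoint.1 hpre U₀ U₁ hU₀ hU₁ hsub
      (by rw [hdisj.inter_eq, Set.inter_empty]) with h1 | h1
    · exact hfin z U₁ U₀ hz hU₁ hzU hdisj.symm h1
    · exact hfin v U₀ U₁ hv hU₀ hvU hdisj h1
  refine ⟨β, hβ, Function.update σ β v, ?_, ?_, ?_, ?_, ?_⟩
  · rw [continuousOn_update_iff, Set.Icc_sdiff_right]
    refine ⟨hσ, fun _ => ?_⟩
    rwa [nhdsWithin_Ico_eq_nhdsLT hβ]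
  · rw [Function.update_of_ne (ne_of_lt hβ), hσw]
  · rw [Function.update_self]
    exact hvV.1
  · intro s hs
    rcases eq_or_lt_of_le hs.2 with rfl | hlt
    · rw [Function.update_self]
      exact hvV.2
    · rw [Function.update_of_ne (ne_of_lt hlt)]
      exact (hσf s ⟨hs.1, hlt⟩).1
  · intro s hs
    rw [Function.update_of_ne (ne_of_lt hs.2)]
    exact (hσf s hs).2

/-- Every point outside `V` lies on an arc of which exactly the ends are in `V`. -/
theorem HasLocalArcs.exists_arc [CompactSpace W] [T2Space W] (hf : Continuous f)
    (hV : V.Finite) (h : HasLocalArcs f V) {w : W} (hw : w ∉ V) :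
    ∃ α β, f w ∈ Set.Ioo α β ∧ ∃ γ : ℝ → W, ContinuousOn γ (Set.Icc α β) ∧ γ (f w) = w ∧
      γ α ∈ V ∧ γ β ∈ V ∧ (∀ s ∈ Set.Icc α β, f (γ s) = s) ∧ ∀ s ∈ Set.Ioo α β, γ s ∉ V := by
  classical
  obtain ⟨β, hβ, γ, hγ, hγw, hγβ, hγf, hγV⟩ := h.exists_right hf hV hw
  -- The left half of the arc is the right half for `-f`; the level reached is `-α`.
  obtain ⟨α, hα, η, hη, hηw, hηα, hηf, hηV⟩ := h.neg.exists_right hf.neg hV hw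
  set t := f w with ht
  have hηf' : ∀ s ∈ Set.Icc (-t) α, f (η s) = -s := fun s hs => by
    have : -f (η s) = s := hηf s hs
    linarith
  have hαt : -α < t := by
    have : -t < α := hα
    linarith
  have hβt : t < β := hβ
  have hη' : ContinuousOn (fun s => η (-s)) (Set.Icc (-α) t) :=
    hη.comp continuous_neg.continuousOn fun s hs => ⟨by simpa using hs.2, by linarith [hs.1]⟩
  refine ⟨-α, β, ⟨hαt, hβt⟩, fun s => if s ≤ t then η (-s) else γ s, ?_, ?_, ?_, ?_, ?_, ?_⟩
  · refine ContinuousOn.if ?_ ?_ ?_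
    · rintro s ⟨-, hs⟩
      have : s = t := by
        have hfrn : s ∈ frontier (Set.Iic t) := hs
        rwa [frontier_Iic, Set.mem_singleton_iff] at hfrn
      rw [this, hγw]
      exact hηw
    · refine hη'.mono ?_
      rintro s ⟨hs, hs'⟩
      have : s ∈ closure (Set.Iic t) := hs'
      rw [closure_Iic, Set.mem_Iic] at this
      exact ⟨hs.1, this⟩
    · refine hγ.mono ?_
      rintro s ⟨hs, hs'⟩
      have : s ∈ closure (Set.Ioi t) := by
        convert hs' using 2
        ext; simp
      rw [closure_Ioi, Set.mem_Ici] at this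
      exact ⟨this, hs.2⟩
  · simp only [le_refl, if_true]
    exact hηw
  · simp only [hαt.le, if_true, neg_neg]
    exact hηα
  · simp only [not_le.2 hβt, if_false]
    exact hγβ
  · intro s hs
    by_cases hst : s ≤ t
    · simp only [hst, if_true]
      rw [hηf' (-s) ⟨by simpa using hst, by linarith [hs.1]⟩, neg_neg]
    · simp only [hst, if_false]
      exact hγf s ⟨(not_le.1 hst).le, hs.2⟩
  · intro s hs
    by_cases hst : s ≤ t
    · simp only [hst, if_true]
      exact hηV (-s) ⟨by simpa using hst, by linarith [hs.1]⟩
    · simp only [hst, if_false]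
      exact hγV s ⟨(not_le.1 hst).le, hs.2⟩

/-- An arc with interior outside `V` and ends in `V` is an edge. -/
theorem HasLocalArcs.connectedComponentIn_eq [T2Space W] (hf : Continuous f)
    (h : HasLocalArcs f V) {α β : ℝ} {γ : ℝ → W}
    (hγ : ContinuousOn γ (Set.Icc α β)) (hα : γ α ∈ V) (hβ : γ β ∈ V)
    (hγf : ∀ s ∈ Set.Icc α β, f (γ s) = s) (hγV : ∀ s ∈ Set.Ioo α β, γ s ∉ V) {t : ℝ}
    (ht : t ∈ Set.Ioo α β) : connectedComponentIn Vᶜ (γ t) = γ '' Set.Ioo α β := by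
  -- Near `γ s` every point lies on a local arc, and there `γ` takes its values in the same arc; as
  -- both are sections of `f`, they coincide. The open arc is also the trace on the complement of
  -- `V` of the compact arc, so it is open and closed there.
  have hopen : IsOpen (γ '' Set.Ioo α β) := by
    rw [isOpen_iff_mem_nhds]
    rintro _ ⟨s, hs, rfl⟩
    have hsI : s ∈ Set.Icc α β := Set.Ioo_subset_Icc_self hs
    have hcs : ContinuousAt γ s := hγ.continuousAt (Icc_mem_nhds hs.1 hs.2)
    obtain ⟨δ, hδ, τ, hτ, hfτ, hτs, hop⟩ := h (γ s) (hγV s hs)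
    rw [hγf s hsI] at hτ hfτ hop hτs
    have hmem : γ s ∈ τ '' Set.Ioo (s - δ) (s + δ) := ⟨s, ⟨by linarith, by linarith⟩, hτs⟩
    have hev : ∀ᶠ u in nhds s, γ u ∈ τ '' Set.Ioo (s - δ) (s + δ) ∧ u ∈ Set.Ioo α β :=
      (hcs.eventually (hop.mem_nhds hmem)).and (Ioo_mem_nhds hs.1 hs.2)
    have hev2 : ∀ᶠ z in nhds (γ s), γ (f z) ∈ τ '' Set.Ioo (s - δ) (s + δ) ∧ f z ∈ Set.Ioo α β :=
      hf.continuousAt.eventually (by rw [hγf s hsI]; exact hev)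
    filter_upwards [hev2, hop.mem_nhds hmem] with z hz hzN
    obtain ⟨u, hu, rfl⟩ := hzN
    rw [hfτ u hu] at hz
    obtain ⟨⟨u', hu', he⟩, huI⟩ := hz
    have h1 := hfτ u' hu'
    rw [he, hγf u (Set.Ioo_subset_Icc_self huI)] at h1
    subst h1
    exact ⟨u, huI, he.symm⟩
  have hmem : γ t ∈ γ '' Set.Ioo α β := ⟨t, ht, rfl⟩
  refine Set.Subset.antisymm ?_ ?_
  · have hcl : IsClosed (γ '' Set.Icc α β) := (isCompact_Icc.image_of_continuousOn hγ).isClosed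
    have hsub : ∀ z ∈ γ '' Set.Icc α β, z ∉ V → z ∈ γ '' Set.Ioo α β := by
      rintro _ ⟨s, hs, rfl⟩ hz
      refine ⟨s, ⟨lt_of_le_of_ne hs.1 ?_, lt_of_le_of_ne hs.2 ?_⟩, rfl⟩
      · rintro rfl; exact hz hα
      · rintro rfl; exact hz hβ
    have hAV : connectedComponentIn Vᶜ (γ t) ⊆ Vᶜ := connectedComponentIn_subset _ _
    rcases isPreconnected_iff_subset_of_disjoint.1
      (isPreconnected_connectedComponentIn (F := Vᶜ) (x := γ t)) _ _ hopen hcl.isOpen_compl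
      (fun z hz => (Classical.em (z ∈ γ '' Set.Icc α β)).imp (fun h1 => hsub z h1 (hAV hz)) id)
      (by
        refine Set.eq_empty_of_forall_notMem fun z hz => hz.2.2 ?_
        exact Set.image_mono Set.Ioo_subset_Icc_self hz.2.1) with h1 | h1
    · exact h1
    · exact absurd (Set.image_mono Set.Ioo_subset_Icc_self hmem)
        (h1 (mem_connectedComponentIn (hγV t ht)))
  · refine IsPreconnected.subset_connectedComponentIn
      (isPreconnected_Ioo.image _ (hγ.mono Set.Ioo_subset_Icc_self)) hmem ?_
    rintro _ ⟨s, hs, rfl⟩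
    exact hγV s hs

/-- Every edge is an arc parametrised by `f` between the levels of two vertices, so it is the
component of a point at the mean of two elements of `f '' V`. There are finitely many such levels,
each with finite fibre, hence finitely many edges. The parametrisation by `f` also makes the closed
arcs injective, which excludes loops. -/
theorem HasLocalArcs.isGraphWith [CompactSpace W] [T2Space W] (hf : Continuous f)
    (hV : V.Finite) (h : HasLocalArcs f V) (hfib : ∀ t, (f ⁻¹' {t}).Finite) : IsGraphWith V := by
  refine ⟨inferInstance, hV, ?_, ?_⟩
  · let T : Set ℝ := Set.image2 (fun a b => (a + b) / 2) (f '' V) (f '' V)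
    have hT : T.Finite := (hV.image f).image2 _ (hV.image f)
    have hP : (f ⁻¹' T).Finite := hT.preimage' fun t _ => hfib t
    refine (hP.image (connectedComponentIn Vᶜ)).subset ?_
    rintro e ⟨w, hw, rfl⟩
    obtain ⟨α, β, hwI, γ, hγ, hγw, hα, hβ, hγf, hγV⟩ := h.exists_arc hf hV hw
    have hαβ : α < β := hwI.1.trans hwI.2
    have hm : (α + β) / 2 ∈ Set.Ioo α β := ⟨by linarith, by linarith⟩
    refine ⟨γ ((α + β) / 2), ?_, ?_⟩
    · rw [Set.mem_preimage, hγf _ (Set.Ioo_subset_Icc_self hm)]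
      exact ⟨α, ⟨γ α, hα, hγf α ⟨le_rfl, hαβ.le⟩⟩, β, ⟨γ β, hβ, hγf β ⟨hαβ.le, le_rfl⟩⟩, rfl⟩
    · rw [h.connectedComponentIn_eq hf hγ hα hβ hγf hγV hm]
      have hcw := h.connectedComponentIn_eq hf hγ hα hβ hγf hγV hwI
      rw [hγw] at hcw
      exact hcw.symm
  · rintro e ⟨w, hw, rfl⟩
    obtain ⟨α, β, hwI, γ, hγ, hγw, hα, hβ, hγf, hγV⟩ := h.exists_arc hf hV hw
    have hαβ : α < β := hwI.1.trans hwI.2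
    have hpos : 0 < β - α := sub_pos.2 hαβ
    have hmaps : ∀ s : unitInterval, α + s * (β - α) ∈ Set.Icc α β := fun s =>
      ⟨by nlinarith [s.2.1], by nlinarith [s.2.2]⟩
    refine ⟨fun s => γ (α + s * (β - α)), ?_, ?_, ?_, ?_, ?_⟩
    · exact hγ.comp_continuous (by fun_prop) hmaps
    · intro s s' hss
      have h1 := congrArg f hss
      simp only [hγf _ (hmaps s), hγf _ (hmaps s')] at h1
      have h2 : (s : ℝ) * (β - α) = s' * (β - α) := by linarith
      exact Subtype.ext (mul_right_cancel₀ hpos.ne' h2)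
    · simpa using hα
    · simpa using hβ
    · have hcw := h.connectedComponentIn_eq hf hγ hα hβ hγf hγV hwI
      rw [hγw] at hcw
      rw [hcw]
      ext z
      constructor
      · rintro ⟨s, hs, rfl⟩
        have h0 : (0 : ℝ) < s := hs.1
        have h1 : (s : ℝ) < 1 := hs.2
        exact ⟨_, ⟨by nlinarith, by nlinarith⟩, rfl⟩
      · rintro ⟨s, hs, rfl⟩
        have h0 : 0 < (s - α) / (β - α) := div_pos (by linarith [hs.1]) hpos
        have h1 : (s - α) / (β - α) < 1 := by rw [div_lt_one hpos]; linarith [hs.2]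
        refine ⟨⟨(s - α) / (β - α), h0.le, h1.le⟩, ⟨h0, h1⟩, ?_⟩
        simp only
        congr 1
        field_simp
        ring

end Arcs

/-- Being a graph is invariant under homeomorphisms. -/
theorem IsGraphWith.of_homeomorph {X Y : Type*} [TopologicalSpace X] [TopologicalSpace Y]
    (h : X ≃ₜ Y) {V : Set X} {V' : Set Y} (hV : h '' V = V') (hg : IsGraphWith V') :
    IsGraphWith V := by
  subst hV
  have hc : h '' Vᶜ = (h '' V)ᶜ := Set.image_compl_eq h.bijective
  have hedge : ∀ e ∈ graphEdges V, h '' e ∈ graphEdges (h '' V) := by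
    rintro _ ⟨w, hw, rfl⟩
    refine ⟨h w, by rw [← hc]; exact ⟨w, hw, rfl⟩, ?_⟩
    rw [h.image_connectedComponentIn hw, hc]
  have := hg.t2
  refine ⟨h.symm.t2Space, Set.Finite.of_finite_image hg.finite_vertices h.injective.injOn, ?_, ?_⟩
  · refine Set.Finite.of_finite_image (f := fun e => h '' e) ?_ h.injective.image_injective.injOn
    refine hg.finite_edges.subset ?_
    rintro _ ⟨e, he, rfl⟩
    exact hedge e he
  · intro e he
    obtain ⟨γ, hγ, hinj, h0, h1, him⟩ := hg.edge_arc _ (hedge e he)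
    refine ⟨h.symm ∘ γ, h.symm.continuous.comp hγ, h.symm.injective.comp hinj, ?_, ?_, ?_⟩
    · obtain ⟨x, hx, hx'⟩ := h0
      rw [Function.comp_apply, ← hx', h.symm_apply_apply]
      exact hx
    · obtain ⟨x, hx, hx'⟩ := h1
      rw [Function.comp_apply, ← hx', h.symm_apply_apply]
      exact hx
    · rw [Set.image_comp, him, ← Set.image_comp]
      simp

/-! ### The Reeb space of the first coordinate on a plane set -/

theorem vec_eta (x : Fin 2 → ℝ) : ![x 0, x 1] = x := by
  funext i; fin_cases i <;> rfl

theorem continuous_vec {X : Type*} [TopologicalSpace X] {f g : X → ℝ} (hf : Continuous f)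
    (hg : Continuous g) : Continuous fun a => (![f a, g a] : Fin 2 → ℝ) := by
  refine continuous_pi fun i => ?_
  fin_cases i
  · exact hf
  · exact hg

section PlaneReeb

variable {K : Set (Fin 2 → ℝ)}

/-- Two points are equivalent iff the vertical segment joining them lies in the set. -/
theorem reebSetoid_plane_iff (x y : K) :
    (reebSetoid K (fun z => z 0)).r x y ↔
      (y : Fin 2 → ℝ) 0 = (x : Fin 2 → ℝ) 0 ∧
        ∀ s ∈ Set.uIcc ((x : Fin 2 → ℝ) 1) ((y : Fin 2 → ℝ) 1), ![(x : Fin 2 → ℝ) 0, s] ∈ K := by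
  set L : Set (Fin 2 → ℝ) := {z | z ∈ K ∧ z 0 = (x : Fin 2 → ℝ) 0} with hL
  change (y : Fin 2 → ℝ) ∈ connectedComponentIn L x ↔ _
  constructor
  · intro hy
    have hsub : connectedComponentIn L x ⊆ L := connectedComponentIn_subset _ _
    refine ⟨(hsub hy).2, fun s hs => ?_⟩
    have hpre : IsPreconnected ((fun z : Fin 2 → ℝ => z 1) '' connectedComponentIn L x) :=
      isPreconnected_connectedComponentIn.image _ (continuous_apply 1).continuousOn
    have hx : (x : Fin 2 → ℝ) ∈ connectedComponentIn L x := mem_connectedComponentIn ⟨x.2, rfl⟩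
    obtain ⟨z, hz, hzs⟩ := hpre.ordConnected.uIcc_subset ⟨x, hx, rfl⟩ ⟨y, hy, rfl⟩ hs
    have := hsub hz
    rw [← this.2, ← hzs, vec_eta]
    exact this.1
  · rintro ⟨h0, hseg⟩
    have hpre : IsPreconnected ((fun s : ℝ => (![(x : Fin 2 → ℝ) 0, s] : Fin 2 → ℝ)) ''
        Set.uIcc ((x : Fin 2 → ℝ) 1) ((y : Fin 2 → ℝ) 1)) :=
      isPreconnected_uIcc.image _ (continuous_vec continuous_const continuous_id).continuousOn
    refine hpre.subset_connectedComponentIn ⟨_, Set.left_mem_uIcc, vec_eta _⟩ ?_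
      ⟨_, Set.right_mem_uIcc, ?_⟩
    · rintro _ ⟨s, hs, rfl⟩
      exact ⟨hseg s hs, rfl⟩
    · simp only [← h0]
      exact vec_eta _

/-- The function induced by the first coordinate on the Reeb space. -/
def reebCoord (K : Set (Fin 2 → ℝ)) : ReebSpace K (fun z => z 0) → ℝ :=
  Quotient.lift (fun x => (x : Fin 2 → ℝ) 0)
    fun x y h => ((reebSetoid_plane_iff x y).1 h).1.symm

theorem continuous_reebCoord : Continuous (reebCoord K) :=
  Continuous.quotient_lift ((continuous_apply 0).comp continuous_subtype_val) _

/-- Classes at different levels are separated by the level. Between two classes at the same level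
some point is missing from `K`; as `K` is closed, it is missing at the same height for all nearby
abscissae, and the parts of `K` above and below this height are saturated open sets. -/
theorem t2Space_reebSpace (hK : IsClosed K) : T2Space (ReebSpace K (fun z => z 0)) := by
  refine ⟨fun w w' hne => ?_⟩
  by_cases hc : reebCoord K w = reebCoord K w'
  swap
  · obtain ⟨U, U', hU, hU', h1, h2, hd⟩ := t2_separation hc
    exact ⟨_, _, hU.preimage continuous_reebCoord, hU'.preimage continuous_reebCoord, h1, h2,
      hd.preimage _⟩
  have key : ∀ x y : K, (x : Fin 2 → ℝ) 0 = (y : Fin 2 → ℝ) 0 →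
      (x : Fin 2 → ℝ) 1 ≤ (y : Fin 2 → ℝ) 1 → Quotient.mk (reebSetoid K (fun z => z 0)) x ≠
      Quotient.mk (reebSetoid K (fun z => z 0)) y →
      ∃ U U' : Set (ReebSpace K (fun z => z 0)), IsOpen U ∧ IsOpen U' ∧
        Quotient.mk _ x ∈ U ∧ Quotient.mk _ y ∈ U' ∧ Disjoint U U' := by
    intro x y h0 hle hxy
    have hex : ∃ c ∈ Set.Icc ((x : Fin 2 → ℝ) 1) ((y : Fin 2 → ℝ) 1),
        ![(x : Fin 2 → ℝ) 0, c] ∉ K := by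
      by_contra! hcon
      refine hxy (Quotient.sound ((reebSetoid_plane_iff x y).2 ⟨h0.symm, ?_⟩))
      rwa [Set.uIcc_of_le hle]
    obtain ⟨c, hc, hcK⟩ := hex
    have hxc : (x : Fin 2 → ℝ) 1 < c := by
      refine lt_of_le_of_ne hc.1 fun he => hcK ?_
      rw [← he, vec_eta]; exact x.2
    have hcy : c < (y : Fin 2 → ℝ) 1 := by
      refine lt_of_le_of_ne hc.2 fun he => hcK ?_
      rw [he, h0, vec_eta]; exact y.2
    have hev : ∀ᶠ s in nhds ((x : Fin 2 → ℝ) 0), (![s, c] : Fin 2 → ℝ) ∉ K :=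
      (continuous_vec continuous_id continuous_const).continuousAt.eventually
        (hK.isOpen_compl.mem_nhds hcK)
    obtain ⟨G, hG, hGo, hxG⟩ := eventually_nhds_iff.1 hev
    have hsat : ∀ a b : K, (reebSetoid K (fun z => z 0)).r a b → (a : Fin 2 → ℝ) 0 ∈ G →
        ((a : Fin 2 → ℝ) 1 < c ↔ (b : Fin 2 → ℝ) 1 < c) ∧
        (c < (a : Fin 2 → ℝ) 1 ↔ c < (b : Fin 2 → ℝ) 1) := by
      intro a b hab haG
      have h1 := (reebSetoid_plane_iff a b).1 hab
      have h2 := hG _ haG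
      have h3 : c ∉ Set.uIcc ((a : Fin 2 → ℝ) 1) ((b : Fin 2 → ℝ) 1) := fun h => h2 (h1.2 c h)
      rw [Set.mem_uIcc] at h3
      push Not at h3
      refine ⟨⟨fun h => ?_, fun h => ?_⟩, ⟨fun h => ?_, fun h => ?_⟩⟩ <;>
        (by_contra! hcon; rcases h3 with ⟨h3, h4⟩)
      · linarith [h3 h.le]
      · linarith [h4 h.le]
      · linarith [h4 hcon]
      · linarith [h3 hcon]
    let A : Set K := {a | (a : Fin 2 → ℝ) 0 ∈ G ∧ (a : Fin 2 → ℝ) 1 < c}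
    let B : Set K := {a | (a : Fin 2 → ℝ) 0 ∈ G ∧ c < (a : Fin 2 → ℝ) 1}
    have c0 : Continuous fun a : K => (a : Fin 2 → ℝ) 0 :=
      (continuous_apply 0).comp continuous_subtype_val
    have c1 : Continuous fun a : K => (a : Fin 2 → ℝ) 1 :=
      (continuous_apply 1).comp continuous_subtype_val
    have hA : IsOpen A := (hGo.preimage c0).inter (isOpen_lt c1 continuous_const)
    have hB : IsOpen B := (hGo.preimage c0).inter (isOpen_lt continuous_const c1)
    have hpA : Quotient.mk (reebSetoid K (fun z => z 0)) ⁻¹' (Quotient.mk _ '' A) = A := by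
      refine Set.Subset.antisymm ?_ (Set.subset_preimage_image _ _)
      rintro b ⟨a, ha, hab⟩
      have hab : (reebSetoid K (fun z => z 0)).r a b := Quotient.exact hab
      exact ⟨((reebSetoid_plane_iff a b).1 hab).1 ▸ ha.1, (hsat a b hab ha.1).1.1 ha.2⟩
    have hpB : Quotient.mk (reebSetoid K (fun z => z 0)) ⁻¹' (Quotient.mk _ '' B) = B := by
      refine Set.Subset.antisymm ?_ (Set.subset_preimage_image _ _)
      rintro b ⟨a, ha, hab⟩
      have hab : (reebSetoid K (fun z => z 0)).r a b := Quotient.exact hab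
      exact ⟨((reebSetoid_plane_iff a b).1 hab).1 ▸ ha.1, (hsat a b hab ha.1).2.1 ha.2⟩
    refine ⟨Quotient.mk _ '' A, Quotient.mk _ '' B, ?_, ?_, ⟨x, ⟨hxG, hxc⟩, rfl⟩,
      ⟨y, ⟨h0 ▸ hxG, hcy⟩, rfl⟩, ?_⟩
    · exact isQuotientMap_quotient_mk'.isOpen_preimage.1 (by have h := hA; rw [← hpA] at h; exact h)
    · exact isQuotientMap_quotient_mk'.isOpen_preimage.1 (by have h := hB; rw [← hpB] at h; exact h)
    · rw [Set.disjoint_left]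
      rintro _ ⟨a, ha, rfl⟩ ⟨b, hb, hab⟩
      have hab : (reebSetoid K (fun z => z 0)).r b a := Quotient.exact hab
      exact lt_asymm ((hsat b a hab hb.1).2.1 hb.2) ha.2
  induction w using Quotient.ind with | _ x
  induction w' using Quotient.ind with | _ y
  rcases le_total ((x : Fin 2 → ℝ) 1) ((y : Fin 2 → ℝ) 1) with hle | hle
  · exact key x y hc hle hne
  · obtain ⟨U, U', h1, h2, h3, h4, h5⟩ := key y x hc.symm hle hne.symm
    exact ⟨U', U, h2, h1, h4, h3, h5.symm⟩

/-- From a point of a compact set one can go vertically, in either direction, to the end of the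
vertical slice. -/
theorem exists_vertical_end (hK : IsCompact K) {x : Fin 2 → ℝ} (hx : x ∈ K) {ε : ℝ}
    (hε : ε ≠ 0) :
    ∃ b ≥ 0, (∀ u ∈ Set.Icc 0 b, ![x 0, x 1 + ε * u] ∈ K) ∧
      ∀ b' > b, ∃ u ∈ Set.Ioc b b', ![x 0, x 1 + ε * u] ∉ K := by
  set S : Set ℝ := {b | 0 ≤ b ∧ ∀ u ∈ Set.Icc 0 b, ![x 0, x 1 + ε * u] ∈ K} with hS
  have h0 : (0 : ℝ) ∈ S := by
    refine ⟨le_rfl, fun u hu => ?_⟩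
    have : u = 0 := le_antisymm hu.2 hu.1
    rw [this, mul_zero, add_zero, vec_eta]
    exact hx
  have hbdd : BddAbove S := by
    obtain ⟨B, hB⟩ := (hK.image ((continuous_apply (A := fun _ : Fin 2 => ℝ) 1).sub
      (continuous_const (y := x 1))).abs).bddAbove
    refine ⟨B / |ε|, fun b hb => ?_⟩
    have h1 : |x 1 + ε * b - x 1| ≤ B := hB ⟨_, hb.2 b ⟨hb.1, le_rfl⟩, rfl⟩
    rw [add_sub_cancel_left, abs_mul, abs_of_nonneg hb.1] at h1
    rw [le_div_iff₀ (abs_pos.2 hε)]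
    linarith
  have hcont : Continuous fun u : ℝ => (![x 0, x 1 + ε * u] : Fin 2 → ℝ) :=
    continuous_vec continuous_const (by fun_prop)
  have hsup : 0 ≤ sSup S := le_csSup hbdd h0
  have hlt : ∀ u, 0 ≤ u → u < sSup S → ![x 0, x 1 + ε * u] ∈ K := by
    intro u hu0 hu
    obtain ⟨b, hb, hub⟩ := exists_lt_of_lt_csSup ⟨0, h0⟩ hu
    exact hb.2 u ⟨hu0, hub.le⟩
  have hle : ∀ u ∈ Set.Icc 0 (sSup S), ![x 0, x 1 + ε * u] ∈ K := by
    intro u hu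
    rcases eq_or_lt_of_le hu.2 with he | hl
    · have hcl : IsClosed ((fun u : ℝ => (![x 0, x 1 + ε * u] : Fin 2 → ℝ)) ⁻¹' K) :=
        hK.isClosed.preimage hcont
      have hsub : S ⊆ (fun u : ℝ => (![x 0, x 1 + ε * u] : Fin 2 → ℝ)) ⁻¹' K :=
        fun b hb => hb.2 b ⟨hb.1, le_rfl⟩
      rw [he]
      exact hcl.closure_subset_iff.2 hsub (csSup_mem_closure ⟨0, h0⟩ hbdd)
    · exact hlt u hu.1 hl
  refine ⟨sSup S, hsup, hle, fun b' hb' => ?_⟩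
  by_contra! hcon
  have : b' ∈ S := by
    refine ⟨hsup.trans hb'.le, fun u hu => ?_⟩
    rcases le_or_gt u (sSup S) with h1 | h1
    · exact hle u ⟨hu.1, h1⟩
    · exact hcon u ⟨h1, hu.2⟩
  exact absurd (le_csSup hbdd this) (not_le.2 hb')

end PlaneReeb

/-! ### Vertical derivatives of circle polynomials and finiteness of intersections -/

namespace OrientedCircle

/-- The derivative of the polynomial in the vertical direction. -/
noncomputable def dy (S : OrientedCircle) (x : Fin 2 → ℝ) : ℝ := -2 * S.sgn * (x 1 - S.center 1)

theorem continuous_dy (S : OrientedCircle) : Continuous S.dy := by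
  unfold dy; fun_prop

theorem dy_eq_zero_iff (S : OrientedCircle) (x : Fin 2 → ℝ) : S.dy x = 0 ↔ x 1 = S.center 1 := by
  simp [dy, S.sgn_ne_zero, sub_eq_zero]

/-- For a quadratic function the mean value theorem holds exactly at the midpoint. This turns the
sign of `dy` into strict monotonicity along vertical segments. -/
theorem val_sub_val (S : OrientedCircle) (s y y' : ℝ) :
    S.val ![s, y] - S.val ![s, y'] = (y - y') * S.dy ![s, (y + y') / 2] := by
  simp only [val_eq, dy, Matrix.cons_val_zero, Matrix.cons_val_one, Matrix.cons_val_fin_one]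
  ring

theorem finite_sq_eq (c : ℝ) : {y : ℝ | y ^ 2 = c}.Finite := by
  refine ((Set.finite_singleton (-√c)).insert (√c)).subset fun y hy => ?_
  have hy : y ^ 2 = c := hy
  have hc : 0 ≤ c := hy ▸ sq_nonneg y
  have : y ^ 2 = √c ^ 2 := by rw [hy, Real.sq_sqrt hc]
  exact sq_eq_sq_iff_eq_or_eq_neg.1 this

theorem finite_vertical (S : OrientedCircle) (t : ℝ) :
    {x : Fin 2 → ℝ | x 0 = t ∧ S.val x = 0}.Finite := by
  refine Set.Finite.of_injOn (f := fun x => x 1 - S.center 1)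
    (t := {y | y ^ 2 = S.radius ^ 2 - (t - S.center 0) ^ 2}) ?_ ?_ (finite_sq_eq _)
  · rintro x ⟨rfl, hx⟩
    rw [val_eq] at hx
    have := (mul_eq_zero.1 hx).resolve_left S.sgn_ne_zero
    simp only [Set.mem_ofPred_eq]
    linarith
  · rintro x ⟨hx, -⟩ y ⟨hy, -⟩ hxy
    have h1 : x 1 = y 1 := by simpa using hxy
    rw [← vec_eta x, ← vec_eta y, hx, hy, h1]

theorem finite_horizontal (S : OrientedCircle) (t : ℝ) :
    {x : Fin 2 → ℝ | x 1 = t ∧ S.val x = 0}.Finite := by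
  refine Set.Finite.of_injOn (f := fun x => x 0 - S.center 0)
    (t := {y | y ^ 2 = S.radius ^ 2 - (t - S.center 1) ^ 2}) ?_ ?_ (finite_sq_eq _)
  · rintro x ⟨rfl, hx⟩
    rw [val_eq] at hx
    have := (mul_eq_zero.1 hx).resolve_left S.sgn_ne_zero
    simp only [Set.mem_ofPred_eq]
    linarith
  · rintro x ⟨hx, -⟩ y ⟨hy, -⟩ hxy
    have h1 : x 0 = y 0 := by simpa using hxy
    rw [← vec_eta x, ← vec_eta y, hx, hy, h1]

/-- Two circles with different centres have finitely many common points. -/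
theorem finite_inter {S T : OrientedCircle} (hc : S.center ≠ T.center) :
    {x : Fin 2 → ℝ | S.val x = 0 ∧ T.val x = 0}.Finite := by
  set n0 := T.center 0 - S.center 0 with hn0
  set n1 := T.center 1 - S.center 1 with hn1
  have hn : 0 < n0 ^ 2 + n1 ^ 2 := by
    rcases eq_or_ne n0 0 with h0 | h0
    · have h1 : n1 ≠ 0 := by
        intro h1
        refine hc ?_
        rw [← vec_eta S.center, ← vec_eta T.center]
        rw [show S.center 0 = T.center 0 by linarith, show S.center 1 = T.center 1 by linarith]
      positivity
    · positivity
  set c := (S.radius ^ 2 - T.radius ^ 2 + n0 ^ 2 + n1 ^ 2) / 2 with hcdef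
  have hlin : ∀ x, S.val x = 0 → T.val x = 0 →
      (x 0 - S.center 0) ^ 2 + (x 1 - S.center 1) ^ 2 = S.radius ^ 2 ∧
      n0 * (x 0 - S.center 0) + n1 * (x 1 - S.center 1) = c := by
    intro x hx hx'
    rw [val_eq] at hx hx'
    have h1 := (mul_eq_zero.1 hx).resolve_left S.sgn_ne_zero
    have h2 := (mul_eq_zero.1 hx').resolve_left T.sgn_ne_zero
    refine ⟨by linarith, ?_⟩
    rw [hcdef, hn0, hn1]
    linear_combination (h2 - h1) / 2
  -- The difference of the two equations fixes the coordinate along the line of centres; the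
  -- perpendicular coordinate used here then has a prescribed square and determines the point.
  refine Set.Finite.of_injOn (f := fun x => n0 * (x 1 - S.center 1) - n1 * (x 0 - S.center 0))
    (t := {y | y ^ 2 = (n0 ^ 2 + n1 ^ 2) * S.radius ^ 2 - c ^ 2}) ?_ ?_ (finite_sq_eq _)
  · rintro x ⟨hx, hx'⟩
    obtain ⟨h1, h2⟩ := hlin x hx hx'
    simp only [Set.mem_ofPred_eq]
    rw [← h1, ← h2]
    ring
  · rintro x ⟨hx, hx'⟩ y ⟨hy, hy'⟩ hxy
    have h1 := (hlin x hx hx').2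
    have h2 := (hlin y hy hy').2
    have h3 : n0 * (x 1 - S.center 1) - n1 * (x 0 - S.center 0) =
      n0 * (y 1 - S.center 1) - n1 * (y 0 - S.center 0) := hxy
    have e0 : x 0 = y 0 := by
      have : (n0 ^ 2 + n1 ^ 2) * (x 0 - y 0) = 0 := by
        linear_combination n0 * (h1 - h2) - n1 * h3
      linarith [(mul_eq_zero.1 this).resolve_left hn.ne']
    have e1 : x 1 = y 1 := by
      have : (n0 ^ 2 + n1 ^ 2) * (x 1 - y 1) = 0 := by
        linear_combination n1 * (h1 - h2) + n0 * h3
      linarith [(mul_eq_zero.1 this).resolve_left hn.ne']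
    rw [← vec_eta x, ← vec_eta y, e0, e1]

end OrientedCircle

theorem mem_ball_plane {x z : Fin 2 → ℝ} {ρ : ℝ} (hρ : 0 < ρ) :
    x ∈ Metric.ball z ρ ↔ |x 0 - z 0| < ρ ∧ |x 1 - z 1| < ρ := by
  rw [Metric.mem_ball, dist_pi_lt_iff hρ, Fin.forall_fin_two, Real.dist_eq, Real.dist_eq]

/-- By the midpoint formula the value is the vertical displacement times a derivative close to the
one at `z`. This decides which vertical direction leaves the region. -/
theorem OrientedCircle.eventually_val_mul_pos {S : OrientedCircle} {z : Fin 2 → ℝ}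
    (hz : S.val z = 0) {ε : ℝ} (hε : ε ≠ 0) (hdy : S.dy z ≠ 0) :
    ∀ᶠ u in nhdsWithin (0 : ℝ) (Set.Ioi 0), 0 < ε * S.dy z * S.val ![z 0, z 1 + ε * u] := by
  have hc : Continuous fun u : ℝ => S.dy z * S.dy ![z 0, (z 1 + ε * u + z 1) / 2] :=
    continuous_const.mul (S.continuous_dy.comp (continuous_vec continuous_const (by fun_prop)))
  have h0 : 0 < S.dy z * S.dy ![z 0, (z 1 + ε * 0 + z 1) / 2] := by
    have : (z 1 + ε * 0 + z 1) / 2 = z 1 := by ring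
    rw [this, vec_eta]
    exact mul_self_pos.2 hdy
  have hev := (hc.continuousAt.eventually (lt_mem_nhds h0)).filter_mono
    (nhdsWithin_le_nhds (s := Set.Ioi (0 : ℝ)))
  filter_upwards [hev, self_mem_nhdsWithin] with u hu hu0
  have hu0 : 0 < u := hu0
  have h1 := S.val_sub_val (z 0) (z 1 + ε * u) (z 1)
  rw [vec_eta, hz, sub_zero, add_sub_cancel_left] at h1
  rw [h1]
  have h2 : ε * S.dy z * (ε * u * S.dy ![z 0, (z 1 + ε * u + z 1) / 2]) =
      (ε * ε) * u * (S.dy z * S.dy ![z 0, (z 1 + ε * u + z 1) / 2]) := by ring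
  rw [h2]
  exact mul_pos (mul_pos (mul_self_pos.2 hε) hu0) hu

/-! ### Vertical slices of the region and the graph structure of its Reeb space -/

/-- The vertices of the Reeb space of the closure of the region: the classes of critical points. -/
def planeVertices {l₁ : ℕ} (D : Set (Fin 2 → ℝ)) (C : Fin l₁ → OrientedCircle) :
    Set (ReebSpace (closure D) (fun x => x 0)) :=
  {w | ∃ x : closure D, (x : Fin 2 → ℝ) ∈ criticalPoints D C ∧ Quotient.mk _ x = w}

namespace IsMomentData

variable {l₁ l₂ : ℕ} {C : Fin l₁ → OrientedCircle} {μ : Fin l₁ → Fin l₂} {D : Set (Fin 2 → ℝ)}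

/-- Transversality makes the two differentials independent, so in the plane their common kernel is
zero. -/
theorem mem_criticalPoints_of_ne (h : IsMomentData D C μ) {x : Fin 2 → ℝ} (hx : x ∈ closure D)
    {j j' : Fin l₁} (hjj' : j ≠ j') (hj : (C j).val x = 0) (hj' : (C j').val x = 0) :
    x ∈ criticalPoints D C := by
  refine ⟨hx, fun v hv => ?_⟩
  obtain ⟨u, hu⟩ := h.exists_fderiv_eq hx fun i => if i = j then 1 else 0
  obtain ⟨w, hw⟩ := h.exists_fderiv_eq hx fun i => if i = j' then 1 else 0
  have hju := hu j hj
  have hj'u := hu j' hj'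
  have hjw := hw j hj
  have hj'w := hw j' hj'
  have hjv := hv j hj
  have hj'v := hv j' hj'
  simp only [if_true, hjj', hjj'.symm, if_false, (C j).fderiv_val, (C j').fderiv_val]
    at hju hj'u hjw hj'w hjv hj'v
  set a0 := -2 * (C j).sgn * (x 0 - (C j).center 0) with ha0
  set a1 := -2 * (C j).sgn * (x 1 - (C j).center 1) with ha1
  set b0 := -2 * (C j').sgn * (x 0 - (C j').center 0) with hb0
  set b1 := -2 * (C j').sgn * (x 1 - (C j').center 1) with hb1
  have e1 : a0 * u 0 + a1 * u 1 = 1 := by rw [← hju, ha0, ha1]; ring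
  have e2 : a0 * w 0 + a1 * w 1 = 0 := by rw [← hjw, ha0, ha1]; ring
  have e3 : b0 * u 0 + b1 * u 1 = 0 := by rw [← hj'u, hb0, hb1]; ring
  have e4 : b0 * w 0 + b1 * w 1 = 1 := by rw [← hj'w, hb0, hb1]; ring
  have e5 : a0 * v 0 + a1 * v 1 = 0 := by rw [← hjv, ha0, ha1]; ring
  have e6 : b0 * v 0 + b1 * v 1 = 0 := by rw [← hj'v, hb0, hb1]; ring
  have hdet : (a0 * b1 - a1 * b0) * (u 0 * w 1 - u 1 * w 0) = 1 := by
    linear_combination e1 * (b0 * w 0 + b1 * w 1) + e4 - e2 * (b0 * u 0 + b1 * u 1)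
  have hv0 : (a0 * b1 - a1 * b0) * v 0 = 0 := by
    linear_combination b1 * e5 - a1 * e6
  refine (mul_eq_zero.1 hv0).resolve_left fun h0 => ?_
  rw [h0, zero_mul] at hdet
  exact zero_ne_one hdet

/-- The differential is then a multiple of the first coordinate, and a nonzero one because the
radius is positive. -/
theorem mem_criticalPoints_of_dy_eq_zero {x : Fin 2 → ℝ} (hx : x ∈ closure D)
    {j : Fin l₁} (hj : (C j).val x = 0) (hdy : (C j).dy x = 0) : x ∈ criticalPoints D C := by
  refine ⟨hx, fun v hv => ?_⟩
  have h1 := hv j hj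
  rw [OrientedCircle.dy_eq_zero_iff] at hdy
  rw [(C j).fderiv_val, hdy] at h1
  rw [(C j).val_eq, hdy] at hj
  have h2 := (mul_eq_zero.1 hj).resolve_left (C j).sgn_ne_zero
  have h3 : x 0 - (C j).center 0 ≠ 0 := by
    intro h0
    rw [h0] at h2
    have := (C j).radius_pos
    nlinarith
  simp only [sub_self, zero_mul, add_zero, mul_eq_zero, (C j).sgn_ne_zero, h3] at h1
  simpa using h1

/-- A point of the closure that is not critical lies in the region, or on exactly one circle, at a
point where the tangent is not vertical. -/
theorem mem_or_of_notMem_criticalPoints (h : IsMomentData D C μ) {x : Fin 2 → ℝ}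
    (hx : x ∈ closure D) (hxc : x ∉ criticalPoints D C) :
    x ∈ D ∨ ∃ j, (C j).val x = 0 ∧ (∀ i, (C i).val x = 0 → i = j) ∧ (C j).dy x ≠ 0 := by
  by_cases hD : x ∈ D
  · exact Or.inl hD
  right
  rw [h.mem_iff hx] at hD
  push Not at hD
  obtain ⟨j, hj⟩ := hD
  have hj0 : (C j).val x = 0 := le_antisymm hj (h.val_nonneg hx j)
  refine ⟨j, hj0, fun i hi => ?_, fun hdy => hxc (mem_criticalPoints_of_dy_eq_zero hx hj0 hdy)⟩
  by_contra hij
  exact hxc (h.mem_criticalPoints_of_ne hx hij hi hj0)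

/-- Around a point on exactly one circle the region is given by the polynomial of this circle. -/
theorem eventually_mem_iff (h : IsMomentData D C μ) {z : Fin 2 → ℝ} (hz : z ∈ closure D)
    {j : Fin l₁} (huniq : ∀ i, (C i).val z = 0 → i = j) :
    ∀ᶠ x in nhds z, (x ∈ closure D ↔ 0 ≤ (C j).val x) ∧ (x ∈ D ↔ 0 < (C j).val x) ∧
      ∀ i, i ≠ j → 0 < (C i).val x := by
  obtain ⟨U, hUo, hDU, hU1, hU2⟩ := h.exists_nhds
  have e2 : ∀ᶠ x in nhds z, ∀ i, i ≠ j → 0 < (C i).val x := by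
    rw [Filter.eventually_all]
    intro i
    by_cases hi : i = j
    · simp [hi]
    have h0 : 0 < (C i).val z := lt_of_le_of_ne (h.val_nonneg hz i) fun h0 => hi (huniq i h0.symm)
    filter_upwards [(C i).continuous_val.continuousAt.eventually (lt_mem_nhds h0)] with x hx _
    exact hx
  filter_upwards [hUo.mem_nhds (hDU hz), e2] with x hxU hx2
  have hmem : 0 ≤ (C j).val x → x ∈ closure D := fun h0 => by
    refine hU2 x hxU fun i => Finset.prod_nonneg fun i' _ => ?_
    by_cases hi' : i' = j
    · rwa [hi']
    · exact (hx2 i' hi').le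
  refine ⟨⟨fun hx => h.val_nonneg hx j, hmem⟩, ⟨fun hx => ?_, fun h0 => hU1 x hxU fun i => ?_⟩, hx2⟩
  · exact (h.mem_iff (subset_closure hx)).1 hx j
  · by_cases hi : i = j
    · rwa [hi]
    · exact hx2 i hi

/-- The end of a vertical slice at a point that is not critical. -/
theorem exists_of_vertical_end (h : IsMomentData D C μ) {z : Fin 2 → ℝ} (hz : z ∈ closure D)
    (hzc : z ∉ criticalPoints D C) {ε : ℝ} (hε : ε ≠ 0)
    (hend : ∀ b > 0, ∃ u ∈ Set.Ioc 0 b, ![z 0, z 1 + ε * u] ∉ closure D) :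
    ∃ j, (C j).val z = 0 ∧ (∀ i, (C i).val z = 0 → i = j) ∧ ε * (C j).dy z < 0 := by
  have hcont : Continuous fun u : ℝ => (![z 0, z 1 + ε * u] : Fin 2 → ℝ) :=
    continuous_vec continuous_const (by fun_prop)
  have hz0 : (![z 0, z 1 + ε * 0] : Fin 2 → ℝ) = z := by rw [mul_zero, add_zero, vec_eta]
  have hno : ¬ ∀ᶠ u in nhdsWithin (0 : ℝ) (Set.Ioi 0), ![z 0, z 1 + ε * u] ∈ closure D := by
    intro hev
    obtain ⟨b, hb, hsub⟩ := mem_nhdsGT_iff_exists_Ioc_subset.1 hev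
    obtain ⟨u, hu, hu'⟩ := hend b hb
    exact hu' (hsub hu)
  rcases h.mem_or_of_notMem_criticalPoints hz hzc with hD | ⟨j, hj, huniq, hdy⟩
  · refine absurd ?_ hno
    have : ∀ᶠ u in nhds (0 : ℝ), ![z 0, z 1 + ε * u] ∈ D :=
      hcont.continuousAt.eventually (by beta_reduce; rw [hz0]; exact h.isOpen.mem_nhds hD)
    exact (this.filter_mono nhdsWithin_le_nhds).mono fun u hu => subset_closure hu
  · refine ⟨j, hj, huniq, lt_of_not_ge fun hge => hno ?_⟩
    have hpos : 0 < ε * (C j).dy z := lt_of_le_of_ne hge (mul_ne_zero hε hdy).symm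
    have h1 : ∀ᶠ u in nhds (0 : ℝ), (![z 0, z 1 + ε * u] ∈ closure D ↔
        0 ≤ (C j).val ![z 0, z 1 + ε * u]) := by
      refine hcont.continuousAt.eventually (p := fun x => x ∈ closure D ↔ 0 ≤ (C j).val x) ?_
      beta_reduce
      rw [hz0]
      exact (h.eventually_mem_iff hz huniq).mono fun x hx => hx.1
    filter_upwards [h1.filter_mono nhdsWithin_le_nhds,
      (C j).eventually_val_mul_pos hj hε hdy] with u hu1 hu2
    rw [hu1]
    exact (pos_of_mul_pos_right hu2 hpos.le).le

/-- A box around a point on exactly one circle at which the tangent is not vertical. -/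
theorem exists_box (h : IsMomentData D C μ) {z : Fin 2 → ℝ} (hz : z ∈ closure D)
    {j : Fin l₁} (huniq : ∀ i, (C i).val z = 0 → i = j) (hdy : (C j).dy z ≠ 0) :
    ∃ ρ > 0, ∀ x ∈ Metric.ball z ρ, (x ∈ closure D ↔ 0 ≤ (C j).val x) ∧ (x ∈ D ↔ 0 < (C j).val x) ∧
      (∀ i, i ≠ j → 0 < (C i).val x) ∧ 0 < (C j).dy z * (C j).dy x := by
  have h1 := (continuous_const (y := (C j).dy z)).mul (C j).continuous_dy
  have h2 := h1.continuousAt.eventually (lt_mem_nhds (mul_self_pos.2 hdy))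
  obtain ⟨ρ, hρ, hρ'⟩ := Metric.eventually_nhds_iff_ball.1 ((h.eventually_mem_iff hz huniq).and h2)
  exact ⟨ρ, hρ, fun x hx => ⟨(hρ' x hx).1.1, (hρ' x hx).1.2.1, (hρ' x hx).1.2.2, (hρ' x hx).2⟩⟩

/-- The shape of a class of the Reeb space that is not a vertex: a vertical segment which crosses
the region and ends at points on exactly one circle with non-vertical tangents. -/
theorem exists_slice (h : IsMomentData D C μ) (x : closure D)
    (hx : Quotient.mk _ x ∉ planeVertices D C) :
    ∃ a b : ℝ, a < b ∧ (x : Fin 2 → ℝ) 1 ∈ Set.Icc a b ∧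
      (∀ y ∈ Set.Icc a b, ![(x : Fin 2 → ℝ) 0, y] ∈ closure D ∧
        ![(x : Fin 2 → ℝ) 0, y] ∉ criticalPoints D C) ∧
      (∀ y ∈ Set.Ioo a b, ![(x : Fin 2 → ℝ) 0, y] ∈ D) ∧
      (∃ j, (C j).val ![(x : Fin 2 → ℝ) 0, b] = 0 ∧
        (∀ i, (C i).val ![(x : Fin 2 → ℝ) 0, b] = 0 → i = j) ∧
        (C j).dy ![(x : Fin 2 → ℝ) 0, b] < 0) ∧
      (∃ j, (C j).val ![(x : Fin 2 → ℝ) 0, a] = 0 ∧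
        (∀ i, (C i).val ![(x : Fin 2 → ℝ) 0, a] = 0 → i = j) ∧
        0 < (C j).dy ![(x : Fin 2 → ℝ) 0, a]) := by
  set t := (x : Fin 2 → ℝ) 0 with ht
  set y₀ := (x : Fin 2 → ℝ) 1 with hy₀
  obtain ⟨b, hb0, hb, hbend⟩ := exists_vertical_end h.isCompact_closure x.2 one_ne_zero
  obtain ⟨a, ha0, ha, haend⟩ := exists_vertical_end h.isCompact_closure x.2
    (neg_ne_zero.2 one_ne_zero)
  rw [← ht, ← hy₀] at hb hbend ha haend
  have hseg : ∀ y ∈ Set.Icc (y₀ - a) (y₀ + b), ![t, y] ∈ closure D := by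
    intro y hy
    rcases le_total y₀ y with hle | hle
    · have := hb (y - y₀) ⟨by linarith, by linarith [hy.2]⟩
      rwa [one_mul, add_sub_cancel] at this
    · have := ha (y₀ - y) ⟨by linarith, by linarith [hy.1]⟩
      rwa [neg_one_mul, neg_sub, add_sub_cancel] at this
  have hcrit : ∀ y ∈ Set.Icc (y₀ - a) (y₀ + b), ![t, y] ∉ criticalPoints D C := by
    intro y hy hyc
    refine hx ⟨⟨_, hseg y hy⟩, hyc, Quotient.sound ((reebSetoid_plane_iff _ _).2 ⟨rfl, ?_⟩)⟩
    intro s hs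
    refine hseg s ?_
    have hs' : s ∈ Set.uIcc y y₀ := hs
    rw [Set.mem_uIcc] at hs'
    rcases hs' with hs' | hs' <;> constructor <;> linarith [hs'.1, hs'.2, hy.1, hy.2]
  have htop : (y₀ + b) ∈ Set.Icc (y₀ - a) (y₀ + b) := ⟨by linarith, le_rfl⟩
  have hbot : (y₀ - a) ∈ Set.Icc (y₀ - a) (y₀ + b) := ⟨le_rfl, by linarith⟩
  obtain ⟨j, hj, hju, hjdy⟩ := h.exists_of_vertical_end (hseg _ htop) (hcrit _ htop) one_ne_zero
    (by
      intro c hc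
      obtain ⟨u, hu, hu'⟩ := hbend (b + c) (by linarith)
      refine ⟨u - b, ⟨by linarith [hu.1], by linarith [hu.2]⟩, ?_⟩
      simp only [Matrix.cons_val_zero, Matrix.cons_val_one, Matrix.cons_val_fin_one]
      rwa [show y₀ + b + 1 * (u - b) = y₀ + 1 * u by ring])
  obtain ⟨i, hi, hiu, hidy⟩ := h.exists_of_vertical_end (hseg _ hbot) (hcrit _ hbot)
    (neg_ne_zero.2 one_ne_zero)
    (by
      intro c hc
      obtain ⟨u, hu, hu'⟩ := haend (a + c) (by linarith)
      refine ⟨u - a, ⟨by linarith [hu.1], by linarith [hu.2]⟩, ?_⟩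
      simp only [Matrix.cons_val_zero, Matrix.cons_val_one, Matrix.cons_val_fin_one]
      rwa [show y₀ - a + -1 * (u - a) = y₀ + -1 * u by ring])
  rw [one_mul] at hjdy
  rw [neg_one_mul, neg_lt_zero] at hidy
  -- If the segment were a single point, the unique circle through it would have vertical
  -- derivatives of both signs.
  have hne : y₀ - a < y₀ + b := by
    rcases eq_or_lt_of_le (show y₀ - a ≤ y₀ + b by linarith) with heq | hlt
    · exfalso
      rw [← heq] at hj hju hjdy
      have := hiu j hj
      subst this
      exact lt_asymm hidy hjdy
    · exact hlt
  refine ⟨y₀ - a, y₀ + b, hne, ⟨by linarith, by linarith⟩, fun y hy => ⟨hseg y hy, hcrit y hy⟩, ?_,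
    ⟨j, hj, hju, hjdy⟩, ⟨i, hi, hiu, hidy⟩⟩
  intro y hy
  have hyI := Set.Ioo_subset_Icc_self hy
  refine (h.mem_or_of_notMem_criticalPoints (hseg y hyI) (hcrit y hyI)).resolve_right ?_
  rintro ⟨j', hj', -, hdy⟩
  -- Moving in the direction of `-dy` makes the polynomial negative, although nearby points of the
  -- segment still belong to the closure.
  have hε : -(C j').dy ![t, y] ≠ 0 := neg_ne_zero.2 hdy
  have h1 := (C j').eventually_val_mul_pos hj' hε hdy
  have h2 : ∀ᶠ u in nhds (0 : ℝ), y + -(C j').dy ![t, y] * u ∈ Set.Ioo (y₀ - a) (y₀ + b) := by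
    have hc : Continuous fun u : ℝ => y + -(C j').dy ![t, y] * u := by fun_prop
    refine hc.continuousAt.eventually ?_
    beta_reduce
    rw [mul_zero, add_zero]
    exact Ioo_mem_nhds hy.1 hy.2
  obtain ⟨u, hu1, hu2⟩ := (h1.and (h2.filter_mono nhdsWithin_le_nhds)).exists
  simp only [Matrix.cons_val_zero, Matrix.cons_val_one, Matrix.cons_val_fin_one] at hu1
  have h3 := h.val_nonneg (hseg _ (Set.Ioo_subset_Icc_self hu2)) j'
  have h4 : 0 < (C j').dy ![t, y] ^ 2 := by positivity
  nlinarith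

/-- The ends of a slice lie on circle arcs with non-vertical tangents, so for nearby abscissae the
closure meets a slightly taller window in one segment, which contains the point at the fixed height
`m`. The classes of these points form the arc. Its image is open because its preimage is the part of
the closure in an open box. -/
theorem hasLocalArcs (h : IsMomentData D C μ) :
    HasLocalArcs (reebCoord (closure D)) (planeVertices D C) := by
  classical
  intro w hw
  induction w using Quotient.ind with | _ x
  obtain ⟨a, b, hab, hxab, hseg, hint, ⟨j, hj, hju, hjdy⟩, ⟨i, hi, hiu, hidy⟩⟩ := h.exists_slice x hw
  change ∃ δ > 0, ∃ σ : ℝ → ReebSpace (closure D) (fun x => x 0),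
    ContinuousOn σ (Set.Ioo ((x : Fin 2 → ℝ) 0 - δ) ((x : Fin 2 → ℝ) 0 + δ)) ∧
    (∀ s ∈ Set.Ioo ((x : Fin 2 → ℝ) 0 - δ) ((x : Fin 2 → ℝ) 0 + δ), reebCoord _ (σ s) = s) ∧
    σ ((x : Fin 2 → ℝ) 0) = Quotient.mk _ x ∧
    IsOpen (σ '' Set.Ioo ((x : Fin 2 → ℝ) 0 - δ) ((x : Fin 2 → ℝ) 0 + δ))
  set t := (x : Fin 2 → ℝ) 0 with ht
  have hbI : b ∈ Set.Icc a b := ⟨hab.le, le_rfl⟩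
  have haI : a ∈ Set.Icc a b := ⟨le_rfl, hab.le⟩
  obtain ⟨ρ, hρ, hbox⟩ := h.exists_box (hseg b hbI).1 hju hjdy.ne
  obtain ⟨ρ', hρ', hbox'⟩ := h.exists_box (hseg a haI).1 hiu hidy.ne'
  obtain ⟨η, hη, hηρ, hηρ', hηab⟩ : ∃ η > 0, η < ρ ∧ η < ρ' ∧ η ≤ (b - a) / 2 := by
    refine ⟨min (min (ρ / 2) (ρ' / 2)) ((b - a) / 2), ?_, ?_, ?_, min_le_right _ _⟩
    · exact lt_min (lt_min (by linarith) (by linarith)) (by linarith)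
    · exact ((min_le_left _ _).trans (min_le_left _ _)).trans_lt (by linarith)
    · exact ((min_le_left _ _).trans (min_le_right _ _)).trans_lt (by linarith)
  have hvert : ∀ y, Continuous fun s : ℝ => (![s, y] : Fin 2 → ℝ) := fun y =>
    continuous_vec continuous_id continuous_const
  have hmemtop : ∀ s y, |s - t| < ρ → |y - b| < ρ → ![s, y] ∈ Metric.ball ![t, b] ρ :=
    fun s y h1 h2 => (mem_ball_plane hρ).2 ⟨h1, h2⟩
  have hmembot : ∀ s y, |s - t| < ρ' → |y - a| < ρ' → ![s, y] ∈ Metric.ball ![t, a] ρ' :=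
    fun s y h1 h2 => (mem_ball_plane hρ').2 ⟨h1, h2⟩
  have htopmono : ∀ s y y', |s - t| < ρ → |y - b| < ρ → |y' - b| < ρ → y < y' →
      (C j).val ![s, y'] < (C j).val ![s, y] := by
    intro s y y' hs hy hy' hlt
    rw [abs_lt] at hy hy'
    have h1 := (hbox _ (hmemtop s ((y + y') / 2) hs
      (abs_lt.2 ⟨by linarith, by linarith⟩))).2.2.2
    have h2 := (C j).val_sub_val s y y'
    have h3 : (C j).dy ![s, (y + y') / 2] < 0 := neg_of_mul_pos_right h1 hjdy.le
    nlinarith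
  have hbotmono : ∀ s y y', |s - t| < ρ' → |y - a| < ρ' → |y' - a| < ρ' → y < y' →
      (C i).val ![s, y] < (C i).val ![s, y'] := by
    intro s y y' hs hy hy' hlt
    rw [abs_lt] at hy hy'
    have h1 := (hbox' _ (hmembot s ((y + y') / 2) hs
      (abs_lt.2 ⟨by linarith, by linarith⟩))).2.2.2
    have h2 := (C i).val_sub_val s y y'
    have h3 : 0 < (C i).dy ![s, (y + y') / 2] := pos_of_mul_pos_right h1 hidy.le
    nlinarith
  -- Just beyond its ends the slice leaves the closure. These heights stay outside for nearby
  -- abscissae, while by compactness the middle part stays inside.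
  have htopout : ![t, b + η] ∉ closure D := by
    have := htopmono t b (b + η) (by simpa) (by simpa) (by simpa [abs_of_pos hη]) (by linarith)
    rw [hj] at this
    exact fun hmem => absurd (h.val_nonneg hmem j) (not_le.2 this)
  have hbotout : ![t, a - η] ∉ closure D := by
    have := hbotmono t (a - η) a (by simpa) (by simpa [abs_of_pos hη]) (by simpa) (by linarith)
    rw [hi] at this
    exact fun hmem => absurd (h.val_nonneg hmem i) (not_le.2 this)
  have hcl : IsOpen (closure D)ᶜ := isClosed_closure.isOpen_compl
  have ev1 : ∀ᶠ s in nhds t, ![s, b + η] ∉ closure D :=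
    (hvert _).continuousAt.eventually (hcl.mem_nhds htopout)
  have ev2 : ∀ᶠ s in nhds t, ![s, a - η] ∉ closure D :=
    (hvert _).continuousAt.eventually (hcl.mem_nhds hbotout)
  have ev3 : ∀ᶠ s in nhds t, ∀ y ∈ Set.Icc (a + η) (b - η), ![s, y] ∈ D := by
    refine isCompact_Icc.eventually_forall_of_forall_eventually fun y hy => ?_
    have hc : Continuous fun z : ℝ × ℝ => (![z.1, z.2] : Fin 2 → ℝ) :=
      continuous_vec continuous_fst continuous_snd
    exact hc.continuousAt.eventually
      (h.isOpen.mem_nhds (hint y ⟨by linarith [hy.1], by linarith [hy.2]⟩))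
  obtain ⟨δ₀, hδ₀, hδ⟩ := Metric.eventually_nhds_iff_ball.1 (ev1.and (ev2.and ev3))
  obtain ⟨δ, hδpos, hδδ, hδρ, hδρ'⟩ : ∃ δ > 0, δ ≤ δ₀ ∧ δ ≤ ρ ∧ δ ≤ ρ' :=
    ⟨min δ₀ (min ρ ρ'), lt_min hδ₀ (lt_min hρ hρ'), min_le_left _ _,
      (min_le_right _ _).trans (min_le_left _ _), (min_le_right _ _).trans (min_le_right _ _)⟩
  have habs : ∀ s ∈ Set.Ioo (t - δ) (t + δ), |s - t| < δ := fun s hs =>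
    abs_lt.2 ⟨by linarith [hs.1], by linarith [hs.2]⟩
  have hδ' : ∀ s ∈ Set.Ioo (t - δ) (t + δ), ![s, b + η] ∉ closure D ∧ ![s, a - η] ∉ closure D ∧
      ∀ y ∈ Set.Icc (a + η) (b - η), ![s, y] ∈ D := fun s hs =>
    hδ s (by rw [Metric.mem_ball, Real.dist_eq]; exact (habs s hs).trans_le hδδ)
  set m := (a + b) / 2 with hm
  have hmI : m ∈ Set.Icc (a + η) (b - η) := ⟨by linarith, by linarith⟩
  have hmK : ∀ s ∈ Set.Ioo (t - δ) (t + δ), ![s, m] ∈ closure D := fun s hs =>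
    subset_closure ((hδ' s hs).2.2 m hmI)
  let σ : ℝ → ReebSpace (closure D) (fun x => x 0) := fun s =>
    -- The value off the closure is irrelevant: on the interval used, the point at height `m` lies
    -- in the region.
    if hs : ![s, m] ∈ closure D then Quotient.mk _ ⟨![s, m], hs⟩ else Quotient.mk _ x
  have hσ : ∀ s (hs : ![s, m] ∈ closure D), σ s = Quotient.mk _ ⟨![s, m], hs⟩ := fun s hs =>
    dif_pos hs
  refine ⟨δ, hδpos, σ, ?_, ?_, ?_, ?_⟩
  · rw [continuousOn_iff_continuous_domRestrict]
    have : (Set.Ioo (t - δ) (t + δ)).domRestrict σ = fun s => Quotient.mk _ ⟨![s, m], hmK s s.2⟩ :=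
      funext fun s => hσ s _
    rw [this]
    exact continuous_quotient_mk'.comp
      (((hvert m).comp continuous_subtype_val).subtype_mk _)
  · intro s hs
    rw [hσ s (hmK s hs)]
    rfl
  · rw [hσ t (hseg m ⟨by linarith, by linarith⟩).1]
    refine Quotient.sound ((reebSetoid_plane_iff _ _).2 ⟨rfl, fun s hs => (hseg s ?_).1⟩)
    have hs' : s ∈ Set.uIcc m ((x : Fin 2 → ℝ) 1) := hs
    rw [Set.mem_uIcc] at hs'
    rcases hs' with hs' | hs' <;> constructor <;> linarith [hs'.1, hs'.2, hxab.1, hxab.2]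
  · have c0 : Continuous fun a : closure D => (a : Fin 2 → ℝ) 0 :=
      (continuous_apply 0).comp continuous_subtype_val
    have c1 : Continuous fun a : closure D => (a : Fin 2 → ℝ) 1 :=
      (continuous_apply 1).comp continuous_subtype_val
    have hpre : Quotient.mk _ ⁻¹' (σ '' Set.Ioo (t - δ) (t + δ)) =
        (fun z : closure D => (z : Fin 2 → ℝ) 0) ⁻¹' Set.Ioo (t - δ) (t + δ) ∩
          (fun z : closure D => (z : Fin 2 → ℝ) 1) ⁻¹' Set.Ioo (a - η) (b + η) := by
      ext z
      constructor
      · rintro ⟨s, hs, hsz⟩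
        rw [hσ s (hmK s hs)] at hsz
        obtain ⟨h1, h2⟩ := (reebSetoid_plane_iff _ _).1 (Quotient.exact hsz)
        have h1 : (z : Fin 2 → ℝ) 0 = s := h1
        have h2 : ∀ y ∈ Set.uIcc m ((z : Fin 2 → ℝ) 1), ![s, y] ∈ closure D := h2
        refine ⟨?_, ?_, ?_⟩
        · rw [Set.mem_preimage, h1]; exact hs
        · refine lt_of_not_ge fun hle => (hδ' s hs).2.1 (h2 _ ?_)
          exact Set.mem_uIcc.2 (Or.inr ⟨hle, by linarith⟩)
        · refine lt_of_not_ge fun hle => (hδ' s hs).1 (h2 _ ?_)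
          exact Set.mem_uIcc.2 (Or.inl ⟨by linarith, hle⟩)
      · rintro ⟨h1, h2⟩
        have h1 : (z : Fin 2 → ℝ) 0 ∈ Set.Ioo (t - δ) (t + δ) := h1
        have h2 : (z : Fin 2 → ℝ) 1 ∈ Set.Ioo (a - η) (b + η) := h2
        refine ⟨(z : Fin 2 → ℝ) 0, h1, ?_⟩
        rw [hσ _ (hmK _ h1)]
        refine Quotient.sound ((reebSetoid_plane_iff _ _).2 ⟨rfl, fun y hy => ?_⟩)
        change ![(z : Fin 2 → ℝ) 0, y] ∈ closure D
        have hy : y ∈ Set.uIcc m ((z : Fin 2 → ℝ) 1) := hy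
        have habsz := habs _ h1
        rw [Set.mem_uIcc] at hy
        -- The middle part lies in the region; in the two end boxes the circle polynomial grows
        -- towards the middle, so its nonnegativity at `z` passes to the points between.
        by_cases hy1 : y ∈ Set.Icc (a + η) (b - η)
        · exact subset_closure ((hδ' _ h1).2.2 y hy1)
        by_cases hyz : y = (z : Fin 2 → ℝ) 1
        · rw [hyz, vec_eta]; exact z.2
        have hzK : ![(z : Fin 2 → ℝ) 0, (z : Fin 2 → ℝ) 1] ∈ closure D := by
          rw [vec_eta]; exact z.2
        rcases hy with hy | hy
        · have hyb : b - η < y := by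
            by_contra! hcon
            exact hy1 ⟨by linarith [hy.1], hcon⟩
          have hyz : y < (z : Fin 2 → ℝ) 1 := lt_of_le_of_ne hy.2 hyz
          have hyρ : |y - b| < ρ := abs_lt.2 ⟨by linarith, by linarith [h2.2]⟩
          have hzρ : |(z : Fin 2 → ℝ) 1 - b| < ρ := abs_lt.2 ⟨by linarith, by linarith [h2.2]⟩
          have hlt := htopmono _ _ _ (habsz.trans_le hδρ) hyρ hzρ hyz
          exact (hbox _ (hmemtop _ _ (habsz.trans_le hδρ) hyρ)).1.2
            ((h.val_nonneg hzK j).trans hlt.le)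
        · have hyb : y < a + η := by
            by_contra! hcon
            exact hy1 ⟨hcon, by linarith [hy.2]⟩
          have hyz : (z : Fin 2 → ℝ) 1 < y := lt_of_le_of_ne hy.1 (Ne.symm hyz)
          have hyρ : |y - a| < ρ' := abs_lt.2 ⟨by linarith [h2.1], by linarith⟩
          have hzρ : |(z : Fin 2 → ℝ) 1 - a| < ρ' := abs_lt.2 ⟨by linarith [h2.1], by linarith⟩
          have hlt := hbotmono _ _ _ (habsz.trans_le hδρ') hzρ hyρ hyz
          exact (hbox' _ (hmembot _ _ (habsz.trans_le hδρ') hyρ)).1.2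
            ((h.val_nonneg hzK i).trans hlt.le)
    refine isQuotientMap_quotient_mk'.isOpen_preimage.1 ?_
    have hop := (isOpen_Ioo.preimage c0 (t := Set.Ioo (t - δ) (t + δ))).inter
      (isOpen_Ioo.preimage c1 (t := Set.Ioo (a - η) (b + η)))
    rw [← hpre] at hop
    exact hop

/-- A critical point on one circle only has the height of its centre; any other lies on two circles,
which transversality forces to have different centres. Either way there are finitely many
candidates. -/
theorem finite_criticalPoints (h : IsMomentData D C μ) : (criticalPoints D C).Finite := by
  have hfin : (⋃ j, {x : Fin 2 → ℝ | x 1 = (C j).center 1 ∧ (C j).val x = 0}) ∪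
      ⋃ (p : Fin l₁ × Fin l₁) (_ : (C p.1).center ≠ (C p.2).center),
        {x : Fin 2 → ℝ | (C p.1).val x = 0 ∧ (C p.2).val x = 0} |>.Finite := by
    refine (Set.finite_iUnion fun j => (C j).finite_horizontal _).union
      (Set.finite_iUnion fun p => Set.finite_iUnion fun hp => OrientedCircle.finite_inter hp)
  refine hfin.subset fun x hx => ?_
  obtain ⟨j, hj⟩ := exists_val_eq_zero hx
  by_cases hu : ∀ i, (C i).val x = 0 → i = j
  · exact Or.inl (Set.mem_iUnion.2 ⟨j, eq_center_of_mem_criticalPoints hx hu, hj⟩)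
  · push Not at hu
    obtain ⟨i, hi, hij⟩ := hu
    refine Or.inr (Set.mem_iUnion.2 ⟨(j, i), Set.mem_iUnion.2 ⟨fun hc => ?_, hj, hi⟩⟩)
    -- With a common centre the two differentials would be proportional and could not take the
    -- values `1` and `0`.
    obtain ⟨u, hu⟩ := h.exists_fderiv_eq hx.1 fun i' => if i' = j then 1 else 0
    have h1 := hu j hj
    have h2 := hu i hi
    simp only [if_true, hij, if_false, (C j).fderiv_val, (C i).fderiv_val] at h1 h2
    have hc : (C j).center = (C i).center := hc
    rw [← hc, mul_assoc, mul_eq_zero, mul_eq_zero] at h2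
    rcases h2 with h2 | h2 | h2
    · norm_num at h2
    · exact (C i).sgn_ne_zero h2
    · rw [h2, mul_zero] at h1
      exact zero_ne_one h1

/-- Each class is represented by the upper end of a vertical segment, which lies on a circle, and a
vertical line meets each circle in finitely many points. -/
theorem finite_reebCoord_fibre (h : IsMomentData D C μ) (t : ℝ) :
    (reebCoord (closure D) ⁻¹' {t}).Finite := by
  have hfin : (⋃ j, {x : Fin 2 → ℝ | x 0 = t ∧ (C j).val x = 0}).Finite :=
    Set.finite_iUnion fun j => (C j).finite_vertical t
  have hfin' : ((fun x : closure D => (x : Fin 2 → ℝ)) ⁻¹'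
      ⋃ j, {x : Fin 2 → ℝ | x 0 = t ∧ (C j).val x = 0}).Finite :=
    hfin.preimage Subtype.val_injective.injOn
  refine (hfin'.image (Quotient.mk _)).subset ?_
  intro w hw
  induction w using Quotient.ind with | _ x
  have hxt : (x : Fin 2 → ℝ) 0 = t := hw
  obtain ⟨b, hb0, hb, hend⟩ := exists_vertical_end h.isCompact_closure x.2 one_ne_zero
  have hK := hb b ⟨hb0, le_rfl⟩
  refine ⟨⟨_, hK⟩, ?_, ?_⟩
  · have hnD : ![(x : Fin 2 → ℝ) 0, (x : Fin 2 → ℝ) 1 + 1 * b] ∉ D := by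
      intro hD
      have hcont : Continuous fun u : ℝ =>
          (![(x : Fin 2 → ℝ) 0, (x : Fin 2 → ℝ) 1 + 1 * u] : Fin 2 → ℝ) :=
        continuous_vec continuous_const (by fun_prop)
      have hev : ∀ᶠ u in nhds b, ![(x : Fin 2 → ℝ) 0, (x : Fin 2 → ℝ) 1 + 1 * u] ∈ D :=
        hcont.continuousAt.eventually (h.isOpen.mem_nhds hD)
      obtain ⟨δ, hδ, hδ'⟩ := Metric.eventually_nhds_iff_ball.1 hev
      obtain ⟨u, hu, hu'⟩ := hend (b + δ / 2) (by linarith)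
      refine hu' (subset_closure (hδ' u ?_))
      rw [Metric.mem_ball, Real.dist_eq, abs_lt]
      exact ⟨by linarith [hu.1], by linarith [hu.2]⟩
    rw [h.mem_iff hK] at hnD
    push Not at hnD
    obtain ⟨j, hj⟩ := hnD
    exact Set.mem_iUnion.2 ⟨j, hxt, le_antisymm hj (h.val_nonneg hK j)⟩
  · refine Quotient.sound ((reebSetoid_plane_iff _ _).2 ⟨rfl, fun s hs => ?_⟩)
    have hs' : s ∈ Set.uIcc ((x : Fin 2 → ℝ) 1 + 1 * b) ((x : Fin 2 → ℝ) 1) := hs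
    rw [Set.mem_uIcc] at hs'
    have := hb (s - (x : Fin 2 → ℝ) 1) (by
      rcases hs' with hs' | hs' <;> constructor <;> linarith [hs'.1, hs'.2])
    rwa [one_mul, add_sub_cancel] at this

theorem finite_planeVertices (h : IsMomentData D C μ) : (planeVertices D C).Finite := by
  have h1 : ((fun x : closure D => (x : Fin 2 → ℝ)) ⁻¹' criticalPoints D C).Finite :=
    h.finite_criticalPoints.preimage Subtype.val_injective.injOn
  refine (h1.image (Quotient.mk _)).subset ?_
  rintro w ⟨x, hx, rfl⟩
  exact ⟨x, hx, rfl⟩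

theorem compactSpace_closure (h : IsMomentData D C μ) : CompactSpace (closure D) :=
  isCompact_iff_compactSpace.1 h.isCompact_closure

theorem isGraphWith_planeVertices (h : IsMomentData D C μ) : IsGraphWith (planeVertices D C) := by
  have := h.compactSpace_closure
  have := t2Space_reebSpace (isClosed_closure (s := D))
  exact h.hasLocalArcs.isGraphWith continuous_reebCoord h.finite_planeVertices
    h.finite_reebCoord_fibre

theorem image_reebVertices (h : IsMomentData D C μ) {k : Fin l₂ → ℕ} (hk : ∀ i, 0 < k i) :
    h.reebHomeomorph hk '' reebVertices (momentManifold C μ k D) (momentFun k) =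
      planeVertices D C := by
  ext w
  constructor
  · rintro ⟨_, ⟨p, hp, rfl⟩, rfl⟩
    exact ⟨_, (h.mem_singularPoints_iff p.2).1 hp, (h.reebHomeomorph_mk hk p).symm⟩
  · rintro ⟨x, hx, rfl⟩
    refine ⟨_, ⟨⟨_, h.momentSection_mem_manifold k x.2⟩, ?_, rfl⟩, h.reebHomeomorph_mk hk _⟩
    exact (h.mem_singularPoints_iff (h.momentSection_mem_manifold k x.2)).2 hx

/-- The Reeb space of the first coordinate of the moment-like map is a graph. -/
theorem isGraphWith_reebVertices (h : IsMomentData D C μ) {k : Fin l₂ → ℕ} (hk : ∀ i, 0 < k i) :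
    IsGraphWith (reebVertices (momentManifold C μ k D) (momentFun k)) :=
  h.isGraphWith_planeVertices.of_homeomorph (h.reebHomeomorph hk) (h.image_reebVertices hk)

end IsMomentData

/-! ### Cutting a small disc out of the region -/

/-- The square of the Euclidean distance in the plane. -/
noncomputable def sqDist (c x : Fin 2 → ℝ) : ℝ := (x 0 - c 0) ^ 2 + (x 1 - c 1) ^ 2

theorem continuous_sqDist (c : Fin 2 → ℝ) : Continuous (sqDist c) := by
  unfold sqDist; fun_prop

namespace OrientedCircle

set_option maxHeartbeats 1000000 in
/-- A disc near a point `q` of a circle with non-horizontal normal, such that the part of the disc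
on the positive side of the circle is a cap below the horizontal diameter. -/
theorem exists_cutting_disc (T : OrientedCircle) {q : Fin 2 → ℝ} (hq : T.val q = 0)
    (hdy : T.dy q < 0) {r₀ : ℝ} (hr₀ : 0 < r₀) :
    ∃ (c : Fin 2 → ℝ) (ρ ρ₀ : ℝ), 0 < ρ ∧ ρ < ρ₀ ∧
      (∀ x, sqDist c x ≤ ρ₀ ^ 2 → x ∈ Metric.ball q r₀) ∧
      (∀ s, |s - c 0| ≤ ρ₀ → T.val ![s, c 1] < 0) ∧ sqDist c q < ρ ^ 2 ∧
      (∃ P Q, P ≠ Q ∧ ∀ x, (T.val x = 0 ∧ sqDist c x = ρ ^ 2) ↔ (x = P ∨ x = Q)) ∧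
      ∀ x, T.val x = 0 → sqDist c x = ρ ^ 2 →
        (x 0 - T.center 0) * (x 1 - c 1) - (x 1 - T.center 1) * (x 0 - c 0) ≠ 0 := by
  set r := T.radius with hr
  have hrpos : 0 < r := T.radius_pos
  set σ := T.sgn with hσ
  have hσσ : σ * σ = 1 := T.sgn_mul_sgn
  -- The pair `(n0, n1)` is the unit normal at `q` that points out of the positive side; it points
  -- upwards since `dy` is negative.
  set n0 := σ * (q 0 - T.center 0) / r with hn0
  set n1 := σ * (q 1 - T.center 1) / r with hn1
  have hp0 : T.center 0 = q 0 - σ * r * n0 := by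
    rw [hn0]; field_simp; linear_combination (q 0 - T.center 0) * hσσ
  have hp1 : T.center 1 = q 1 - σ * r * n1 := by
    rw [hn1]; field_simp; linear_combination (q 1 - T.center 1) * hσσ
  have hnn : n0 ^ 2 + n1 ^ 2 = 1 := by
    rw [T.val_eq] at hq
    have h1 := (mul_eq_zero.1 hq).resolve_left T.sgn_ne_zero
    rw [hn0, hn1, div_pow, div_pow, ← add_div, div_eq_one_iff_eq (by positivity)]
    linear_combination -h1 + ((q 0 - T.center 0) ^ 2 + (q 1 - T.center 1) ^ 2) * hσσ
  have hn1pos : 0 < n1 := by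
    have h1 : T.dy q = -2 * (r * n1) := by
      unfold dy
      rw [hn1, ← hσ]; field_simp
    rw [h1] at hdy
    exact pos_of_mul_pos_right (by linarith : 0 < r * n1) hrpos.le
  have hval : ∀ x, T.val x = -2 * r * (n0 * (x 0 - q 0) + n1 * (x 1 - q 1)) -
      σ * ((x 0 - q 0) ^ 2 + (x 1 - q 1) ^ 2) := by
    intro x
    rw [T.val_eq, hp0, hp1, ← hσ, ← hr]
    linear_combination (-σ * r ^ 2 * σ ^ 2) * hnn +
      (-σ * r ^ 2 - 2 * r * (n0 * (x 0 - q 0) + n1 * (x 1 - q 1))) * hσσ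
  set κ := |n0| with hκ
  have hκ0 : 0 ≤ κ := abs_nonneg _
  have hκκ : κ ^ 2 = n0 ^ 2 := sq_abs _
  have hκ1 : κ < 1 := by nlinarith
  -- The radii will be `ρ = B * h` and `ρ₀ = A * h` with `1 < B < A`. The inequality `A * κ < 1`
  -- keeps the whole horizontal diameter on the outer side of the tangent line at `q`.
  set A := 2 / (1 + κ) with hA
  have hA1 : 1 < A := by rw [hA, lt_div_iff₀ (by linarith)]; linarith
  have hA2 : A ≤ 2 := by rw [hA, div_le_iff₀ (by linarith)]; linarith
  have hAκ : A * κ < 1 := by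
    rw [hA, div_mul_eq_mul_div, div_lt_one (by linarith)]; linarith
  set B := (1 + A) / 2 with hB
  have hB1 : 1 < B := by linarith
  have hBA : B < A := by linarith
  have hB2 : B ≤ 3 / 2 := by linarith
  -- Here `h` is the distance of the new centre from `q`. The bounds put the disc into the ball,
  -- since `1 + A ≤ 3`, make the two circles cross, and let the linear term of the polynomial
  -- dominate the quadratic one on the diameter, where `7 = 1 + 2 + 4`.
  obtain ⟨h, hh, hhr₀, hhr, hhA⟩ : ∃ h > 0, 3 * h < r₀ ∧ 9 * h < 2 * r ∧
      7 * h < 2 * r * (1 - A * κ) := by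
    have h3 : 0 < 2 * r * (1 - A * κ) := mul_pos (by linarith) (by linarith)
    refine ⟨min (min (r₀ / 6) (r / 9)) (2 * r * (1 - A * κ) / 14), ?_, ?_, ?_, ?_⟩
    · exact lt_min (lt_min (by linarith) (by linarith)) (by linarith)
    · have := (min_le_left (min (r₀ / 6) (r / 9)) (2 * r * (1 - A * κ) / 14)).trans
        (min_le_left _ _)
      linarith
    · have := (min_le_left (min (r₀ / 6) (r / 9)) (2 * r * (1 - A * κ) / 14)).trans
        (min_le_right _ _)
      linarith
    · have := min_le_right (min (r₀ / 6) (r / 9)) (2 * r * (1 - A * κ) / 14)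
      linarith
  have hBh : h < B * h := lt_mul_of_one_lt_left hh hB1
  have hBh2 : B * h ≤ 3 / 2 * h := mul_le_mul_of_nonneg_right hB2 hh.le
  have hAh2 : A * h ≤ 2 * h := mul_le_mul_of_nonneg_right hA2 hh.le
  have hBAh : B * h < A * h := mul_lt_mul_of_pos_right hBA hh
  clear_value A B n0 n1
  have hσabs : |σ| = 1 := by
    rcases mul_self_eq_one_iff.1 hσσ with h1 | h1 <;> rw [h1] <;> simp
  have habs0 : |n0| ≤ 1 := hκ1.le
  have habs1 : |n1| ≤ 1 := abs_le.2 ⟨by linarith, by nlinarith⟩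
  have hσr : 0 < r + σ * h := by
    rcases mul_self_eq_one_iff.1 hσσ with h1 | h1 <;> rw [h1] <;> linarith
  have hσr' : σ * r + h ≠ 0 := by
    rcases mul_self_eq_one_iff.1 hσσ with h1 | h1 <;> rw [h1] <;> intro h2 <;> linarith
  set c : Fin 2 → ℝ := ![q 0 + h * n0, q 1 + h * n1] with hc
  have hc0 : c 0 = q 0 + h * n0 := rfl
  have hc1 : c 1 = q 1 + h * n1 := rfl
  -- Eliminating the quadratic terms from the two circle equations leaves a linear equation for the
  -- normal coordinate of a common point, solved by `u`; `V` is the square of its tangential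
  -- coordinate. Positivity of `V` yields two points and transversality.
  set u := -σ * ((B * h) ^ 2 - h ^ 2) / (2 * (r + σ * h)) with hu
  set V := (B * h) ^ 2 - (u - h) ^ 2 with hV
  have hueq : u * (2 * (r + σ * h)) = -σ * ((B * h) ^ 2 - h ^ 2) := by
    rw [hu]; field_simp
  have hVpos : 0 < V := by
    have hulow : |u| < B * h - h := by
      rw [hu, abs_div, abs_mul, abs_neg, hσabs, one_mul,
        abs_of_pos (by linarith : 0 < 2 * (r + σ * h)),
        show (B * h) ^ 2 - h ^ 2 = (B * h - h) * (B * h + h) by ring,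
        abs_of_pos (mul_pos (by linarith) (by linarith)), div_lt_iff₀ (by linarith)]
      have h2 : r - h ≤ r + σ * h := by
        rcases mul_self_eq_one_iff.1 hσσ with h1 | h1 <;> rw [h1] <;> linarith
      exact mul_lt_mul_of_pos_left (by linarith) (by linarith)
    have h1 := abs_lt.1 hulow
    have h2 : 0 < B * h - (u - h) := by linarith
    have h3 : 0 < B * h + (u - h) := by linarith
    have h4 : V = (B * h - (u - h)) * (B * h + (u - h)) := by rw [hV]; ring
    rw [h4]
    exact mul_pos h2 h3
  have hsV : √V * √V = V := Real.mul_self_sqrt hVpos.le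
  have hsVpos : 0 < √V := Real.sqrt_pos.2 hVpos
  -- coordinates along the normal and the tangent
  have hcoord : ∀ x, T.val x = 0 → sqDist c x = (B * h) ^ 2 →
      n0 * (x 0 - q 0) + n1 * (x 1 - q 1) = u ∧
      (-n1 * (x 0 - q 0) + n0 * (x 1 - q 1)) ^ 2 = V := by
    intro x hx hx'
    rw [hval] at hx
    unfold sqDist at hx'
    rw [hc0, hc1] at hx'
    have h1 : n0 * (x 0 - q 0) + n1 * (x 1 - q 1) = u := by
      have h2 : (n0 * (x 0 - q 0) + n1 * (x 1 - q 1)) * (2 * (r + σ * h)) =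
          u * (2 * (r + σ * h)) := by
        rw [hueq]
        linear_combination -hx - σ * hx' + σ * h ^ 2 * hnn
      exact mul_right_cancel₀ (by linarith) h2
    refine ⟨h1, ?_⟩
    rw [hV, ← h1]
    linear_combination hx' + ((x 0 - q 0) ^ 2 + (x 1 - q 1) ^ 2 - h ^ 2) * hnn
  refine ⟨c, B * h, A * h, by linarith, hBAh, ?_, ?_, ?_, ?_, ?_⟩
  · intro x hx
    unfold sqDist at hx
    have h0 : |x 0 - c 0| ≤ A * h := abs_le_of_sq_le_sq (by linarith [sq_nonneg (x 1 - c 1)])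
      (by linarith)
    have h1 : |x 1 - c 1| ≤ A * h := abs_le_of_sq_le_sq (by linarith [sq_nonneg (x 0 - c 0)])
      (by linarith)
    have h2 : |h * n0| ≤ h := by
      rw [abs_mul, abs_of_pos hh]; exact mul_le_of_le_one_right hh.le habs0
    have h3 : |h * n1| ≤ h := by
      rw [abs_mul, abs_of_pos hh]; exact mul_le_of_le_one_right hh.le habs1
    rw [abs_le] at h0 h1 h2 h3
    rw [mem_ball_plane hr₀, abs_lt, abs_lt]
    rw [hc0] at h0
    rw [hc1] at h1
    refine ⟨⟨?_, ?_⟩, ⟨?_, ?_⟩⟩ <;> linarith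
  · intro s hs
    rw [hval]
    simp only [Matrix.cons_val_zero, Matrix.cons_val_one, Matrix.cons_val_fin_one]
    set θ := s - c 0 with hθ
    have e0 : s - q 0 = h * n0 + θ := by rw [hθ, hc0]; ring
    have e1 : c 1 - q 1 = h * n1 := by rw [hc1]; ring
    rw [e0, e1]
    have h1 : n0 * (h * n0 + θ) + n1 * (h * n1) = h + n0 * θ := by
      linear_combination h * hnn
    have h2 : (h * n0 + θ) ^ 2 + (h * n1) ^ 2 = h ^ 2 + 2 * h * (n0 * θ) + θ ^ 2 := by
      linear_combination h ^ 2 * hnn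
    rw [h1, h2]
    have h3 : |n0 * θ| ≤ κ * (A * h) := by
      rw [abs_mul]
      exact mul_le_mul_of_nonneg_left hs hκ0
    have h4 := abs_le.1 h3
    have h5 : θ ^ 2 ≤ (2 * h) ^ 2 := by
      rw [← sq_abs]
      have : |θ| ≤ 2 * h := hs.trans hAh2
      exact pow_le_pow_left₀ (abs_nonneg _) this 2
    have h6 : κ * (A * h) = h * (A * κ) := by ring
    have h6' : h * (A * κ) ≤ h * 1 := mul_le_mul_of_nonneg_left hAκ.le hh.le
    have h7 : |σ * (h ^ 2 + 2 * h * (n0 * θ) + θ ^ 2)| ≤ 7 * h ^ 2 := by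
      have h8 : |2 * h * (n0 * θ)| ≤ 2 * h * h := by
        rw [abs_mul, abs_of_pos (by linarith : 0 < 2 * h)]
        exact mul_le_mul_of_nonneg_left (by linarith) (by linarith)
      have h9 := abs_le.1 h8
      rw [abs_mul, hσabs, one_mul, abs_le]
      constructor
      · linarith [sq_nonneg θ, sq_nonneg h, h9.1]
      · linarith [h9.2]
    have h8 := (abs_le.1 h7).1
    have h10 : 2 * r * (h * (1 - A * κ)) ≤ 2 * r * (h + n0 * θ) :=
      mul_le_mul_of_nonneg_left (by linarith [h4.1]) (by linarith)
    have h11 : h * (7 * h) < h * (2 * r * (1 - A * κ)) := mul_lt_mul_of_pos_left hhA hh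
    linarith
  · unfold sqDist
    rw [hc0, hc1]
    have h1 : (q 0 - (q 0 + h * n0)) ^ 2 + (q 1 - (q 1 + h * n1)) ^ 2 = h ^ 2 := by
      linear_combination h ^ 2 * hnn
    rw [h1]
    exact pow_lt_pow_left₀ hBh hh.le two_ne_zero
  · refine ⟨![q 0 + u * n0 - √V * n1, q 1 + u * n1 + √V * n0],
      ![q 0 + u * n0 + √V * n1, q 1 + u * n1 - √V * n0], ?_, ?_⟩
    · intro heq
      have := congrFun heq 0
      simp only [Matrix.cons_val_zero] at this
      linarith [mul_pos hsVpos hn1pos]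
    · intro x
      constructor
      · rintro ⟨hx, hx'⟩
        obtain ⟨h1, h2⟩ := hcoord x hx hx'
        set v := -n1 * (x 0 - q 0) + n0 * (x 1 - q 1) with hv
        have hx0 : x 0 = q 0 + u * n0 - v * n1 := by
          rw [hv, ← h1]; linear_combination -(x 0 - q 0) * hnn
        have hx1 : x 1 = q 1 + u * n1 + v * n0 := by
          rw [hv, ← h1]; linear_combination -(x 1 - q 1) * hnn
        have hvs : v = √V ∨ v = -√V := by
          refine sq_eq_sq_iff_eq_or_eq_neg.1 ?_
          rw [h2, Real.sq_sqrt hVpos.le]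
        rw [← vec_eta x, hx0, hx1]
        rcases hvs with hvs | hvs
        · left; rw [hvs]
        · right; rw [hvs]; congr 1
          · ring
          · congr 1; ring
      · have main : ∀ v, v * v = V → T.val ![q 0 + u * n0 - v * n1, q 1 + u * n1 + v * n0] = 0 ∧
            sqDist c ![q 0 + u * n0 - v * n1, q 1 + u * n1 + v * n0] = (B * h) ^ 2 := by
          intro v hv
          have hd : sqDist c ![q 0 + u * n0 - v * n1, q 1 + u * n1 + v * n0] = (B * h) ^ 2 := by
            unfold sqDist
            simp only [Matrix.cons_val_zero, Matrix.cons_val_one, Matrix.cons_val_fin_one]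
            rw [hc0, hc1]
            linear_combination ((u - h) ^ 2 + v ^ 2) * hnn + hv
          refine ⟨?_, hd⟩
          rw [hval]
          simp only [Matrix.cons_val_zero, Matrix.cons_val_one, Matrix.cons_val_fin_one]
          linear_combination (-2 * r * u - σ * (u ^ 2 + v ^ 2)) * hnn - σ * hv - hueq
        rintro (rfl | rfl)
        · exact main _ hsV
        · have := main (-√V) (by rw [neg_mul_neg]; exact hsV)
          rwa [show q 0 + u * n0 - -√V * n1 = q 0 + u * n0 + √V * n1 by ring,
            show q 1 + u * n1 + -√V * n0 = q 1 + u * n1 - √V * n0 by ring] at this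
  · intro x hx hx' h0
    obtain ⟨h1, h2⟩ := hcoord x hx hx'
    rw [hp0, hp1, hc0, hc1] at h0
    have h3 : (-n1 * (x 0 - q 0) + n0 * (x 1 - q 1)) * (σ * r + h) = 0 := by
      linear_combination h0
    rw [(mul_eq_zero.1 h3).resolve_right hσr'] at h2
    rw [← h2] at hVpos
    norm_num at hVpos

end OrientedCircle

/-- The polynomial `|x - p|² - r²` cuts the disc bounded by `S` out of the region `D`, the disc
being contained in a box around the boundary point `q`, in which the region is the part below the
circle `C j`; in the disc, the region lies below the horizontal diameter. -/
structure IsCut {l₁ : ℕ} (D : Set (Fin 2 → ℝ)) (C : Fin l₁ → OrientedCircle) (j : Fin l₁)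
    (S : OrientedCircle) (q : Fin 2 → ℝ) (r₀ ρ₀ : ℝ) : Prop where
  inside_eq : S.inside = false
  box : ∀ x ∈ Metric.ball q r₀, (x ∈ closure D ↔ 0 ≤ (C j).val x) ∧ (x ∈ D ↔ 0 < (C j).val x) ∧
    (∀ i, i ≠ j → 0 < (C i).val x) ∧ (C j).dy x < 0
  r₀_pos : 0 < r₀
  radius_lt : S.radius < ρ₀
  disc : ∀ x, sqDist S.center x ≤ ρ₀ ^ 2 → x ∈ Metric.ball q r₀
  diameter : ∀ s, |s - S.center 0| ≤ ρ₀ → (C j).val ![s, S.center 1] < 0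
  mem_closure : q ∈ closure D
  sqDist_lt : sqDist S.center q < S.radius ^ 2
  transverse : ∀ x, (C j).val x = 0 → sqDist S.center x = S.radius ^ 2 →
    (x 0 - (C j).center 0) * (x 1 - S.center 1) - (x 1 - (C j).center 1) * (x 0 - S.center 0) ≠ 0

/-- The region without the closed disc bounded by a circle. -/
def cutRegion (D : Set (Fin 2 → ℝ)) (S : OrientedCircle) : Set (Fin 2 → ℝ) :=
  D ∩ {x | S.radius ^ 2 < sqDist S.center x}

theorem sqDist_vec (c : Fin 2 → ℝ) (s y : ℝ) :
    sqDist c ![s, y] = (s - c 0) ^ 2 + (y - c 1) ^ 2 := rfl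

theorem segment_mem_ball {q : Fin 2 → ℝ} {r₀ : ℝ} (hr : 0 < r₀) {s y y' z : ℝ}
    (h : ![s, y] ∈ Metric.ball q r₀) (h' : ![s, y'] ∈ Metric.ball q r₀) (h1 : y ≤ z) (h2 : z ≤ y') :
    ![s, z] ∈ Metric.ball q r₀ := by
  rw [mem_ball_plane hr] at h h' ⊢
  obtain ⟨a1, a2⟩ := h
  obtain ⟨-, b2⟩ := h'
  refine ⟨a1, ?_⟩
  change |y - q 1| < r₀ at a2
  change |y' - q 1| < r₀ at b2
  change |z - q 1| < r₀
  rw [abs_lt] at a2 b2 ⊢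
  constructor <;> linarith [a2.1, b2.2]

namespace IsCut

variable {l₁ l₂ : ℕ} {D : Set (Fin 2 → ℝ)} {C : Fin l₁ → OrientedCircle} {μ : Fin l₁ → Fin l₂}
  {j : Fin l₁} {S : OrientedCircle} {q : Fin 2 → ℝ} {r₀ ρ₀ : ℝ}

theorem val_eq (hc : IsCut D C j S q r₀ ρ₀) (x : Fin 2 → ℝ) :
    S.val x = sqDist S.center x - S.radius ^ 2 := by
  rw [S.val_eq, OrientedCircle.sgn, hc.inside_eq, sqDist]
  simp
  ring

theorem sq_lt (hc : IsCut D C j S q r₀ ρ₀) : S.radius ^ 2 < ρ₀ ^ 2 := by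
  have h1 := S.radius_pos
  have h2 := hc.radius_lt
  nlinarith

theorem val_lt (hc : IsCut D C j S q r₀ ρ₀) {s y y' : ℝ} (hy : ![s, y] ∈ Metric.ball q r₀)
    (hy' : ![s, y'] ∈ Metric.ball q r₀) (hlt : y < y') :
    (C j).val ![s, y'] < (C j).val ![s, y] := by
  have h1 := (C j).val_sub_val s y' y
  have h2 := (hc.box _ (segment_mem_ball hc.r₀_pos hy hy' (z := (y' + y) / 2)
    (by linarith) (by linarith))).2.2.2
  nlinarith

/-- On the diameter the polynomial of the circle being cut is negative, and it decreases upwards in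
the box; so nothing of the closure can lie in the disc at or above the diameter. -/
theorem lt_center (hc : IsCut D C j S q r₀ ρ₀) {x : Fin 2 → ℝ} (hx : x ∈ closure D)
    (hN : sqDist S.center x ≤ ρ₀ ^ 2) : x 1 < S.center 1 := by
  by_contra! hle
  have hpos : 0 < ρ₀ := S.radius_pos.trans hc.radius_lt
  have h0 : (x 0 - S.center 0) ^ 2 ≤ ρ₀ ^ 2 := by
    unfold sqDist at hN; nlinarith [sq_nonneg (x 1 - S.center 1)]
  have hd := hc.diameter (x 0) (abs_le_of_sq_le_sq h0 hpos.le)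
  have hxv := ((hc.box x (hc.disc x hN)).1).1 hx
  rcases hle.eq_or_lt with he | hlt
  · rw [he, vec_eta] at hd
    linarith
  · have := hc.val_lt (s := x 0) (y := S.center 1) (y' := x 1)
      (hc.disc _ (by rw [sqDist_vec]; simpa using h0)) (by rw [vec_eta]; exact hc.disc x hN) hlt
    rw [vec_eta] at this
    linarith

/-- Going down in the box strictly increases the one polynomial that defines the region there. -/
theorem below_mem (hc : IsCut D C j S q r₀ ρ₀) {x : Fin 2 → ℝ} (hx : x ∈ closure D)
    (hxb : x ∈ Metric.ball q r₀) {y : ℝ} (hy : ![x 0, y] ∈ Metric.ball q r₀) (hlt : y < x 1) :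
    ![x 0, y] ∈ D := by
  have h1 := hc.val_lt hy (by rw [vec_eta]; exact hxb) hlt
  rw [vec_eta] at h1
  exact (hc.box _ hy).2.1.2 ((((hc.box x hxb).1).1 hx).trans_lt h1)

/-- Only points on the new circle need an argument: they lie below the diameter, so moving straight
down leaves the disc and enters the old region. -/
theorem closure_cutRegion (hc : IsCut D C j S q r₀ ρ₀) :
    closure (cutRegion D S) = closure D ∩ {x | S.radius ^ 2 ≤ sqDist S.center x} := by
  have hcont := continuous_sqDist S.center
  refine Set.Subset.antisymm (Set.subset_inter (closure_mono Set.inter_subset_left) ?_) ?_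
  · refine closure_minimal (fun x hx => ?_) (isClosed_le continuous_const hcont)
    have hN : S.radius ^ 2 < sqDist S.center x := hx.2
    exact hN.le
  rintro x ⟨hx, hN⟩
  have hN : S.radius ^ 2 ≤ sqDist S.center x := hN
  rcases hN.eq_or_lt with he | hlt
  swap
  · have := (isOpen_lt continuous_const hcont).inter_closure (t := D)
      (⟨hlt, hx⟩ : x ∈ {x | S.radius ^ 2 < sqDist S.center x} ∩ closure D)
    rwa [Set.inter_comm] at this
  have hxN : sqDist S.center x ≤ ρ₀ ^ 2 := by rw [← he]; exact hc.sq_lt.le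
  have hxb := hc.disc x hxN
  have hx1 := hc.lt_center hx hxN
  have hline : Continuous fun t : ℝ => (![x 0, x 1 - t] : Fin 2 → ℝ) :=
    continuous_vec continuous_const (by fun_prop)
  have hl0 : (![x 0, x 1 - 0] : Fin 2 → ℝ) = x := by rw [sub_zero, vec_eta]
  refine mem_closure_of_tendsto (b := nhdsWithin (0 : ℝ) (Set.Ioi 0))
    (f := fun t : ℝ => (![x 0, x 1 - t] : Fin 2 → ℝ)) ?_ ?_
  · have := hline.tendsto 0
    rw [hl0] at this
    exact this.mono_left nhdsWithin_le_nhds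
  have hev : ∀ᶠ t in nhds (0 : ℝ), (![x 0, x 1 - t] : Fin 2 → ℝ) ∈ Metric.ball q r₀ :=
    hline.continuousAt.eventually (by
      beta_reduce; rw [hl0]; exact Metric.isOpen_ball.mem_nhds hxb)
  filter_upwards [hev.filter_mono nhdsWithin_le_nhds, self_mem_nhdsWithin] with t ht ht0
  have ht0 : 0 < t := ht0
  refine ⟨hc.below_mem hx hxb ht (by linarith), ?_⟩
  change S.radius ^ 2 < sqDist S.center _
  rw [sqDist_vec, he, sqDist]
  nlinarith

theorem mem_closure_cutRegion (hc : IsCut D C j S q r₀ ρ₀) {x : Fin 2 → ℝ} :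
    x ∈ closure (cutRegion D S) ↔ x ∈ closure D ∧ S.radius ^ 2 ≤ sqDist S.center x := by
  rw [hc.closure_cutRegion]; rfl

/-- Points of the region in the disc can be moved down to a larger circle. -/
theorem lower_mem (hc : IsCut D C j S q r₀ ρ₀) {z : Fin 2 → ℝ} (hz : z ∈ closure D) {τ : ℝ}
    (hzτ : sqDist S.center z ≤ τ) (hτ : τ ≤ ρ₀ ^ 2) :
    sqDist S.center ![z 0, S.center 1 - √(τ - (z 0 - S.center 0) ^ 2)] = τ ∧
      S.center 1 - √(τ - (z 0 - S.center 0) ^ 2) ≤ z 1 ∧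
      ((sqDist S.center z = τ ∧ ![z 0, S.center 1 - √(τ - (z 0 - S.center 0) ^ 2)] = z) ∨
        ![z 0, S.center 1 - √(τ - (z 0 - S.center 0) ^ 2)] ∈ D) := by
  have h1 := hc.lt_center hz (hzτ.trans hτ)
  have hzτ' : (z 1 - S.center 1) ^ 2 ≤ τ - (z 0 - S.center 0) ^ 2 := by
    unfold sqDist at hzτ; linarith
  have hnn : 0 ≤ τ - (z 0 - S.center 0) ^ 2 := (sq_nonneg _).trans hzτ'
  have hd : sqDist S.center ![z 0, S.center 1 - √(τ - (z 0 - S.center 0) ^ 2)] = τ := by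
    rw [sqDist_vec, sub_sub_cancel_left, neg_sq, Real.sq_sqrt hnn]; ring
  have hle : S.center 1 - z 1 ≤ √(τ - (z 0 - S.center 0) ^ 2) :=
    Real.le_sqrt_of_sq_le (by nlinarith)
  refine ⟨hd, by linarith, ?_⟩
  rcases eq_or_lt_of_le (show S.center 1 - √(τ - (z 0 - S.center 0) ^ 2) ≤ z 1 by linarith)
    with he | hlt
  · left
    rw [he, vec_eta] at hd ⊢
    exact ⟨hd, rfl⟩
  · right
    exact hc.below_mem hz (hc.disc z (hzτ.trans hτ)) (hc.disc _ (hd.trans_le hτ)) hlt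

theorem lower_eq (hc : IsCut D C j S q r₀ ρ₀) {z : Fin 2 → ℝ} (hz : z ∈ closure D) {τ : ℝ}
    (hzτ : sqDist S.center z = τ) (hτ : τ ≤ ρ₀ ^ 2) :
    ![z 0, S.center 1 - √(τ - (z 0 - S.center 0) ^ 2)] = z := by
  have h1 := hc.lt_center hz (hzτ.trans_le hτ)
  have : τ - (z 0 - S.center 0) ^ 2 = (S.center 1 - z 1) ^ 2 := by
    rw [← hzτ, sqDist]; ring
  rw [this, Real.sqrt_sq (by linarith), sub_sub_cancel, vec_eta]

theorem exists_mem_lt (hc : IsCut D C j S q r₀ ρ₀) :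
    ∃ z ∈ D, sqDist S.center z < S.radius ^ 2 := by
  obtain ⟨z, hz, hzD⟩ := mem_closure_iff.1 hc.mem_closure
    {x | sqDist S.center x < S.radius ^ 2}
    (isOpen_lt (continuous_sqDist _) continuous_const) hc.sqDist_lt
  exact ⟨z, hzD, hz⟩

theorem cutRegion_ssubset (hc : IsCut D C j S q r₀ ρ₀) : cutRegion D S ⊂ D := by
  refine ⟨Set.inter_subset_left, fun hsub => ?_⟩
  obtain ⟨z, hzD, hz⟩ := hc.exists_mem_lt
  exact lt_asymm hz (hsub hzD).2

/-- Pushing the part of `D` in a slightly larger concentric disc straight down onto the lower arc of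
that disc maps `D` continuously into the new region. If the disc is small enough, two given points
are fixed, and both lie in the connected image of `D`. -/
theorem isConnected_cutRegion (hc : IsCut D C j S q r₀ ρ₀) (hD : IsConnected D) :
    IsConnected (cutRegion D S) := by
  have hcont := continuous_sqDist S.center
  constructor
  · obtain ⟨z, hzD, hz⟩ := hc.exists_mem_lt
    -- A point of the removed cap, lowered to the circle of radius `ρ₀`, lands in the new region.
    obtain ⟨h1, -, h2⟩ := hc.lower_mem (subset_closure hzD) (hz.le.trans hc.sq_lt.le) le_rfl
    refine ⟨_, ?_, show _ < _ from hc.sq_lt.trans_eq h1.symm⟩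
    rcases h2 with ⟨-, h2⟩ | h2
    · rwa [h2]
    · exact h2
  refine isPreconnected_of_forall_pair fun x hx y hy => ?_
  -- The radius `√τ` exceeds that of the removed disc, is at most `ρ₀`, and leaves `x` and `y`
  -- outside the open disc that is pushed down.
  set τ := min (min (sqDist S.center x) (sqDist S.center y)) (ρ₀ ^ 2) with hτ
  have hτ0 : τ ≤ ρ₀ ^ 2 := min_le_right _ _
  have hτ1 : S.radius ^ 2 < τ := lt_min (lt_min hx.2 hy.2) hc.sq_lt
  let Φ : (Fin 2 → ℝ) → (Fin 2 → ℝ) := fun z =>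
    if sqDist S.center z ≤ τ then ![z 0, S.center 1 - √(τ - (z 0 - S.center 0) ^ 2)] else z
  have hfix : ∀ z ∈ D, τ ≤ sqDist S.center z → Φ z = z := by
    intro z hz hle
    by_cases hz' : sqDist S.center z ≤ τ
    · rw [show Φ z = _ from if_pos hz']
      exact hc.lower_eq (subset_closure hz) (le_antisymm hz' hle) hτ0
    · exact if_neg hz'
  refine ⟨Φ '' D, ?_, ⟨x, hx.1, hfix x hx.1 ((min_le_left _ _).trans (min_le_left _ _))⟩,
    ⟨y, hy.1, hfix y hy.1 ((min_le_left _ _).trans (min_le_right _ _))⟩,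
    hD.isPreconnected.image _ ?_⟩
  · rintro _ ⟨z, hz, rfl⟩
    by_cases hz' : sqDist S.center z ≤ τ
    · rw [show Φ z = _ from if_pos hz']
      obtain ⟨h1, -, h2⟩ := hc.lower_mem (subset_closure hz) hz' hτ0
      refine ⟨?_, show _ < _ from hτ1.trans_eq h1.symm⟩
      rcases h2 with ⟨-, h2⟩ | h2
      · rwa [h2]
      · exact h2
    · rw [show Φ z = _ from if_neg hz']
      exact ⟨hz, hτ1.trans (not_le.1 hz')⟩
  · refine ContinuousOn.if ?_ ?_ continuousOn_id
    · rintro z ⟨hz, hzf⟩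
      exact hc.lower_eq (subset_closure hz) (frontier_le_subset_eq hcont continuous_const hzf) hτ0
    · refine (continuous_vec (continuous_apply 0) ?_).continuousOn
      fun_prop

/-- At a new corner the conditions form a linear system with nonzero determinant, by
`IsCut.transverse`, solved by Cramer's rule. At other points of the new circle a multiple of the
radius vector works, and off this circle nothing new is required. -/
theorem exists_fderiv_eq (hc : IsCut D C j S q r₀ ρ₀) (h : IsMomentData D C μ) {p : Fin 2 → ℝ}
    (hp : p ∈ closure (cutRegion D S)) (c : Fin (l₁ + 1) → ℝ) :
    ∃ v, ∀ i, ((Fin.snoc C S : Fin (l₁ + 1) → OrientedCircle) i).val p = 0 →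
      fderiv ℝ ((Fin.snoc C S : Fin (l₁ + 1) → OrientedCircle) i).val p v = c i := by
  obtain ⟨hpD, hpN⟩ := hc.mem_closure_cutRegion.1 hp
  simp only [Fin.forall_fin_succ', Fin.snoc_castSucc, Fin.snoc_last]
  rcases hpN.eq_or_lt with he | hlt
  swap
  · obtain ⟨v, hv⟩ := h.exists_fderiv_eq hpD fun i => c i.castSucc
    refine ⟨v, hv, fun h0 => ?_⟩
    rw [hc.val_eq] at h0
    linarith
  have hbox := hc.box p (hc.disc p (by rw [← he]; exact hc.sq_lt.le))
  have huniq : ∀ i, (C i).val p = 0 → i = j := fun i hi => by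
    by_contra hij
    exact (hbox.2.2.1 i hij).ne' hi
  have hsgn : S.sgn = -1 := by rw [OrientedCircle.sgn, hc.inside_eq]; simp
  set b0 := p 0 - S.center 0 with hb0
  set b1 := p 1 - S.center 1 with hb1
  by_cases hj : (C j).val p = 0
  · have hd := hc.transverse p hj he.symm
    set a0 := p 0 - (C j).center 0 with ha0
    set a1 := p 1 - (C j).center 1 with ha1
    rw [← hb0, ← hb1] at hd
    have hdiv : ∀ a b u w d : ℝ, a * (u / d) + b * (w / d) = (a * u + b * w) / d := by
      intros; ring
    set A := -(C j).sgn * c j.castSucc / 2 with hA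
    set B := c (Fin.last l₁) / 2 with hB
    refine ⟨![(A * b1 - a1 * B) / (a0 * b1 - a1 * b0), (a0 * B - A * b0) / (a0 * b1 - a1 * b0)],
      fun i hi => ?_, fun _ => ?_⟩
    · rw [huniq i hi, (C j).fderiv_val, ← ha0, ← ha1]
      simp only [Matrix.cons_val_zero, Matrix.cons_val_one, Matrix.cons_val_fin_one]
      have : a0 * ((A * b1 - a1 * B) / (a0 * b1 - a1 * b0)) +
          a1 * ((a0 * B - A * b0) / (a0 * b1 - a1 * b0)) = A := by
        rw [hdiv, div_eq_iff hd]; ring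
      rw [this, hA]
      linear_combination c j.castSucc * (C j).sgn_mul_sgn
    · rw [S.fderiv_val, ← hb0, ← hb1, hsgn]
      simp only [Matrix.cons_val_zero, Matrix.cons_val_one, Matrix.cons_val_fin_one]
      have : b0 * ((A * b1 - a1 * B) / (a0 * b1 - a1 * b0)) +
          b1 * ((a0 * B - A * b0) / (a0 * b1 - a1 * b0)) = B := by
        rw [hdiv, div_eq_iff hd]; ring
      rw [this, hB]
      ring
  · have hN : b0 ^ 2 + b1 ^ 2 = S.radius ^ 2 := he.symm
    have hr := S.radius_pos
    refine ⟨![c (Fin.last l₁) / 2 * b0 / S.radius ^ 2, c (Fin.last l₁) / 2 * b1 / S.radius ^ 2],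
      fun i hi => absurd (huniq i hi ▸ hi) hj, fun _ => ?_⟩
    rw [S.fderiv_val, ← hb0, ← hb1, hsgn]
    simp only [Matrix.cons_val_zero, Matrix.cons_val_one, Matrix.cons_val_fin_one]
    field_simp
    linear_combination c (Fin.last l₁) * hN

/-- The new circle carries an index of its own, so injectivity is inherited; transversality is the
solvability of all systems of values for the differentials. -/
theorem isMomentData (hc : IsCut D C j S q r₀ ρ₀) (h : IsMomentData D C μ) :
    IsMomentData (cutRegion D S) (Fin.snoc C S : Fin (l₁ + 1) → OrientedCircle)
      (Fin.snoc (fun i => (μ i).castSucc) (Fin.last l₂) : Fin (l₁ + 1) → Fin (l₂ + 1)) where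
  isOpen := h.isOpen.inter (isOpen_lt continuous_const (continuous_sqDist _))
  isConnected := hc.isConnected_cutRegion h.isConnected
  isCompact_closure := h.isCompact_closure.of_isClosed_subset isClosed_closure
    (closure_mono Set.inter_subset_left)
  eq_pos := by
    obtain ⟨U₀, hU₀, hDU₀, hU⟩ := h.eq_pos
    have hD := hU U₀ hU₀ hDU₀ subset_rfl
    refine ⟨U₀, hU₀, (closure_mono Set.inter_subset_left).trans hDU₀, fun U _ hDU hUU => ?_⟩
    ext x
    simp only [Set.mem_inter_iff, Set.mem_iInter, Fin.forall_fin_succ', Fin.snoc_castSucc,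
      Fin.snoc_last, Set.mem_ofPred_eq, hc.val_eq, sub_pos]
    constructor
    · intro hx
      refine ⟨hDU (subset_closure hx), ?_, hx.2⟩
      have hxD := hx.1
      rw [hD] at hxD
      exact Set.mem_iInter.1 hxD.2
    · rintro ⟨hxU, hpos, hN⟩
      refine ⟨?_, hN⟩
      rw [hD]
      exact ⟨hUU hxU, Set.mem_iInter.2 hpos⟩
  transverse := by
    rintro J - p ⟨hpJ, hp⟩
    have := (finrank_iInf_ker_add_card_iff J fun i =>
      (fderiv ℝ ((Fin.snoc C S : Fin (l₁ + 1) → OrientedCircle) i).val p).toLinearMap).2 (by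
        intro c
        obtain ⟨v, hv⟩ := hc.exists_fderiv_eq h hp c
        exact ⟨v, fun i hi => hv i (Set.mem_iInter₂.1 hpJ i hi)⟩)
    rw [Module.finrank_fin_fun] at this
    exact this
  surjective := by
    intro i
    refine Fin.lastCases ⟨Fin.last l₁, by simp⟩ (fun i => ?_) i
    obtain ⟨i', rfl⟩ := h.surjective i
    exact ⟨i'.castSucc, by simp⟩
  injOn := by
    rintro J - ⟨p, hpJ, hp⟩ a ha b hb hab
    have hpa := Set.mem_iInter₂.1 hpJ a ha
    have hpb := Set.mem_iInter₂.1 hpJ b hb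
    have hpD := (hc.mem_closure_cutRegion.1 hp).1
    clear ha hb
    induction a using Fin.lastCases with
    | last =>
      induction b using Fin.lastCases with
      | last => rfl
      | cast b => simp [Fin.ext_iff] at hab; omega
    | cast a =>
      induction b using Fin.lastCases with
      | last => simp [Fin.ext_iff] at hab; omega
      | cast b =>
        simp only [Fin.snoc_castSucc, Fin.castSucc_inj] at hab hpa hpb ⊢
        exact h.index_injective hpD hpa hpb hab

end IsCut

/-! ### Critical points and Reeb space after the cut -/

namespace IsCut

variable {l₁ l₂ : ℕ} {D : Set (Fin 2 → ℝ)} {C : Fin l₁ → OrientedCircle} {μ : Fin l₁ → Fin l₂}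
  {j : Fin l₁} {S : OrientedCircle} {q : Fin 2 → ℝ} {r₀ ρ₀ : ℝ}

theorem eq_of_val_eq_zero (hc : IsCut D C j S q r₀ ρ₀) {x : Fin 2 → ℝ}
    (hx : x ∈ Metric.ball q r₀) {i : Fin l₁} (hi : (C i).val x = 0) : i = j := by
  by_contra hij
  exact ((hc.box x hx).2.2.1 i hij).ne' hi

/-- In the box only one circle can pass through a point, and its tangent is nowhere vertical there.
-/
theorem notMem_criticalPoints (hc : IsCut D C j S q r₀ ρ₀) {x : Fin 2 → ℝ}
    (hx : x ∈ Metric.ball q r₀) : x ∉ criticalPoints D C := by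
  intro hcr
  have h1 := IsMomentData.eq_center_of_mem_criticalPoints hcr fun i => hc.eq_of_val_eq_zero hx
  exact (hc.box x hx).2.2.2.ne (((C j).dy_eq_zero_iff x).2 h1)

theorem mem_ball_of_le (hc : IsCut D C j S q r₀ ρ₀) {x : Fin 2 → ℝ}
    (hx : sqDist S.center x ≤ S.radius ^ 2) : x ∈ Metric.ball q r₀ :=
  hc.disc x (hx.trans hc.sq_lt.le)

theorem mem_closure_of_corner (hc : IsCut D C j S q r₀ ρ₀) {x : Fin 2 → ℝ}
    (hj : (C j).val x = 0) (hN : sqDist S.center x = S.radius ^ 2) :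
    x ∈ closure (cutRegion D S) :=
  hc.mem_closure_cutRegion.2 ⟨(hc.box x (hc.mem_ball_of_le hN.le)).1.2 hj.ge, hN.ge⟩

/-- The critical points of the region without the disc. -/
theorem mem_criticalPoints_iff (hc : IsCut D C j S q r₀ ρ₀) (h : IsMomentData D C μ)
    {x : Fin 2 → ℝ} :
    x ∈ criticalPoints (cutRegion D S) (Fin.snoc C S : Fin (l₁ + 1) → OrientedCircle) ↔
      x ∈ criticalPoints D C ∨ ((C j).val x = 0 ∧ sqDist S.center x = S.radius ^ 2) := by
  constructor
  · intro hx
    obtain ⟨hxD, hN⟩ := hc.mem_closure_cutRegion.1 hx.1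
    rcases hN.eq_or_lt with he | hlt
    · refine Or.inr ⟨?_, he.symm⟩
      -- A critical point on the new circle alone would have the height of the centre, but the
      -- closure meets the disc only below it.
      by_contra hj
      have h1 := IsMomentData.eq_center_of_mem_criticalPoints hx (j := Fin.last l₁) (by
        intro i
        induction i using Fin.lastCases with
        | last => simp
        | cast i =>
          intro hi
          rw [Fin.snoc_castSucc] at hi
          have := hc.eq_of_val_eq_zero (hc.mem_ball_of_le he.ge) hi
          exact absurd (this ▸ hi) hj)
      rw [Fin.snoc_last] at h1
      exact (hc.lt_center hxD (he.ge.trans hc.sq_lt.le)).ne h1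
    · refine Or.inl ⟨hxD, fun v hv => hx.2 v ?_⟩
      simp only [Fin.forall_fin_succ', Fin.snoc_castSucc, Fin.snoc_last]
      refine ⟨hv, fun h0 => ?_⟩
      rw [hc.val_eq] at h0
      linarith
  · rintro (hx | ⟨hj, hN⟩)
    · have hN : S.radius ^ 2 ≤ sqDist S.center x := by
        by_contra! hlt
        exact hc.notMem_criticalPoints (hc.mem_ball_of_le hlt.le) hx
      refine ⟨hc.mem_closure_cutRegion.2 ⟨hx.1, hN⟩, fun v hv => hx.2 v fun i hi => ?_⟩
      have := hv i.castSucc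
      rw [Fin.snoc_castSucc] at this
      exact this hi
    · refine (hc.isMomentData h).mem_criticalPoints_of_ne (hc.mem_closure_of_corner hj hN)
        (j := j.castSucc) (j' := Fin.last l₁) (Fin.castSucc_lt_last j).ne ?_ ?_
      · rwa [Fin.snoc_castSucc]
      · rw [Fin.snoc_last, hc.val_eq, hN, sub_self]

/-- The new corners are not at the height of the centre of a circle through them. -/
theorem ne_center (hc : IsCut D C j S q r₀ ρ₀)
    (hcorner : ∀ x ∈ closure D, ∀ i i', i ≠ i' → (C i).val x = 0 → (C i').val x = 0 →
      x 1 ≠ (C i).center 1) :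
    ∀ x ∈ closure (cutRegion D S), ∀ i i', i ≠ i' →
      ((Fin.snoc C S : Fin (l₁ + 1) → OrientedCircle) i).val x = 0 →
      ((Fin.snoc C S : Fin (l₁ + 1) → OrientedCircle) i').val x = 0 →
      x 1 ≠ ((Fin.snoc C S : Fin (l₁ + 1) → OrientedCircle) i).center 1 := by
  intro x hx i i' hne hi hi'
  have hxD := (hc.mem_closure_cutRegion.1 hx).1
  have hS : S.val x = 0 → sqDist S.center x ≤ S.radius ^ 2 := fun h0 => by
    rw [hc.val_eq] at h0; linarith
  induction i using Fin.lastCases with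
  | last =>
    rw [Fin.snoc_last] at hi ⊢
    exact (hc.lt_center hxD ((hS hi).trans hc.sq_lt.le)).ne
  | cast i =>
    rw [Fin.snoc_castSucc] at hi ⊢
    induction i' using Fin.lastCases with
    | last =>
      rw [Fin.snoc_last] at hi'
      have hb := hc.mem_ball_of_le (hS hi')
      rw [hc.eq_of_val_eq_zero hb hi]
      intro h1
      exact (hc.box x hb).2.2.2.ne (((C j).dy_eq_zero_iff x).2 h1)
    | cast i' =>
      rw [Fin.snoc_castSucc] at hi'
      exact hcorner x hxD i i' (fun he => hne (by rw [he])) hi hi'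

/-- Below the centre, going up brings a point nearer to it; an upper end outside the disc therefore
protects everything beneath it. -/
theorem segment_subset (hc : IsCut D C j S q r₀ ρ₀) {t y y' : ℝ}
    (hy' : ![t, y'] ∈ closure (cutRegion D S)) (hseg : ∀ s ∈ Set.Icc y y', ![t, s] ∈ closure D) :
    ∀ s ∈ Set.Icc y y', ![t, s] ∈ closure (cutRegion D S) := by
  intro s hs
  refine hc.mem_closure_cutRegion.2 ⟨hseg s hs, ?_⟩
  by_contra! hlt
  have hlt' := hlt.trans hc.sq_lt
  have h1 : s < S.center 1 := hc.lt_center (hseg s hs) hlt'.le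
  have h2 : y' < S.center 1 := by
    -- Otherwise the segment would cross the horizontal diameter, which avoids the closure.
    by_contra! hle
    have := hc.lt_center (hseg (S.center 1) ⟨hs.1.trans h1.le, hle⟩) (by
      rw [sqDist_vec] at hlt' ⊢
      nlinarith [sq_nonneg (s - S.center 1)])
    exact lt_irrefl _ this
  have h3 := (hc.mem_closure_cutRegion.1 hy').2
  rw [sqDist_vec] at hlt h3
  nlinarith [hs.2]

/-- The map of Reeb spaces induced by the inclusion of the region without the disc. -/
def reebMap (D : Set (Fin 2 → ℝ)) (S : OrientedCircle) :
    ReebSpace (closure (cutRegion D S)) (fun x => x 0) → ReebSpace (closure D) (fun x => x 0) :=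
  Quotient.map (Set.inclusion (closure_mono Set.inter_subset_left)) fun x y hxy => by
    obtain ⟨h1, h2⟩ := (reebSetoid_plane_iff x y).1 hxy
    exact (reebSetoid_plane_iff _ _).2
      ⟨h1, fun s hs => closure_mono Set.inter_subset_left (h2 s hs)⟩

theorem continuous_reebMap : Continuous (reebMap D S) :=
  (continuous_inclusion _).quotient_map' _

/-- A vertical segment joining two remaining points in the old closure survives the cut, because its
upper end does. -/
theorem injective_reebMap (hc : IsCut D C j S q r₀ ρ₀) : Function.Injective (reebMap D S) := by
  intro w w' hww
  induction w using Quotient.ind with | _ x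
  induction w' using Quotient.ind with | _ y
  obtain ⟨h0, hseg⟩ := (reebSetoid_plane_iff _ _).1 (Quotient.exact hww)
  have h0 : (y : Fin 2 → ℝ) 0 = (x : Fin 2 → ℝ) 0 := h0
  have hseg : ∀ s ∈ Set.uIcc ((x : Fin 2 → ℝ) 1) ((y : Fin 2 → ℝ) 1),
    ![(x : Fin 2 → ℝ) 0, s] ∈ closure D := hseg
  refine Quotient.sound ((reebSetoid_plane_iff _ _).2 ⟨h0, ?_⟩)
  rcases le_total ((x : Fin 2 → ℝ) 1) ((y : Fin 2 → ℝ) 1) with hle | hle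
  · rw [Set.uIcc_of_le hle] at hseg ⊢
    refine hc.segment_subset ?_ hseg
    rw [← h0, vec_eta]; exact y.2
  · rw [Set.uIcc_of_ge hle] at hseg ⊢
    refine hc.segment_subset ?_ hseg
    rw [vec_eta]; exact x.2

/-- A point strictly inside the removed disc is joined within the old closure to the point of the
new circle vertically below it, which represents the same class. -/
theorem surjective_reebMap (hc : IsCut D C j S q r₀ ρ₀) : Function.Surjective (reebMap D S) := by
  intro w
  induction w using Quotient.ind with | _ x
  by_cases hN : S.radius ^ 2 ≤ sqDist S.center x
  · exact ⟨Quotient.mk _ ⟨x, hc.mem_closure_cutRegion.2 ⟨x.2, hN⟩⟩, rfl⟩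
  push Not at hN
  obtain ⟨h1, h2, h3⟩ := hc.lower_mem x.2 hN.le hc.sq_lt.le
  set y := S.center 1 - √(S.radius ^ 2 - ((x : Fin 2 → ℝ) 0 - S.center 0) ^ 2) with hy
  have h3 : ![(x : Fin 2 → ℝ) 0, y] ∈ D := h3.resolve_left fun h => hN.ne h.1
  have hb := hc.mem_ball_of_le h1.le
  have hxb := hc.mem_ball_of_le hN.le
  refine ⟨Quotient.mk _ ⟨![(x : Fin 2 → ℝ) 0, y],
    hc.mem_closure_cutRegion.2 ⟨subset_closure h3, h1.ge⟩⟩,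
    Quotient.sound ((reebSetoid_plane_iff _ _).2 ⟨rfl, ?_⟩)⟩
  intro s hs
  have hs : s ∈ Set.uIcc y ((x : Fin 2 → ℝ) 1) := hs
  change ![(x : Fin 2 → ℝ) 0, s] ∈ closure D
  rw [Set.uIcc_of_le h2] at hs
  rcases hs.2.eq_or_lt with he | hlt
  · rw [he, vec_eta]; exact x.2
  · exact subset_closure (hc.below_mem x.2 hxb (segment_mem_ball hc.r₀_pos hb
      (by rw [vec_eta]; exact hxb) hs.1 hs.2) hlt)

/-- Cutting out the disc does not change the Reeb space. -/
noncomputable def reebHomeomorph (hc : IsCut D C j S q r₀ ρ₀) (h : IsMomentData D C μ) :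
    ReebSpace (closure (cutRegion D S)) (fun x => x 0) ≃ₜ ReebSpace (closure D) (fun x => x 0) :=
  have := (hc.isMomentData h).compactSpace_closure
  have := t2Space_reebSpace (isClosed_closure (s := D))
  Continuous.homeoOfEquivCompactToT2
    (f := Equiv.ofBijective (reebMap D S) ⟨hc.injective_reebMap, hc.surjective_reebMap⟩)
    continuous_reebMap

theorem reebHomeomorph_mk (hc : IsCut D C j S q r₀ ρ₀) (h : IsMomentData D C μ)
    (x : closure (cutRegion D S)) : hc.reebHomeomorph h (Quotient.mk _ x) =
      Quotient.mk _ (Set.inclusion (closure_mono Set.inter_subset_left) x) := rfl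

theorem image_planeVertices (hc : IsCut D C j S q r₀ ρ₀) (h : IsMomentData D C μ)
    {P Q : closure D} (hPQ : ∀ x : Fin 2 → ℝ,
      ((C j).val x = 0 ∧ sqDist S.center x = S.radius ^ 2) ↔ (x = P ∨ x = Q)) :
    hc.reebHomeomorph h '' planeVertices (cutRegion D S)
        (Fin.snoc C S : Fin (l₁ + 1) → OrientedCircle) =
      planeVertices D C ∪ {Quotient.mk _ P, Quotient.mk _ Q} := by
  ext w
  constructor
  · rintro ⟨_, ⟨x, hx, rfl⟩, rfl⟩
    rw [hc.mem_criticalPoints_iff h, hPQ] at hx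
    rw [reebHomeomorph_mk]
    rcases hx with hx | hx | hx
    · exact Or.inl ⟨_, hx, rfl⟩
    · exact Or.inr (Or.inl (congrArg _ (Subtype.ext hx)))
    · exact Or.inr (Or.inr (congrArg _ (Subtype.ext hx)))
  · have key : ∀ x : closure D, ((x : Fin 2 → ℝ) ∈ criticalPoints D C ∨
        ((C j).val x = 0 ∧ sqDist S.center x = S.radius ^ 2)) →
        Quotient.mk _ x ∈ hc.reebHomeomorph h '' planeVertices (cutRegion D S)
          (Fin.snoc C S : Fin (l₁ + 1) → OrientedCircle) := by
      intro x hx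
      have hx' := (hc.mem_criticalPoints_iff h).2 hx
      exact ⟨_, ⟨⟨x, hx'.1⟩, hx', rfl⟩, hc.reebHomeomorph_mk h _⟩
    rintro (⟨x, hx, rfl⟩ | rfl | rfl)
    · exact key x (Or.inl hx)
    · exact key P (Or.inr ((hPQ P).2 (Or.inl rfl)))
    · exact key Q (Or.inr ((hPQ Q).2 (Or.inr rfl)))

/-- Equal classes would put both points on one vertical line, where the polynomial of the circle is
strictly monotone inside the box and so vanishes at most once. -/
theorem mk_ne_mk (hc : IsCut D C j S q r₀ ρ₀) {P Q : closure D} (hP : (P : Fin 2 → ℝ) ∈ Metric.ball q r₀)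
    (hQ : (Q : Fin 2 → ℝ) ∈ Metric.ball q r₀) (hPv : (C j).val P = 0) (hQv : (C j).val Q = 0)
    (hne : P ≠ Q) :
    Quotient.mk (reebSetoid (closure D) (fun x => x 0)) P ≠ Quotient.mk _ Q := by
  intro he
  obtain ⟨h0, -⟩ := (reebSetoid_plane_iff _ _).1 (Quotient.exact he)
  have hP' := vec_eta P
  have hQ' := vec_eta Q
  rw [h0] at hQ'
  rw [← hP'] at hP hPv
  rw [← hQ'] at hQ hQv
  rcases lt_trichotomy ((P : Fin 2 → ℝ) 1) ((Q : Fin 2 → ℝ) 1) with hlt | heq | hlt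
  · have := hc.val_lt hP hQ hlt
    linarith
  · exact hne (Subtype.ext (by rw [← hP', ← hQ', heq]))
  · have := hc.val_lt hQ hP hlt
    linarith

end IsCut

/-! ### Existence of a cut over a given edge -/

namespace IsMomentData

variable {l₁ l₂ : ℕ} {C : Fin l₁ → OrientedCircle} {μ : Fin l₁ → Fin l₂} {D : Set (Fin 2 → ℝ)}

/-- Over each edge of the Reeb graph there is a disc that can be cut out. -/
theorem exists_isCut (h : IsMomentData D C μ) (x : closure D)
    (hx : Quotient.mk _ x ∉ planeVertices D C) :
    ∃ (j : Fin l₁) (S : OrientedCircle) (q : Fin 2 → ℝ) (r₀ ρ₀ : ℝ) (P Q : closure D),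
      IsCut D C j S q r₀ ρ₀ ∧ P ≠ Q ∧
      (∀ y : Fin 2 → ℝ, ((C j).val y = 0 ∧ sqDist S.center y = S.radius ^ 2) ↔
        (y = P ∨ y = Q)) ∧
      Quotient.mk _ P ∈ connectedComponentIn (planeVertices D C)ᶜ (Quotient.mk _ x) ∧
      Quotient.mk _ Q ∈ connectedComponentIn (planeVertices D C)ᶜ (Quotient.mk _ x) := by
  obtain ⟨a, b, hab, hxab, hseg, -, ⟨j, hj, hju, hjdy⟩, -⟩ := h.exists_slice x hx
  -- The disc is placed at the upper end `q` of the slice, where the vertical derivative is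
  -- negative; `q` represents the same class as `x`.
  have hq := (hseg b ⟨hab.le, le_rfl⟩).1
  set q : Fin 2 → ℝ := ![(x : Fin 2 → ℝ) 0, b] with hqdef
  have hqx : Quotient.mk (reebSetoid (closure D) (fun x => x 0)) ⟨q, hq⟩ = Quotient.mk _ x := by
    refine Quotient.sound ((reebSetoid_plane_iff _ _).2 ⟨rfl, fun s hs => (hseg s ?_).1⟩)
    have hs' : s ∈ Set.uIcc b ((x : Fin 2 → ℝ) 1) := hs
    rw [Set.uIcc_of_ge hxab.2] at hs'
    exact ⟨hxab.1.trans hs'.1, hs'.2⟩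
  have := t2Space_reebSpace (isClosed_closure (s := D))
  obtain ⟨δ, hδ, σ, hσ, -, hσw, hop, hσV⟩ := h.hasLocalArcs.shrink continuous_reebCoord hx
    h.finite_planeVertices.isClosed.isOpen_compl hx
  set I := Set.Ioo (reebCoord (closure D) (Quotient.mk _ x) - δ)
    (reebCoord (closure D) (Quotient.mk _ x) + δ) with hI
  have hxI : Quotient.mk _ x ∈ σ '' I := ⟨_, ⟨by linarith, by linarith⟩, hσw⟩
  have hN : σ '' I ⊆ connectedComponentIn (planeVertices D C)ᶜ (Quotient.mk _ x) := by
    refine (isPreconnected_Ioo.image σ hσ).subset_connectedComponentIn hxI ?_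
    rintro _ ⟨s, hs, rfl⟩
    exact hσV s hs
  obtain ⟨r₁, hr₁, hbox⟩ := h.exists_box hq hju hjdy.ne
  have hpre := hop.preimage (continuous_quotient_mk' (s := reebSetoid (closure D) (fun x => x 0)))
  -- Within distance `r₂` of `q` the classes stay on a connected arc inside the edge, which places
  -- the classes of both corners there.
  obtain ⟨r₂, hr₂, hball⟩ := Metric.isOpen_iff.1 hpre ⟨q, hq⟩ (by
    rw [← hqx] at hxI; exact hxI)
  obtain ⟨c, ρ, ρ₀, hρ, hρρ, hdisc, hdiam, hcq, ⟨P, Q, hPQ, hPQ'⟩, htr⟩ :=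
    (C j).exists_cutting_disc hj hjdy (lt_min hr₁ hr₂)
  have hbox' : ∀ y ∈ Metric.ball q (min r₁ r₂), (y ∈ closure D ↔ 0 ≤ (C j).val y) ∧
      (y ∈ D ↔ 0 < (C j).val y) ∧ (∀ i, i ≠ j → 0 < (C i).val y) ∧ (C j).dy y < 0 := by
    intro y hy
    obtain ⟨h1, h2, h3, h4⟩ := hbox y (Metric.ball_subset_ball (min_le_left _ _) hy)
    exact ⟨h1, h2, h3, neg_of_mul_pos_right h4 hjdy.le⟩
  have hin : ∀ y, (C j).val y = 0 → sqDist c y = ρ ^ 2 →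
      ∃ hy : y ∈ closure D, Quotient.mk _ ⟨y, hy⟩ ∈
        connectedComponentIn (planeVertices D C)ᶜ (Quotient.mk _ x) := by
    intro y hy hyρ
    have hyb := hdisc y (by rw [hyρ]; nlinarith)
    have hyD := (hbox' y hyb).1.2 hy.ge
    exact ⟨hyD, hN (hball (show (⟨y, hyD⟩ : closure D) ∈ Metric.ball _ _ from
      Metric.ball_subset_ball (min_le_right _ _) hyb))⟩
  obtain ⟨hP, hP'⟩ := hin P ((hPQ' P).2 (Or.inl rfl)).1 ((hPQ' P).2 (Or.inl rfl)).2
  obtain ⟨hQ, hQ'⟩ := hin Q ((hPQ' Q).2 (Or.inr rfl)).1 ((hPQ' Q).2 (Or.inr rfl)).2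
  exact ⟨j, ⟨c, ρ, hρ, false⟩, q, min r₁ r₂, ρ₀, ⟨P, hP⟩, ⟨Q, hQ⟩,
    ⟨rfl, hbox', lt_min hr₁ hr₂, hρρ, hdisc, hdiam, hq, hcq, htr⟩,
    fun he => hPQ (congrArg Subtype.val he), hPQ', hP', hQ'⟩

end IsMomentData

namespace OrientedCircle

theorem mem_verticalPoles (S : OrientedCircle) {x : Fin 2 → ℝ} (hx : S.val x = 0)
    (h1 : x 1 = S.center 1) : x ∈ S.verticalPoles := by
  rw [S.val_eq, h1] at hx
  have h2 := (mul_eq_zero.1 hx).resolve_left S.sgn_ne_zero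
  have h3 : (x 0 - (S.center 0 - S.radius)) * (x 0 - (S.center 0 + S.radius)) = 0 := by
    linear_combination -h2
  rw [← vec_eta x, h1]
  rcases mul_eq_zero.1 h3 with h | h
  · left; rw [sub_eq_zero.1 h]
  · right; rw [sub_eq_zero.1 h]; rfl

end OrientedCircle

/-! ### The old circles and the zero set after the cut -/

namespace IsCut

variable {l₁ l₂ : ℕ} {D : Set (Fin 2 → ℝ)} {C : Fin l₁ → OrientedCircle} {μ : Fin l₁ → Fin l₂}
  {j : Fin l₁} {S : OrientedCircle} {q : Fin 2 → ℝ} {r₀ ρ₀ : ℝ}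

theorem eq_of_carrier_inter_nonempty (hc : IsCut D C j S q r₀ ρ₀) {i : Fin l₁}
    (hi : (S.carrier ∩ (C i).carrier).Nonempty) : i = j := by
  obtain ⟨x, hx, hxi⟩ := hi
  have hx : S.val x = 0 := hx
  rw [hc.val_eq] at hx
  exact hc.eq_of_val_eq_zero (hc.mem_ball_of_le (by linarith)) hxi

theorem carrier_inter_eq (hc : IsCut D C j S q r₀ ρ₀) {P Q : Fin 2 → ℝ}
    (hPQ : ∀ x : Fin 2 → ℝ,
      ((C j).val x = 0 ∧ sqDist S.center x = S.radius ^ 2) ↔ (x = P ∨ x = Q)) :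
    S.carrier ∩ (C j).carrier = {P, Q} := by
  ext x
  rw [Set.mem_insert_iff, Set.mem_singleton_iff, ← hPQ, and_comm (a := (C j).val x = 0),
    ← sub_eq_zero, ← hc.val_eq]
  rfl

/-- The boundary of the region without the disc meets the old circles. -/
theorem boundary_inter_nonempty (hc : IsCut D C j S q r₀ ρ₀) {P : Fin 2 → ℝ}
    (hP : (C j).val P = 0 ∧ sqDist S.center P = S.radius ^ 2)
    (hmeet : ∀ i, ((closure D \ D) ∩ (C i).carrier).Nonempty) (i : Fin l₁) :
    ((closure (cutRegion D S) \ cutRegion D S) ∩ (C i).carrier).Nonempty := by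
  -- The circle that is cut keeps a corner on the new boundary; every other circle misses the disc,
  -- so its boundary points are untouched.
  by_cases hij : i = j
  · subst hij
    exact ⟨P, ⟨hc.mem_closure_of_corner hP.1 hP.2, fun h => (show _ < _ from h.2).ne' hP.2⟩, hP.1⟩
  · obtain ⟨x, ⟨hx, hxD⟩, hxi⟩ := hmeet i
    refine ⟨x, ⟨hc.mem_closure_cutRegion.2 ⟨hx, ?_⟩, fun h => hxD h.1⟩, hxi⟩
    by_contra! hlt
    exact hij (hc.eq_of_val_eq_zero (hc.mem_ball_of_le hlt.le) hxi)

theorem planeProd_castSucc (i : Fin l₂) (x : Fin 2 → ℝ) :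
    planeProd (Fin.snoc C S : Fin (l₁ + 1) → OrientedCircle)
      (Fin.snoc (fun i => (μ i).castSucc) (Fin.last l₂) : Fin (l₁ + 1) → Fin (l₂ + 1))
      i.castSucc x = planeProd C μ i x := by
  unfold planeProd
  rw [Finset.prod_filter, Finset.prod_filter, Fin.prod_univ_castSucc]
  simp [(Fin.castSucc_lt_last i).ne']

theorem planeProd_last (x : Fin 2 → ℝ) :
    planeProd (Fin.snoc C S : Fin (l₁ + 1) → OrientedCircle)
      (Fin.snoc (fun i => (μ i).castSucc) (Fin.last l₂) : Fin (l₁ + 1) → Fin (l₂ + 1))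
      (Fin.last l₂) x = S.val x := by
  unfold planeProd
  rw [Finset.prod_filter, Fin.prod_univ_castSucc]
  simp [Fin.castSucc_ne_last]

/-- If the old manifold is the whole zero set, so is the new one. -/
theorem momentManifold_eq_momentZeroSet (hc : IsCut D C j S q r₀ ρ₀) {k : Fin l₂ → ℕ}
    (hZ : momentManifold C μ k D = momentZeroSet C μ k) (k' : Fin (l₂ + 1) → ℕ) :
    momentManifold (Fin.snoc C S : Fin (l₁ + 1) → OrientedCircle)
        (Fin.snoc (fun i => (μ i).castSucc) (Fin.last l₂) : Fin (l₁ + 1) → Fin (l₂ + 1)) k'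
        (cutRegion D S) =
      momentZeroSet (Fin.snoc C S : Fin (l₁ + 1) → OrientedCircle)
        (Fin.snoc (fun i => (μ i).castSucc) (Fin.last l₂) : Fin (l₁ + 1) → Fin (l₂ + 1)) k' := by
  refine Set.Subset.antisymm (fun p hp => hp.2) fun p hp => ⟨?_, hp⟩
  have h1 := planeProd_nonneg_of_mem _ _ k' hp
  refine hc.mem_closure_cutRegion.2 ⟨?_, ?_⟩
  · have h2 := momentSection_mem C μ k (x := momentProj k' p) fun i => by
      rw [← planeProd_castSucc (S := S)]
      exact h1 i.castSucc
    rw [← hZ] at h2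
    exact h2.1
  · have h2 := h1 (Fin.last l₂)
    rw [planeProd_last, hc.val_eq] at h2
    linarith

end IsCut

/-! ### The main theorem -/

theorem theorem5 {l₁ l₂ : ℕ} (hl₂ : 1 ≤ l₂)
    (C : Fin l₁ → OrientedCircle) (D₁ : Set (Fin 2 → ℝ)) (μ : Fin l₁ → Fin l₂) (k : Fin l₂ → ℕ)
    (hdata : IsMomentData D₁ C μ)
    (hbdry : closure D₁ \ D₁ ⊆ ⋃ j, (C j).carrier)
    (hmeet : ∀ j, ((closure D₁ \ D₁) ∩ (C j).carrier).Nonempty)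
    (hpoles : ∀ j j', j ≠ j' →
      Disjoint ((C j).verticalPoles ∪ (C j).horizontalPoles) (C j').carrier)
    (hk : ∀ i, 0 < k i) :
    -- the Reeb graph of the given function
    IsGraphWith (reebVertices (momentManifold C μ k D₁) (momentFun k)) ∧
    ∀ e ∈ graphEdges (reebVertices (momentManifold C μ k D₁) (momentFun k)),
    ∀ k' : Fin (l₂ + 1) → ℕ, (∀ i, 0 < k' i) → (∀ i : Fin l₂, k' i.castSucc = k i) →
    ∃ (C' : Fin (l₁ + 1) → OrientedCircle) (D' : Set (Fin 2 → ℝ))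
      (μ' : Fin (l₁ + 1) → Fin (l₂ + 1)),
      -- the new data
      IsMomentData D' C' μ' ∧
      D' ⊂ D₁ ∧
      (∀ j : Fin l₁, ((closure D' \ D') ∩ (C' j.castSucc).carrier).Nonempty) ∧
      (∀ j : Fin l₁, C' j.castSucc = C j) ∧
      (∀ j : Fin l₁, μ' j.castSucc = (μ j).castSucc) ∧ μ' (Fin.last l₁) = Fin.last l₂ ∧
      (∃! j : Fin l₁, ((C' (Fin.last l₁)).carrier ∩ (C j).carrier).Nonempty) ∧
      (∀ j : Fin l₁, ((C' (Fin.last l₁)).carrier ∩ (C j).carrier).Nonempty →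
        ((C' (Fin.last l₁)).carrier ∩ (C j).carrier).ncard = 2) ∧
      -- the new manifold is closed, connected, non-singular real algebraic, of dimension `∑ k' + 2`
      IsSmoothSubmanifold ((∑ i, k' i) + 2) (momentManifold C' μ' k' D') ∧
      IsNonsingularAlgebraic ((∑ i, k' i) + 2) (momentManifold C' μ' k' D') ∧
      IsCompact (momentManifold C' μ' k' D') ∧
      IsConnected (momentManifold C' μ' k' D') ∧
      -- it is the zero set of a real polynomial map, if the neighbourhood of the closure of the
      -- region in the construction of the given manifold can be taken to be the whole plane
      (momentManifold C μ k D₁ = momentZeroSet C μ k →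
        momentManifold C' μ' k' D' = momentZeroSet C' μ' k') ∧
      -- the new function is Morse-Bott
      IsMorseBott (momentManifold C' μ' k' D') (momentFun k') ∧
      -- its Reeb graph is the given Reeb graph with two vertices added in the interior of `e`
      IsGraphWith (reebVertices (momentManifold C' μ' k' D') (momentFun k')) ∧
      ∃ a ∈ e, ∃ b ∈ e, a ≠ b ∧
        ∃ h : ReebSpace (momentManifold C' μ' k' D') (momentFun k') ≃ₜ
            ReebSpace (momentManifold C μ k D₁) (momentFun k),
          h '' reebVertices (momentManifold C' μ' k' D') (momentFun k') =
            reebVertices (momentManifold C μ k D₁) (momentFun k) ∪ {a, b} := by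
  refine ⟨hdata.isGraphWith_reebVertices hk, ?_⟩
  rintro e ⟨w, hw, rfl⟩ k' hk' -
  set H := hdata.reebHomeomorph hk with hH
  have hHV := hdata.image_reebVertices hk
  rw [← hH] at hHV
  have hHw : H w ∉ planeVertices D₁ C := by
    rw [← hHV, H.injective.mem_set_image]
    exact hw
  obtain ⟨x, hx⟩ := Quotient.exists_rep (H w)
  rw [← hx] at hHw
  obtain ⟨j, S, q, r₀, ρ₀, P, Q, hc, hPQ, hcorner, hP, hQ⟩ := hdata.exists_isCut x hHw
  have h' := hc.isMomentData hdata
  -- A homeomorphism respecting the vertices carries edges to edges, so classes found over the plane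
  -- region return to the given edge.
  have hcomp : ∀ z, z ∈ connectedComponentIn (planeVertices D₁ C)ᶜ (Quotient.mk _ x) →
      H.symm z ∈ connectedComponentIn
        (reebVertices (momentManifold C μ k D₁) (momentFun k))ᶜ w := by
    intro z hz
    have h1 := H.image_connectedComponentIn hw
    rw [H.image_compl, hHV, ← hx] at h1
    rw [← h1] at hz
    obtain ⟨y, hy, rfl⟩ := hz
    rwa [H.symm_apply_apply]
  have hPv := (hcorner P).2 (Or.inl rfl)
  have hQv := (hcorner Q).2 (Or.inr rfl)
  have hinter := hc.carrier_inter_eq hcorner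
  -- A corner at the height of the centre of one of its circles would be a vertical pole of that
  -- circle lying on another.
  have hold : ∀ x ∈ closure D₁, ∀ i i', i ≠ i' → (C i).val x = 0 → (C i').val x = 0 →
      x 1 ≠ (C i).center 1 := fun x _ i i' hne hi hi' h1 =>
    Set.disjoint_left.1 (hpoles i i' hne) (Or.inl ((C i).mem_verticalPoles hi h1)) hi'
  refine ⟨Fin.snoc C S, cutRegion D₁ S, Fin.snoc (fun i => (μ i).castSucc) (Fin.last l₂), h',
    hc.cutRegion_ssubset, ?_, fun i => Fin.snoc_castSucc .., fun i => Fin.snoc_castSucc ..,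
    Fin.snoc_last .., ?_, ?_, h'.isSmoothSubmanifold_momentManifold k',
    h'.isNonsingularAlgebraic_momentManifold k', h'.isCompact_momentManifold k',
    h'.isConnected_momentManifold hk', fun hZ => hc.momentManifold_eq_momentZeroSet hZ k',
    h'.isMorseBott_momentFun k' (hc.ne_center hold), h'.isGraphWith_reebVertices hk',
    H.symm (Quotient.mk _ P), hcomp _ hP, H.symm (Quotient.mk _ Q), hcomp _ hQ, ?_,
    ((h'.reebHomeomorph hk').trans (hc.reebHomeomorph hdata)).trans H.symm, ?_⟩
  · intro i
    rw [Fin.snoc_castSucc]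
    exact hc.boundary_inter_nonempty hPv hmeet i
  · rw [Fin.snoc_last]
    exact ⟨j, by beta_reduce; rw [hinter]; exact ⟨P, Or.inl rfl⟩,
      fun i hi => hc.eq_of_carrier_inter_nonempty hi⟩
  · rw [Fin.snoc_last]
    intro i hi
    rw [hc.eq_of_carrier_inter_nonempty hi, hinter]
    exact Set.ncard_pair fun he => hPQ (Subtype.ext he)
  · intro he
    exact hc.mk_ne_mk (hc.mem_ball_of_le hPv.2.le) (hc.mem_ball_of_le hQv.2.le) hPv.1 hQv.1 hPQ
      (H.symm.injective he)
  -- The outer two homeomorphisms match the vertices with classes of critical points; the middle one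
  -- adds the classes of the two corners.
  · change (H.symm ∘ hc.reebHomeomorph hdata ∘ h'.reebHomeomorph hk') '' _ = _
    rw [Set.image_comp, Set.image_comp,
      h'.image_reebVertices hk', hc.image_planeVertices hdata hcorner, Set.image_union,
      Set.image_pair, ← hHV, ← Set.image_comp, Homeomorph.symm_comp_self, Set.image_id]
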